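/- Let $d \ge 3$ be odd. For $s \in \mathbb{R}$ let $H^s = H^s(\mathbb{R}^d)$ be the usual ($L^2$-based, complex valued) Sobolev space and put $\mathcal{H}^s := H^{s+1} \oplus H^s$. Let $$ G_0 = i \begin{pmatrix} 0 & 1 \\ \Delta & 0 \end{pmatrix}, \qquad G_0 (u_0, u_1) = (i u_1, i \Delta u_0), $$ be the free wave generator, acting on pairs of tempered distributions, where $\Delta$ is the Laplacian of $\mathbb{R}^d$, and let $\langle x \rangle^{r} = (1 + |x|^2)^{r/2}$ act on pairs by multiplication of both components. Let $k \in \mathbb{N} = \{0, 1, 2, \dots\}$, $s \in \mathbb{R}$, $C > 0$ and $\varepsilon > 0$. Then, for every $z \in \mathbb{C} \setminus \mathbb{R}$, the operator $G_0 - z$ is invertible (with continuous inverse) on pairs of tempered distributions and maps $\mathcal{H}^{s+1}$ bijectively onto $\mathcal{H}^{s}$, so that the resolvent $(G_0 - z)^{-1}$ is well defined; and for every $z \in \mathbb{C} \setminus \mathbb{R}$ with $|z| \le C$ the operator $\langle x \rangle^{-k-\varepsilon} (G_0 - z)^{-k} \langle x \rangle^{-k-\varepsilon}$ is bounded from $\mathcal{H}^s$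 to $\mathcal{H}^{s+k}$, with $$ \sup_{z \in \mathbb{C} \setminus \mathbb{R},\ |z| \le C} \big\Vert \langle x \rangle^{-k-\varepsilon} (G_0 - z)^{-k} \langle x \rangle^{-k-\varepsilon} \big\Vert_{\mathcal{L}(\mathcal{H}^s, \mathcal{H}^{s+k})} < \infty . $$ -/

import Mathlib

open scoped SchwartzMap Laplacian ENNReal
open MeasureTheory TemperedDistribution

noncomputable section

namespace FreeWave

/-- The tempered distributions on `ℝ^d`. -/
abbrev Distr (d : ℕ) : Type := 𝓢'(EuclideanSpace ℝ (Fin d), ℂ)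

/-- The space `L²(ℝ^d)` of complex valued functions. -/
abbrev L2 (d : ℕ) : Type := Lp ℂ 2 (volume : Measure (EuclideanSpace ℝ (Fin d)))

/-- The Sobolev space `H^s(ℝ^d)`, as a vector space of tempered distributions. -/
def sobolevSubmodule (d : ℕ) (s : ℝ) : Submodule ℂ (Distr d) where
  carrier := {u | MemSobolev s 2 u}
  add_mem' hu hv := hu.add hv
  zero_mem' := memSobolev_fun_zero _ _ s 2
  smul_mem' c _ hu := hu.smul c

/-- The Sobolev space `H^s(ℝ^d)` as a type of its own; it carries its own norm below, and not
the topology that it would inherit from the tempered distributions. -/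
def Sobolev (d : ℕ) (s : ℝ) : Type := ↥(sobolevSubmodule d s)

namespace Sobolev

variable {d : ℕ} {s : ℝ}

instance : AddCommGroup (Sobolev d s) := inferInstanceAs (AddCommGroup ↥(sobolevSubmodule d s))

instance : Module ℂ (Sobolev d s) := inferInstanceAs (Module ℂ ↥(sobolevSubmodule d s))

/-- The inclusion of `H^s` into the tempered distributions. -/
def toDistr : Sobolev d s →ₗ[ℂ] Distr d := (sobolevSubmodule d s).subtype

theorem toDistr_injective : Function.Injective (toDistr : Sobolev d s → Distr d) :=
  Subtype.val_injective

theorem memSobolev (u : Sobolev d s) : MemSobolev s 2 u.toDistr := u.2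

theorem toTemperedDistribution_injective :
    Function.Injective (Lp.toTemperedDistributionCLM ℂ
      (volume : Measure (EuclideanSpace ℝ (Fin d))) 2) :=
  LinearMap.ker_eq_bot.mp Lp.ker_toTemperedDistributionCLM_eq_bot

theorem exists_toL2 (u : Sobolev d s) : ∃ f : L2 d,
    besselPotential (EuclideanSpace ℝ (Fin d)) ℂ s u.toDistr = Lp.toTemperedDistributionCLM ℂ
      (volume : Measure (EuclideanSpace ℝ (Fin d))) 2 f := u.memSobolev

/-- The map `u ↦ 𝓕⁻¹ (1 + ‖ξ‖²)^(s/2) 𝓕 u` from `H^s` to `L²`. -/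
def toL2 : Sobolev d s →ₗ[ℂ] L2 d where
  toFun u := u.exists_toL2.choose
  map_add' u v := by
    apply toTemperedDistribution_injective
    refine (u + v).exists_toL2.choose_spec.symm.trans ?_
    simp only [map_add]
    exact congrArg₂ (· + ·) u.exists_toL2.choose_spec v.exists_toL2.choose_spec
  map_smul' c u := by
    apply toTemperedDistribution_injective
    refine (c • u).exists_toL2.choose_spec.symm.trans ?_
    simp only [map_smul, RingHom.id_apply]
    exact congrArg (c • ·) u.exists_toL2.choose_spec

theorem besselPotential_toDistr (u : Sobolev d s) :
    besselPotential (EuclideanSpace ℝ (Fin d)) ℂ s u.toDistr = (u.toL2 : Distr d) :=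
  u.exists_toL2.choose_spec

theorem toL2_injective : Function.Injective (toL2 : Sobolev d s → L2 d) := by
  intro u v h
  apply toDistr_injective
  have h' : besselPotential (EuclideanSpace ℝ (Fin d)) ℂ s u.toDistr =
      besselPotential (EuclideanSpace ℝ (Fin d)) ℂ s v.toDistr := by
    rw [besselPotential_toDistr, besselPotential_toDistr, h]
  simpa using congrArg (besselPotential (EuclideanSpace ℝ (Fin d)) ℂ (-s)) h'

/-- The norm `‖u‖_{H^s} = ‖𝓕⁻¹ (1 + ‖ξ‖²)^(s/2) 𝓕 u‖_{L²}`. -/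
instance : NormedAddCommGroup (Sobolev d s) :=
  NormedAddCommGroup.induced (Sobolev d s) (L2 d) toL2 toL2_injective

instance : NormedSpace ℂ (Sobolev d s) := NormedSpace.induced ℂ (Sobolev d s) (L2 d) toL2

theorem norm_eq (u : Sobolev d s) : ‖u‖ = ‖u.toL2‖ := rfl

end Sobolev

/-- The Hilbert sum `𝓗^s = H^{s+1} ⊕ H^s`. -/
abbrev EnergySpace (d : ℕ) (s : ℝ) : Type := WithLp 2 (Sobolev d (s + 1) × Sobolev d s)

/-- The inclusion of `𝓗^s` into the pairs of tempered distributions. -/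
def toPair {d : ℕ} {s : ℝ} (f : EnergySpace d s) : Distr d × Distr d :=
  (f.fst.toDistr, f.snd.toDistr)

/-- The free wave generator `G₀ = i (0, 1; Δ, 0)`, so `G₀ (u₀, u₁) = (i u₁, i Δ u₀)`. -/
def freeGenerator (d : ℕ) : (Distr d × Distr d) →L[ℂ] (Distr d × Distr d) :=
  (Complex.I • ContinuousLinearMap.snd ℂ (Distr d) (Distr d)).prod
    (Complex.I • (LineDeriv.laplacianCLM ℂ (EuclideanSpace ℝ (Fin d)) (Distr d) ∘L
      ContinuousLinearMap.fst ℂ (Distr d) (Distr d)))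

/-- The operator `G₀ - z`. -/
def freeGeneratorSub (d : ℕ) (z : ℂ) : (Distr d × Distr d) →L[ℂ] (Distr d × Distr d) :=
  freeGenerator d - z • ContinuousLinearMap.id ℂ (Distr d × Distr d)

/-- The free resolvent `(G₀ - z)⁻¹` (meaningful when `G₀ - z` is invertible). -/
def freeResolvent (d : ℕ) (z : ℂ) : (Distr d × Distr d) →L[ℂ] (Distr d × Distr d) :=
  Ring.inverse (freeGeneratorSub d z)

/-- Multiplication of a distribution by `⟨x⟩^r = (1 + ‖x‖²)^(r/2)`. -/
def weight (d : ℕ) (r : ℝ) : Distr d →L[ℂ] Distr d :=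
  smulLeftCLM ℂ (fun x : EuclideanSpace ℝ (Fin d) ↦ (((1 + ‖x‖ ^ 2) ^ (r / 2) : ℝ) : ℂ))

/-- Multiplication of both components of a pair by `⟨x⟩^r`. -/
def weightPair (d : ℕ) (r : ℝ) : (Distr d × Distr d) →L[ℂ] (Distr d × Distr d) :=
  (weight d r).prodMap (weight d r)

end FreeWave

end

/-! Write ρ = 2π‖ξ‖. Since G₀² = -Δ has symbol ρ², the power (G₀ - z)⁻ᵏ equals c + s G₀, where the
scalar symbols c, s satisfy c ± ρ s = (±ρ - z)⁻ᵏ (`symC_add_mul_symS`). It suffices to bound ⟨x⟩⁻ᵃ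
m(D) ⟨x⟩⁻ᵃ with a = k + ε, uniformly in z, for m = c (order -k), m = s (order -k-1) and m = ρ² s
(order 1-k). The last case reduces to the first, because ρ² s at level k is c at level k-1 plus z
times c at level k. The reflection z ↦ -z reduces everything to Im z > 0.

There, up to constants, c and s are the integrals over t > 0 of tᵏ⁻¹ exp(izt) against cos(tρ) and
sin(tρ)/ρ. These blow up as Im z → 0, but d is odd: by the strong Huygens principle both propagators
vanish for t > 2R when tested between functions supported in a ball of radius R. So tᵏ⁻¹ may be cut
off smoothly at t ~ R without changing the pairing (`integral_symC_eq`, `integral_symS_eq`).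
Integrating by parts k times in t bounds the truncated integrals by Rᵏ (1 + ρ)⁻ᵏ, uniformly for |z|
≤ C; s gains a further 1/ρ, singular at low frequency.

The weights are split dyadically. The i-th piece of ⟨x⟩⁻ᵃ acts on Sobolev spaces with norm about
2^(-ai), and a pair (i, j) lives in a ball of radius about 2^max(i,j). A term therefore costs 2^(k
max(i,j)) 2^(-a(i+j)), which is summable since a > k. The factor 1/‖ξ‖ costs one power of the scale
of the piece that carries it (here d ≥ 3 enters), and is charged to the smaller piece
(`exists_enorm_integral_weight_le`). Duality turns the bounds on pairings into bounded operators.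

The Huygens principle is obtained from Gaussians alone. With parameter p, the transform of
exp(-πp‖x‖²) is p^(-d/2) exp(-π‖ξ‖²/p), while in one variable t the factor is p^(-1/2) with the same
exponential. If d = 2m + 1 the ratio is the integral power p⁻ᵐ. Superposing over p = 1 - 2iσ turns
multiplication by p into a derivative of the profile in τ = ‖x‖², so a function of t² tested on the
wave sees only its m-th derivative at ‖x‖² (`integral_mul_halfWave_eq`). -/

noncomputable section

namespace FreeWave

open Complex FourierTransform

/-! ### Superpositions of complex Gaussians and their Fourier transforms. -/

section Gaussians

/-- The parameter of the complex Gaussian `exp (-π (1 - 2 i σ) ‖x‖²)`. -/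
def gaussParam (σ : ℝ) : ℂ := 1 - 2 * I * σ

@[simp] theorem gaussParam_re (σ : ℝ) : (gaussParam σ).re = 1 := by simp [gaussParam]

theorem gaussParam_ne_zero (σ : ℝ) : gaussParam σ ≠ 0 := fun h => by
  have := gaussParam_re σ
  simp [h] at this

theorem continuous_gaussParam : Continuous gaussParam := by unfold gaussParam; fun_prop

theorem one_le_norm_gaussParam (σ : ℝ) : 1 ≤ ‖gaussParam σ‖ := by
  simpa using abs_re_le_norm (gaussParam σ)

theorem norm_cexp_neg_pi_gaussParam (σ τ : ℝ) :
    ‖cexp (-(Real.pi * gaussParam σ) * τ)‖ = Real.exp (-Real.pi * τ) := by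
  rw [norm_exp]
  congr 1
  simp [gaussParam]

theorem norm_cexp_neg_pi_gaussParam_le (σ : ℝ) {τ : ℝ} (hτ : 0 ≤ τ) :
    ‖cexp (-(Real.pi * gaussParam σ) * τ)‖ ≤ 1 := by
  rw [norm_cexp_neg_pi_gaussParam]
  simpa using mul_nonneg Real.pi_pos.le hτ

/-- `exp (-π τ) β τ` is a superposition of exponentials. -/
theorem exp_mul_eq_integral (β : 𝓢(ℝ, ℂ)) (τ : ℝ) :
    cexp (-Real.pi * τ) * β τ = ∫ σ : ℝ, 𝓕 β σ * cexp (-(Real.pi * gaussParam σ) * τ) := by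
  have h : β τ = ∫ σ : ℝ, cexp (↑(2 * Real.pi * inner ℝ σ τ) * I) • 𝓕 β σ := by
    conv_lhs => rw [← FourierTransform.fourierInv_fourier_eq (F := 𝓢(ℝ, ℂ)) β]
    rw [SchwartzMap.fourierInv_coe, Real.fourierInv_eq']
  rw [h, ← integral_const_mul]
  congr 1
  ext σ
  rw [smul_eq_mul, ← mul_assoc, ← Complex.exp_add, mul_comm]
  congr 2
  simp [gaussParam]
  ring

variable {V : Type*} [NormedAddCommGroup V] [InnerProductSpace ℝ V] [FiniteDimensional ℝ V]
  [MeasurableSpace V] [BorelSpace V]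

/-- The Fourier transform is symmetric for the bilinear pairing, and that of the Gaussian is
explicit. The dimension enters only through the power of the parameter. -/
theorem integral_gaussian_mul_fourier (σ : ℝ) (G : 𝓢(V, ℂ)) :
    ∫ x, cexp (-(Real.pi * gaussParam σ) * ‖x‖ ^ 2) * 𝓕 G x =
      (gaussParam σ)⁻¹ ^ (Module.finrank ℝ V / 2 : ℂ) *
        ∫ ξ, cexp (-Real.pi * (gaussParam σ)⁻¹ * ‖ξ‖ ^ 2) * G ξ := by
  have hb : 0 < (Real.pi * gaussParam σ).re := by simpa using Real.pi_pos
  have hint : Integrable (fun x : V => cexp (-(Real.pi * gaussParam σ) * ‖x‖ ^ 2)) := by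
    simpa using GaussianFourier.integrable_cexp_neg_mul_sq_norm_add hb 0 (0 : V)
  have := VectorFourier.integral_bilin_fourierIntegral_eq_flip (ContinuousLinearMap.mul ℂ ℂ)
    (L := innerₗ V) Real.continuous_fourierChar continuous_inner hint (G.integrable (μ := volume))
  simp only [flip_innerₗ, ContinuousLinearMap.mul_apply'] at this
  change ∫ ξ, 𝓕 (fun x : V => cexp (-(Real.pi * gaussParam σ) * ‖x‖ ^ 2)) ξ * G ξ = 
    ∫ x, cexp (-(Real.pi * gaussParam σ) * ‖x‖ ^ 2) * 𝓕 (G : V → ℂ) x at this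
  rw [SchwartzMap.fourier_coe, ← this, ← integral_const_mul]
  congr 1
  ext ξ
  rw [fourier_gaussian_innerProductSpace hb, ← mul_assoc]
  have hp : (Real.pi : ℂ) ≠ 0 := ofReal_ne_zero.2 Real.pi_ne_zero
  have h0 := gaussParam_ne_zero σ
  congr 2
  · congr 1
    field_simp
  · congr 1
    field_simp

/-- Integrates the Gaussian identity against `𝓕 β σ`. Fubini is available because the Gaussians have
modulus at most 1 and both transforms are integrable. -/
theorem integral_radial_mul_fourier (β : 𝓢(ℝ, ℂ)) (G : 𝓢(V, ℂ)) :
    ∫ x : V, cexp (-Real.pi * ‖x‖ ^ 2) * β (‖x‖ ^ 2) * 𝓕 G x =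
      ∫ σ : ℝ, 𝓕 β σ * ((gaussParam σ)⁻¹ ^ (Module.finrank ℝ V / 2 : ℂ) *
        ∫ ξ, cexp (-Real.pi * (gaussParam σ)⁻¹ * ‖ξ‖ ^ 2) * G ξ) := by
  simp_rw [← integral_gaussian_mul_fourier, ← integral_const_mul]
  rw [integral_integral_swap]
  · congr 1
    ext x
    have := exp_mul_eq_integral β (‖x‖ ^ 2)
    push_cast at this
    rw [this, ← integral_mul_const]
    simp_rw [mul_assoc]
  · refine Integrable.mono' (g := fun p : ℝ × V => ‖𝓕 β p.1‖ * ‖𝓕 G p.2‖) ?_ ?_ ?_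
    · exact ((𝓕 β).integrable.norm).mul_prod ((𝓕 G).integrable.norm)
    · apply Continuous.aestronglyMeasurable
      have := continuous_gaussParam
      have h1 := (𝓕 β).continuous
      have h2 := (𝓕 G).continuous
      simp only [Function.uncurry_def]
      fun_prop
    · refine Filter.Eventually.of_forall fun p => ?_
      have := norm_cexp_neg_pi_gaussParam_le p.1 (sq_nonneg ‖p.2‖)
      push_cast at this
      simp only [Function.uncurry, norm_mul]
      have h0 : 0 ≤ ‖𝓕 G p.2‖ := norm_nonneg _
      gcongr
      exact mul_le_of_le_one_left h0 this

end Gaussians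

/-! ### The strong Huygens principle in odd dimension. -/

section Huygens

/-- The operator `D = d/dτ - π`, which corresponds to differentiating `exp (-π τ) β τ`. -/
def expDeriv : 𝓢(ℝ, ℂ) →L[ℂ] 𝓢(ℝ, ℂ) :=
  SchwartzMap.derivCLM ℂ ℂ - (Real.pi : ℂ) • ContinuousLinearMap.id ℂ _

theorem expDeriv_apply (β : 𝓢(ℝ, ℂ)) (τ : ℝ) : expDeriv β τ = deriv β τ - Real.pi * β τ := by
  simp [expDeriv]

/-- The symbol of d/dτ - π is 2πiσ - π = -π(1 - 2iσ), so one factor of the Gaussian parameter is one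
derivative of the profile. -/
theorem fourier_expDeriv (β : 𝓢(ℝ, ℂ)) (σ : ℝ) :
    𝓕 (expDeriv β) σ = -Real.pi * gaussParam σ * 𝓕 β σ := by
  have h1 : 𝓕 (expDeriv β) σ =
      𝓕 (SchwartzMap.derivCLM ℂ ℂ β) σ - Real.pi * 𝓕 β σ := by
    have : expDeriv β = SchwartzMap.derivCLM ℂ ℂ β - (Real.pi : ℂ) • β := rfl
    rw [this, ← FourierTransform.fourierCLM_apply (R := ℂ), map_sub, map_smul]
    rfl
  have h2 : 𝓕 (SchwartzMap.derivCLM ℂ ℂ β) σ = 2 * Real.pi * I * σ * 𝓕 β σ := by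
    rw [SchwartzMap.fourier_coe]
    have : (SchwartzMap.derivCLM ℂ ℂ β : ℝ → ℂ) = deriv β := by
      ext; simp
    rw [this, Real.fourier_deriv β.integrable β.differentiable
      (by rw [← this]; exact SchwartzMap.integrable _)]
    simp [SchwartzMap.fourier_coe]
  rw [h1, h2, gaussParam]
  ring

theorem fourier_iterate_expDeriv (β : 𝓢(ℝ, ℂ)) (m : ℕ) (σ : ℝ) :
    𝓕 (expDeriv^[m] β) σ = (-Real.pi * gaussParam σ) ^ m * 𝓕 β σ := by
  induction m with
  | zero => simp
  | succ m ih => rw [Function.iterate_succ_apply', fourier_expDeriv, ih, pow_succ]; ring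

theorem iterate_expDeriv_eq_zero {U : Set ℝ} (hU : IsOpen U) {β : 𝓢(ℝ, ℂ)}
    (h : ∀ τ ∈ U, expDeriv β τ = 0) {m : ℕ} (hm : 1 ≤ m) : ∀ τ ∈ U, expDeriv^[m] β τ = 0 := by
  induction m, hm using Nat.le_induction with
  | base => simpa using h
  | succ m _ ih =>
    intro τ hτ
    rw [Function.iterate_succ_apply', expDeriv_apply, ih τ hτ]
    have : (expDeriv^[m] β : ℝ → ℂ) =ᶠ[nhds τ] fun _ => 0 := by
      filter_upwards [hU.mem_nhds hτ] with x hx using ih x hx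
    simp [this.deriv_eq]

variable {V : Type*} [NormedAddCommGroup V] [InnerProductSpace ℝ V] [FiniteDimensional ℝ V]
  [MeasurableSpace V] [BorelSpace V]

/-- The half wave propagator paired with `G`. -/
def halfWave (G : 𝓢(V, ℂ)) (t : ℝ) : ℂ := ∫ ξ : V, cexp (-2 * Real.pi * I * t * ‖ξ‖) * G ξ

/-- The Gaussian transform in the single variable t at frequency ρ: the same exponential as in
dimension d, with the power 1/2 instead of d/2. -/
theorem integral_gaussian_mul_cexp (σ ρ : ℝ) :
    ∫ t : ℝ, cexp (-(Real.pi * gaussParam σ) * t ^ 2) * cexp (-2 * Real.pi * I * t * ρ) =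
      (gaussParam σ)⁻¹ ^ (1 / 2 : ℂ) * cexp (-Real.pi * (gaussParam σ)⁻¹ * ρ ^ 2) := by
  have hb : 0 < (Real.pi * gaussParam σ).re := by simpa using Real.pi_pos
  have := fourierIntegral_gaussian hb (-2 * Real.pi * ρ)
  have hp : (Real.pi : ℂ) ≠ 0 := ofReal_ne_zero.2 Real.pi_ne_zero
  have h0 := gaussParam_ne_zero σ
  convert this using 2
  · ext t
    rw [mul_comm]
    congr 2
    ring
  · congr 1
    field_simp
  · congr 1
    field_simp
    ring

theorem norm_cexp_neg_two_pi_mul (t ρ : ℝ) : ‖cexp (-2 * Real.pi * I * t * ρ)‖ = 1 := by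
  rw [norm_exp]
  simp

theorem norm_halfWave_le (G : 𝓢(V, ℂ)) (t : ℝ) : ‖halfWave G t‖ ≤ ∫ ξ, ‖G ξ‖ := by
  refine (norm_integral_le_integral_norm _).trans_eq ?_
  simp_rw [norm_mul, norm_cexp_neg_two_pi_mul, one_mul]

theorem continuous_halfWave (G : 𝓢(V, ℂ)) : Continuous (halfWave G) := by
  refine continuous_of_dominated (bound := fun ξ => ‖G ξ‖) (fun t => ?_) (fun t => ?_)
    G.integrable.norm ?_
  · have := G.continuous
    exact Continuous.aestronglyMeasurable (by fun_prop)
  · simp_rw [norm_mul, norm_cexp_neg_two_pi_mul, one_mul]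
    exact Filter.Eventually.of_forall fun ξ => le_rfl
  · exact Filter.Eventually.of_forall fun ξ => by fun_prop

theorem integrable_exp_neg_pi_sq : Integrable fun t : ℝ => Real.exp (-Real.pi * t ^ 2) :=
  integrable_exp_neg_mul_sq Real.pi_pos

theorem integral_gaussian_mul_halfWave (σ : ℝ) (G : 𝓢(V, ℂ)) :
    ∫ t : ℝ, cexp (-(Real.pi * gaussParam σ) * t ^ 2) * halfWave G t =
      (gaussParam σ)⁻¹ ^ (1 / 2 : ℂ) *
        ∫ ξ : V, cexp (-Real.pi * (gaussParam σ)⁻¹ * ‖ξ‖ ^ 2) * G ξ := by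
  simp_rw [halfWave, ← integral_const_mul]
  rw [integral_integral_swap]
  · congr 1
    ext ξ
    simp_rw [← mul_assoc]
    rw [integral_mul_const, integral_gaussian_mul_cexp]
  · refine Integrable.mono' (g := fun p : ℝ × V => Real.exp (-Real.pi * p.1 ^ 2) * ‖G p.2‖)
      ?_ ?_ ?_
    · exact integrable_exp_neg_pi_sq.mul_prod G.integrable.norm
    · apply Continuous.aestronglyMeasurable
      have h2 := G.continuous
      simp only [Function.uncurry_def]
      fun_prop
    · refine Filter.Eventually.of_forall fun p => ?_
      have := norm_cexp_neg_pi_gaussParam σ (p.1 ^ 2)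
      push_cast at this
      simp only [Function.uncurry, norm_mul, norm_cexp_neg_two_pi_mul, this, one_mul]
      exact le_rfl

theorem integral_mul_halfWave (β : 𝓢(ℝ, ℂ)) (G : 𝓢(V, ℂ)) :
    ∫ t : ℝ, cexp (-Real.pi * t ^ 2) * β (t ^ 2) * halfWave G t =
      ∫ σ : ℝ, 𝓕 β σ * ((gaussParam σ)⁻¹ ^ (1 / 2 : ℂ) *
        ∫ ξ : V, cexp (-Real.pi * (gaussParam σ)⁻¹ * ‖ξ‖ ^ 2) * G ξ) := by
  simp_rw [← integral_gaussian_mul_halfWave, ← integral_const_mul]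
  rw [integral_integral_swap]
  · congr 1
    ext t
    have := exp_mul_eq_integral β (t ^ 2)
    push_cast at this
    rw [this, ← integral_mul_const]
    simp_rw [mul_assoc]
  · refine Integrable.mono' (g := fun p : ℝ × ℝ => ‖𝓕 β p.1‖ *
      (Real.exp (-Real.pi * p.2 ^ 2) * ∫ ξ, ‖G ξ‖)) ?_ ?_ ?_
    · exact ((𝓕 β).integrable.norm).mul_prod (integrable_exp_neg_pi_sq.mul_const _)
    · apply Continuous.aestronglyMeasurable
      have := continuous_gaussParam
      have h1 := (𝓕 β).continuous
      have h2 := continuous_halfWave G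
      simp only [Function.uncurry_def]
      fun_prop
    · refine Filter.Eventually.of_forall fun p => ?_
      have := norm_cexp_neg_pi_gaussParam p.1 (p.2 ^ 2)
      push_cast at this
      simp only [Function.uncurry, norm_mul, this]
      gcongr
      exact norm_halfWave_le G p.2

/-- **Strong Huygens principle**, tested against functions of `t²`. -/
theorem integral_mul_halfWave_eq {m : ℕ} (hd : Module.finrank ℝ V = 2 * m + 1) (β : 𝓢(ℝ, ℂ))
    (G : 𝓢(V, ℂ)) :
    (-Real.pi : ℂ) ^ m * ∫ t : ℝ, cexp (-Real.pi * t ^ 2) * β (t ^ 2) * halfWave G t =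
      ∫ x : V, cexp (-Real.pi * ‖x‖ ^ 2) * expDeriv^[m] β (‖x‖ ^ 2) * 𝓕 G x := by
  rw [integral_mul_halfWave, integral_radial_mul_fourier, ← integral_const_mul]
  congr 1
  ext σ
  have h0 := gaussParam_ne_zero σ
  -- Oddness of the dimension: the surplus over the one-dimensional power 1/2 is the integer m,
  -- which is cancelled exactly by m derivatives.
  have : (Module.finrank ℝ V / 2 : ℂ) = m + 1 / 2 := by rw [hd]; push_cast; ring
  rw [fourier_iterate_expDeriv, this, cpow_add _ _ (inv_ne_zero h0), cpow_natCast, mul_pow]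
  have : gaussParam σ ^ m * (gaussParam σ)⁻¹ ^ m = 1 := by
    rw [← mul_pow, mul_inv_cancel₀ h0, one_pow]
  linear_combination (-(-Real.pi : ℂ) ^ m * 𝓕 β σ * ((gaussParam σ)⁻¹ ^ (1 / 2 : ℂ) *
        ∫ ξ : V, cexp (-Real.pi * (gaussParam σ)⁻¹ * ‖ξ‖ ^ 2) * G ξ)) * this

/-- For m ≥ 1 the right-hand side of the Huygens identity contains at least one derivative of the
profile. It vanishes where ‖x‖ < R, while `𝓕 G` vanishes elsewhere. The lower end -1 makes the
interval an open set around τ = 0. -/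
theorem integral_mul_halfWave_eq_zero {m : ℕ} (hm : 1 ≤ m)
    (hd : Module.finrank ℝ V = 2 * m + 1) {R : ℝ} {β : 𝓢(ℝ, ℂ)}
    (hβ : ∀ τ ∈ Set.Ioo (-1) (R ^ 2), expDeriv β τ = 0) {G : 𝓢(V, ℂ)}
    (hG : ∀ x, R ≤ ‖x‖ → 𝓕 G x = 0) :
    ∫ t : ℝ, cexp (-Real.pi * t ^ 2) * β (t ^ 2) * halfWave G t = 0 := by
  have h := integral_mul_halfWave_eq hd β G
  have h0 : ∫ x : V, cexp (-Real.pi * ‖x‖ ^ 2) * expDeriv^[m] β (‖x‖ ^ 2) * 𝓕 G x = 0 := by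
    rw [← integral_zero V ℂ]
    congr 1
    ext x
    by_cases hx : R ≤ ‖x‖
    · rw [hG x hx, mul_zero]
    · rw [iterate_expDeriv_eq_zero isOpen_Ioo hβ hm _ ⟨?_, ?_⟩, mul_zero, zero_mul]
      · linarith [sq_nonneg ‖x‖]
      · push Not at hx
        gcongr
  rw [h0] at h
  exact (mul_eq_zero.1 h).resolve_left (pow_ne_zero _ (by simp [Real.pi_ne_zero]))

/-- The wave propagator `cos (2 π t ‖ξ‖)` paired with `G`. -/
def cosWave (G : 𝓢(V, ℂ)) (t : ℝ) : ℂ := (halfWave G t + halfWave G (-t)) / 2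

theorem continuous_cosWave (G : 𝓢(V, ℂ)) : Continuous (cosWave G) := by
  have := continuous_halfWave G
  unfold cosWave
  fun_prop

theorem cosWave_neg (G : 𝓢(V, ℂ)) (t : ℝ) : cosWave G (-t) = cosWave G t := by
  simp [cosWave, add_comm]

theorem integrable_cexp_mul_halfWave (G : 𝓢(V, ℂ)) (t : ℝ) :
    Integrable fun ξ => cexp (-2 * Real.pi * I * t * ‖ξ‖) * G ξ := by
  refine G.integrable.norm.mono' ?_ ?_
  · have := G.continuous
    exact Continuous.aestronglyMeasurable (by fun_prop)
  · simp_rw [norm_mul, norm_cexp_neg_two_pi_mul, one_mul]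
    exact Filter.Eventually.of_forall fun ξ => le_rfl

theorem cosWave_eq (G : 𝓢(V, ℂ)) (t : ℝ) :
    cosWave G t = ∫ ξ : V, Complex.cos (2 * Real.pi * t * ‖ξ‖) * G ξ := by
  unfold cosWave
  unfold halfWave
  rw [← integral_add (integrable_cexp_mul_halfWave G t) (integrable_cexp_mul_halfWave G (-t)),
    ← integral_div]
  congr 1
  ext ξ
  rw [Complex.cos]
  have h1 : -2 * Real.pi * I * t * ‖ξ‖ = -(2 * Real.pi * t * ‖ξ‖) * I := by ring
  have h2 : -2 * Real.pi * I * (-t : ℝ) * ‖ξ‖ = (2 * Real.pi * t * ‖ξ‖) * I := by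
    push_cast; ring
  rw [h1, h2]
  ring

/-- The test function is even in t, so it sees only the even part of the half wave, and the two half
lines contribute equally. -/
theorem integral_mul_cosWave_eq {b : ℝ → ℂ} (hb : Continuous b) (hb' : HasCompactSupport b)
    (G : 𝓢(V, ℂ)) (h : ∫ t : ℝ, b (t ^ 2) * halfWave G t = 0) :
    ∫ t in Set.Ioi (0 : ℝ), b (t ^ 2) * cosWave G t = 0 := by
  have hc : HasCompactSupport fun t : ℝ => b (t ^ 2) := by
    obtain ⟨r, hr⟩ := hb'.isCompact.isBounded.subset_closedBall 0
    refine HasCompactSupport.intro (isCompact_closedBall (0 : ℝ) (r + 1)) fun t ht => ?_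
    by_contra h0
    have : t ^ 2 ∈ Metric.closedBall (0 : ℝ) r := hr (subset_tsupport _ h0)
    simp only [Metric.mem_closedBall, dist_zero_right, Real.norm_eq_abs, not_le] at this ht
    rw [abs_of_nonneg (sq_nonneg t), ← sq_abs] at this
    nlinarith [abs_nonneg t]
  have hi : Integrable fun t : ℝ => b (t ^ 2) * halfWave G t :=
    ((hb.comp (by fun_prop)).mul (continuous_halfWave G)).integrable_of_hasCompactSupport
      hc.mul_right
  have hi' : Integrable fun t : ℝ => b (t ^ 2) * cosWave G t :=
    ((hb.comp (by fun_prop)).mul (continuous_cosWave G)).integrable_of_hasCompactSupport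
      hc.mul_right
  have h2 : ∫ t : ℝ, b (t ^ 2) * halfWave G (-t) = 0 := by
    rw [← h, ← integral_neg_eq_self (fun t : ℝ => b (t ^ 2) * halfWave G t)]
    simp
  have h3 : ∫ t : ℝ, b (t ^ 2) * cosWave G t = 0 := by
    have : ∀ t, b (t ^ 2) * cosWave G t =
        (1 / 2 : ℂ) * (b (t ^ 2) * halfWave G t) + (1 / 2 : ℂ) * (b (t ^ 2) * halfWave G (-t)) := by
      intro t
      simp only [cosWave]
      ring
    simp_rw [this]
    have hn : Integrable fun t : ℝ => b (t ^ 2) * halfWave G (-t) := by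
      simpa using hi.comp_neg
    rw [integral_add (hi.const_mul _) (hn.const_mul _), integral_const_mul, integral_const_mul, h,
      h2]
    simp
  have h4 : ∫ t in Set.Iic (0 : ℝ), b (t ^ 2) * cosWave G t =
      ∫ t in Set.Ioi (0 : ℝ), b (t ^ 2) * cosWave G t := by
    have := integral_comp_neg_Ioi (0 : ℝ) fun t : ℝ => b (t ^ 2) * cosWave G t
    simp only [cosWave_neg, neg_sq, neg_zero] at this
    exact this.symm
  rw [← integral_add_compl (measurableSet_Iic (a := (0 : ℝ))) hi', Set.compl_Iic, h4,
    ← two_mul] at h3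
  exact (mul_eq_zero.1 h3).resolve_left two_ne_zero

theorem integral_smooth_mul_cosWave_eq_zero {m : ℕ} (hm : 1 ≤ m)
    (hd : Module.finrank ℝ V = 2 * m + 1) {R : ℝ} {b : ℝ → ℂ} (hb : ContDiff ℝ (⊤ : ℕ∞) b)
    (hb' : HasCompactSupport b) (hbR : ∀ τ ∈ Set.Ioo (-1) (R ^ 2), deriv b τ = 0) {G : 𝓢(V, ℂ)}
    (hG : ∀ x, R ≤ ‖x‖ → 𝓕 G x = 0) :
    ∫ t in Set.Ioi (0 : ℝ), b (t ^ 2) * cosWave G t = 0 := by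
  have he : ContDiff ℝ (⊤ : ℕ∞) fun τ : ℝ => cexp (Real.pi * τ) :=
    (contDiff_const.mul ofRealCLM.contDiff).cexp
  -- Undoes the factor exp(-πτ): the operator d/dτ - π applied to exp(πτ) b is exp(πτ) b', so it
  -- vanishes where b is locally constant.
  let β : 𝓢(ℝ, ℂ) := (hb'.mul_left (f := fun τ : ℝ => cexp (Real.pi * τ))).toSchwartzMap
    (he.mul hb)
  have hβ : ∀ τ, β τ = cexp (Real.pi * τ) * b τ := fun τ => rfl
  apply integral_mul_cosWave_eq hb.continuous hb'
  rw [← integral_mul_halfWave_eq_zero hm hd (β := β) _ hG]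
  · congr 1
    ext t
    rw [hβ, ← mul_assoc, ← Complex.exp_add]
    simp
  · intro τ hτ
    have h1 : HasDerivAt (fun τ : ℝ => cexp (Real.pi * τ)) (cexp (Real.pi * τ) * Real.pi) τ := by
      have := ((hasDerivAt_id (τ : ℂ)).const_mul (Real.pi : ℂ)).cexp.comp_ofReal
      simpa using this
    have h2 := h1.mul (hb.differentiable (by simp) τ).hasDerivAt
    have h3 : deriv β τ = _ := h2.deriv
    rw [expDeriv_apply, h3, hbR τ hτ, hβ]
    ring

theorem integral_smooth_mul_cosWave {m : ℕ} (hm : 1 ≤ m) (hd : Module.finrank ℝ V = 2 * m + 1)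
    {R : ℝ} (hR : 0 < R) {G : 𝓢(V, ℂ)} (hG : ∀ x, R ≤ ‖x‖ → 𝓕 G x = 0) {g : ℝ → ℝ}
    (hg : ContDiff ℝ (⊤ : ℕ∞) g) (hgc : HasCompactSupport g) (hgR : tsupport g ⊆ Set.Ioi R) :
    ∫ t, g t • cosWave G t = 0 := by
  have hg0 : ∀ t, t ≤ R → g t = 0 := fun t ht => by
    by_contra h
    exact absurd (hgR (subset_tsupport _ h)) (by simpa using ht)
  -- The square root is not smooth at 0, but g vanishes up to R, so b is zero below R².
  let b : ℝ → ℂ := fun τ => (g (Real.sqrt τ) : ℂ)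
  have hloc : ∀ τ < R ^ 2, b =ᶠ[nhds τ] fun _ => 0 := fun τ hτ => by
    filter_upwards [Iio_mem_nhds hτ] with x hx
    simp only [b]
    rw [hg0 _ (Real.sqrt_le_iff.2 ⟨hR.le, le_of_lt hx⟩), ofReal_zero]
  have hb : ContDiff ℝ (⊤ : ℕ∞) b := by
    rw [contDiff_iff_contDiffAt]
    intro τ
    rcases lt_or_ge τ (R ^ 2) with h | h
    · exact contDiffAt_const.congr_of_eventuallyEq (hloc τ h)
    · have h0 : τ ≠ 0 := (lt_of_lt_of_le (by positivity) h).ne'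
      exact ofRealCLM.contDiff.contDiffAt.comp τ
        (hg.contDiffAt.comp τ (Real.contDiffAt_sqrt h0))
  have hbc : HasCompactSupport b := by
    obtain ⟨r, hr⟩ := hgc.isCompact.isBounded.subset_closedBall 0
    refine HasCompactSupport.intro (isCompact_closedBall (0 : ℝ) (r ^ 2)) fun τ hτ => ?_
    simp only [b, ofReal_eq_zero]
    by_contra h0
    have h1 : Real.sqrt τ ∈ Metric.closedBall (0 : ℝ) r := hr (subset_tsupport _ h0)
    rcases le_or_gt τ 0 with h2 | h2
    · exact h0 (hg0 _ (by rw [Real.sqrt_eq_zero_of_nonpos h2]; exact hR.le))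
    · simp only [Metric.mem_closedBall, dist_zero_right, Real.norm_eq_abs, not_le,
        abs_of_pos h2, abs_of_nonneg (Real.sqrt_nonneg τ)] at h1 hτ
      have h3 := Real.sq_sqrt h2.le
      nlinarith [Real.sqrt_nonneg τ]
  have h := integral_smooth_mul_cosWave_eq_zero hm hd hb hbc
    (fun τ hτ => by rw [(hloc τ hτ.2).deriv_eq]; simp) hG
  rw [← h, ← integral_indicator measurableSet_Ioi]
  congr 1
  ext t
  by_cases ht : 0 < t
  · rw [Set.indicator_of_mem (show t ∈ Set.Ioi 0 from ht)]
    simp [b, Real.sqrt_sq ht.le]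
  · rw [Set.indicator_of_notMem (by simpa using ht), hg0 t (by linarith), zero_smul]

/-- **Strong Huygens principle**: outside of the ball of radius `R` the propagator vanishes. -/
theorem cosWave_eq_zero {m : ℕ} (hm : 1 ≤ m) (hd : Module.finrank ℝ V = 2 * m + 1) {R : ℝ}
    (hR : 0 < R) {G : 𝓢(V, ℂ)} (hG : ∀ x, R ≤ ‖x‖ → 𝓕 G x = 0) {t : ℝ} (ht : R < t) :
    cosWave G t = 0 := by
  have h := isOpen_Ioi.ae_eq_zero_of_integral_contDiff_smul_eq_zero (U := Set.Ioi R)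
    (μ := volume) ((continuous_cosWave G).locallyIntegrable.locallyIntegrableOn _)
    fun g hg hgc hgR => integral_smooth_mul_cosWave hm hd hR hG hg hgc hgR
  have h' : cosWave G =ᵐ[volume.restrict (Set.Ioi R)] fun _ => 0 :=
    (ae_restrict_iff' measurableSet_Ioi).2 h
  exact Measure.eqOn_open_of_ae_eq h' isOpen_Ioi (continuous_cosWave G).continuousOn
    continuousOn_const ht

/-- A profile equal to 1 on the relevant range also has zero derivative there, so the total integral
of the cosine propagator is zero; nothing is contributed beyond R. This is the Huygens principle for
the sine propagator. -/
theorem integral_cosWave_eq_zero {m : ℕ} (hm : 1 ≤ m) (hd : Module.finrank ℝ V = 2 * m + 1)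
    {R : ℝ} (hR : 0 < R) {G : 𝓢(V, ℂ)} (hG : ∀ x, R ≤ ‖x‖ → 𝓕 G x = 0) {t : ℝ} (ht : R ≤ t) :
    ∫ s in (0)..t, cosWave G s = 0 := by
  -- The inner radius R² + 1 covers both [0, R²] and the margin down to -1.
  let θ : ContDiffBump (0 : ℝ) := ⟨R ^ 2 + 1, R ^ 2 + 2, by positivity, by linarith⟩
  let b : ℝ → ℂ := fun τ => (θ τ : ℂ)
  have hb1 : ∀ τ, |τ| ≤ R ^ 2 + 1 → b τ = 1 := fun τ hτ => by
    simp only [b]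
    rw [θ.one_of_mem_closedBall (by simpa using hτ), ofReal_one]
  have hbc : HasCompactSupport b := θ.hasCompactSupport.comp_left (g := ofReal) rfl
  have h := integral_smooth_mul_cosWave_eq_zero hm hd (b := b) (R := R) (G := G)
    (ofRealCLM.contDiff.comp θ.contDiff) hbc (fun τ hτ => ?_) hG
  · have hint : Set.indicator (Set.Ioi 0) (fun s => b (s ^ 2) * cosWave G s) =
        Set.indicator (Set.Ioc 0 t) (cosWave G) := by
      ext s
      by_cases h0 : 0 < s
      · rw [Set.indicator_of_mem (show s ∈ Set.Ioi 0 from h0)]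
        rcases le_or_gt s R with h1 | h1
        · rw [Set.indicator_of_mem (show s ∈ Set.Ioc 0 t from ⟨h0, h1.trans ht⟩), hb1, one_mul]
          rw [abs_of_nonneg (sq_nonneg s)]
          nlinarith
        · rw [cosWave_eq_zero hm hd hR hG h1, mul_zero]
          by_cases h2 : s ∈ Set.Ioc 0 t
          · rw [Set.indicator_of_mem h2, cosWave_eq_zero hm hd hR hG h1]
          · rw [Set.indicator_of_notMem h2]
      · rw [Set.indicator_of_notMem (by simpa using h0),
          Set.indicator_of_notMem (fun h => h0 h.1)]
    rw [intervalIntegral.integral_of_le (hR.le.trans ht), ← integral_indicator measurableSet_Ioc,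
      ← hint, integral_indicator measurableSet_Ioi, h]
  · have : b =ᶠ[nhds τ] fun _ => 1 := by
      filter_upwards [isOpen_Ioo.mem_nhds hτ] with x hx
      exact hb1 x (abs_le.2 ⟨by nlinarith [hx.1, sq_nonneg R], by linarith [hx.2]⟩)
    rw [this.deriv_eq]
    simp

/-! ### Time averages of the propagators, and their locality in time. -/

/-- The radial multiplier `∫ a(t) cos (2 π t ‖ξ‖) dt`. -/
def cosMultiplier (a : ℝ → ℂ) (ξ : V) : ℂ :=
  ∫ t in Set.Ioi (0 : ℝ), a t * Real.cos (t * (2 * Real.pi * ‖ξ‖))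

/-- The radial multiplier `∫ a(t) sin (2 π t ‖ξ‖) / (2 π ‖ξ‖) dt`. -/
def sinMultiplier (a : ℝ → ℂ) (ξ : V) : ℂ :=
  ∫ t in Set.Ioi (0 : ℝ), a t * (t * Real.sinc (t * (2 * Real.pi * ‖ξ‖)) : ℝ)

theorem cosWave_eq' (G : 𝓢(V, ℂ)) (t : ℝ) :
    cosWave G t = ∫ ξ : V, (Real.cos (t * (2 * Real.pi * ‖ξ‖)) : ℂ) * G ξ := by
  rw [cosWave_eq]
  congr 1
  ext ξ
  push_cast
  ring_nf

theorem integral_cos_eq_sinc (t ρ : ℝ) : ∫ s in (0)..t, Real.cos (s * ρ) = t * Real.sinc (t * ρ) := by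
  rcases eq_or_ne ρ 0 with rfl | h
  · simp
  · rw [intervalIntegral.integral_comp_mul_right (fun x => Real.cos x) h, integral_cos]
    rcases eq_or_ne t 0 with rfl | h'
    · simp
    · rw [Real.sinc_of_ne_zero (mul_ne_zero h' h)]
      simp
      field_simp

/-- Integrating cos(sρ) up to time t gives sin(tρ)/ρ, written with sinc so that ρ = 0 is included.
-/
theorem integral_cosWave_eq (G : 𝓢(V, ℂ)) {t : ℝ} (ht : 0 ≤ t) :
    ∫ s in (0)..t, cosWave G s =
      ∫ ξ : V, ((t * Real.sinc (t * (2 * Real.pi * ‖ξ‖)) : ℝ) : ℂ) * G ξ := by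
  simp_rw [cosWave_eq', intervalIntegral.integral_of_le ht]
  rw [integral_integral_swap]
  · congr 1
    ext ξ
    rw [← integral_cos_eq_sinc, intervalIntegral.integral_of_le ht, integral_mul_const]
    congr 1
    exact integral_ofReal
  · refine Integrable.mono' (g := fun p : ℝ × V => 1 * ‖G p.2‖) ?_ ?_ ?_
    · exact Integrable.mul_prod (f := fun _ : ℝ => (1 : ℝ)) (g := fun ξ => ‖G ξ‖)
        (integrable_const _) G.integrable.norm
    · apply Continuous.aestronglyMeasurable
      have h2 := G.continuous
      simp only [Function.uncurry_def]
      fun_prop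
    · refine Filter.Eventually.of_forall fun p => ?_
      simp only [Function.uncurry, norm_mul, norm_real]
      gcongr
      exact Real.abs_cos_le_one _

theorem integral_cosMultiplier_mul {a : ℝ → ℂ} (ha : IntegrableOn a (Set.Ioi 0)) (G : 𝓢(V, ℂ)) :
    ∫ ξ, cosMultiplier a ξ * G ξ = ∫ t in Set.Ioi (0 : ℝ), a t * cosWave G t := by
  simp_rw [cosMultiplier, cosWave_eq', ← integral_const_mul, ← integral_mul_const]
  rw [integral_integral_swap]
  · simp_rw [mul_assoc]
  · refine Integrable.mono' (g := fun p : V × ℝ => ‖G p.1‖ * ‖a p.2‖) ?_ ?_ ?_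
    · exact G.integrable.norm.mul_prod ha.norm
    · have h1 : AEStronglyMeasurable (fun p : V × ℝ => a p.2)
          (volume.prod (volume.restrict (Set.Ioi 0))) := ha.aestronglyMeasurable.comp_snd
      have h2 := G.continuous
      have h3 : Continuous fun p : V × ℝ =>
          (Real.cos (p.2 * (2 * Real.pi * ‖p.1‖)) : ℂ) * G p.1 := by fun_prop
      simp only [Function.uncurry_def, mul_assoc] at h3 ⊢
      exact h1.mul h3.aestronglyMeasurable
    · refine Filter.Eventually.of_forall fun p => ?_
      simp only [Function.uncurry, norm_mul, norm_real]
      rw [mul_comm ‖G p.1‖]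
      gcongr
      exact mul_le_of_le_one_right (norm_nonneg _) (Real.abs_cos_le_one _)

theorem integral_sinMultiplier_mul {a : ℝ → ℂ}
    (ha : IntegrableOn (fun t : ℝ => (t : ℂ) * a t) (Set.Ioi 0))
    (ha' : AEStronglyMeasurable a (volume.restrict (Set.Ioi 0))) (G : 𝓢(V, ℂ)) :
    ∫ ξ, sinMultiplier a ξ * G ξ =
      ∫ t in Set.Ioi (0 : ℝ), a t * ∫ s in (0)..t, cosWave G s := by
  have : ∫ t in Set.Ioi (0 : ℝ), a t * ∫ s in (0)..t, cosWave G s =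
      ∫ t in Set.Ioi (0 : ℝ), a t *
        ∫ ξ : V, ((t * Real.sinc (t * (2 * Real.pi * ‖ξ‖)) : ℝ) : ℂ) * G ξ :=
    setIntegral_congr_fun measurableSet_Ioi fun t ht => by
      rw [integral_cosWave_eq G (le_of_lt ht)]
  rw [this]
  simp_rw [sinMultiplier, ← integral_const_mul, ← integral_mul_const]
  rw [integral_integral_swap]
  · simp_rw [mul_assoc]
  · refine Integrable.mono' (g := fun p : V × ℝ => ‖G p.1‖ * ‖(p.2 : ℂ) * a p.2‖) ?_ ?_ ?_
    · exact G.integrable.norm.mul_prod ha.norm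
    · have h1 : AEStronglyMeasurable (fun p : V × ℝ => a p.2)
          (volume.prod (volume.restrict (Set.Ioi 0))) := ha'.comp_snd
      have h2 := G.continuous
      have h4 := Real.continuous_sinc
      have h3 : Continuous fun p : V × ℝ =>
          ((p.2 * Real.sinc (p.2 * (2 * Real.pi * ‖p.1‖)) : ℝ) : ℂ) * G p.1 := by fun_prop
      simp only [Function.uncurry_def, mul_assoc] at h3 ⊢
      exact h1.mul h3.aestronglyMeasurable
    · refine Filter.Eventually.of_forall fun p => ?_
      simp only [Function.uncurry, norm_mul, norm_real]
      have h1 : ‖Real.sinc (p.2 * (2 * Real.pi * ‖p.1‖))‖ ≤ 1 := Real.abs_sinc_le_one _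
      calc ‖a p.2‖ * (‖p.2‖ * ‖Real.sinc (p.2 * (2 * Real.pi * ‖p.1‖))‖) * ‖G p.1‖
          ≤ ‖a p.2‖ * (‖p.2‖ * 1) * ‖G p.1‖ := by gcongr
        _ = ‖G p.1‖ * (‖p.2‖ * ‖a p.2‖) := by ring

/-- By the Huygens principle, only the values `a t` with `t ≤ R` matter for the action of the
multiplier on functions whose transform is supported in the ball of radius `R`. -/
theorem integral_cosMultiplier_congr {m : ℕ} (hm : 1 ≤ m) (hd : Module.finrank ℝ V = 2 * m + 1)
    {R : ℝ} (hR : 0 < R) {G : 𝓢(V, ℂ)} (hG : ∀ x, R ≤ ‖x‖ → 𝓕 G x = 0) {a b : ℝ → ℂ}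
    (ha : IntegrableOn a (Set.Ioi 0)) (hb : IntegrableOn b (Set.Ioi 0))
    (hab : ∀ t, 0 < t → t ≤ R → a t = b t) :
    ∫ ξ, cosMultiplier a ξ * G ξ = ∫ ξ, cosMultiplier b ξ * G ξ := by
  rw [integral_cosMultiplier_mul ha, integral_cosMultiplier_mul hb]
  refine setIntegral_congr_fun measurableSet_Ioi fun t ht => ?_
  rcases le_or_gt t R with h | h
  · simp only [hab t ht h]
  · simp only [cosWave_eq_zero hm hd hR hG h, mul_zero]

/-- Same as the cosine case, with the primitive of the cosine propagator. The integrability of t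
a(t) reflects |sin(tρ)/ρ| ≤ t. -/
theorem integral_sinMultiplier_congr {m : ℕ} (hm : 1 ≤ m) (hd : Module.finrank ℝ V = 2 * m + 1)
    {R : ℝ} (hR : 0 < R) {G : 𝓢(V, ℂ)} (hG : ∀ x, R ≤ ‖x‖ → 𝓕 G x = 0) {a b : ℝ → ℂ}
    (ha : IntegrableOn (fun t : ℝ => (t : ℂ) * a t) (Set.Ioi 0))
    (ha' : AEStronglyMeasurable a (volume.restrict (Set.Ioi 0)))
    (hb : IntegrableOn (fun t : ℝ => (t : ℂ) * b t) (Set.Ioi 0))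
    (hb' : AEStronglyMeasurable b (volume.restrict (Set.Ioi 0)))
    (hab : ∀ t, 0 < t → t ≤ R → a t = b t) :
    ∫ ξ, sinMultiplier a ξ * G ξ = ∫ ξ, sinMultiplier b ξ * G ξ := by
  rw [integral_sinMultiplier_mul ha ha', integral_sinMultiplier_mul hb hb']
  refine setIntegral_congr_fun measurableSet_Ioi fun t ht => ?_
  rcases le_or_gt t R with h | h
  · simp only [hab t ht h]
  · simp only [integral_cosWave_eq_zero hm hd hR hG h.le, mul_zero]

end Huygens
end FreeWave

end

noncomputable section

namespace FreeWave

open Complex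

/-! ### Laplace transforms of powers of t. -/

section Laplace

theorem norm_cexp_I_mul (ζ : ℂ) (t : ℝ) : ‖cexp (I * ζ * t)‖ = Real.exp (-ζ.im * t) := by
  rw [norm_exp]
  simp

theorem norm_cexp_I_mul_le {ζ : ℂ} (hζ : 0 ≤ ζ.im) {t : ℝ} (ht : 0 ≤ t) :
    ‖cexp (I * ζ * t)‖ ≤ 1 := by
  rw [norm_cexp_I_mul]
  simpa using mul_nonneg hζ ht

theorem integrableOn_pow_mul_exp (n : ℕ) {b : ℝ} (hb : 0 < b) :
    IntegrableOn (fun t : ℝ => t ^ n * Real.exp (-b * t)) (Set.Ioi 0) := by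
  have := integrableOn_rpow_mul_exp_neg_mul_rpow (p := 1) (s := n) (b := b)
    (by linarith [(Nat.cast_nonneg n : (0 : ℝ) ≤ n)]) one_pos hb
  simpa using this

/-- A function dominated by `t ^ n`, times a decaying exponential, is integrable. -/
theorem integrableOn_mul_cexp {n : ℕ} {α : ℝ → ℂ} (hα : Continuous α)
    (hα' : ∀ t, 0 < t → ‖α t‖ ≤ t ^ n) {ζ : ℂ} (hζ : 0 < ζ.im) :
    IntegrableOn (fun t : ℝ => α t * cexp (I * ζ * t)) (Set.Ioi 0) := by
  refine (integrableOn_pow_mul_exp n hζ).mono' ?_ ?_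
  · exact Continuous.aestronglyMeasurable (by fun_prop)
  · filter_upwards [ae_restrict_mem measurableSet_Ioi] with t ht
    rw [norm_mul, norm_cexp_I_mul]
    gcongr
    exact hα' t ht

/-- Integration by parts lowers the power; the boundary terms vanish at 0 by the power and at
infinity because Im ζ > 0. -/
theorem integral_pow_mul_cexp (n : ℕ) {ζ : ℂ} (hζ : 0 < ζ.im) :
    ∫ t in Set.Ioi (0 : ℝ), (t : ℂ) ^ n * cexp (I * ζ * t) = n.factorial * (I / ζ) ^ (n + 1) := by
  have h0 : ζ ≠ 0 := fun h => by simp [h] at hζ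
  have hI : I * ζ ≠ 0 := mul_ne_zero I_ne_zero h0
  induction n with
  | zero =>
    have := integral_exp_mul_complex_Ioi (a := I * ζ) (by simpa using hζ) 0
    simp only [pow_zero, one_mul, this, ofReal_zero, mul_zero, Complex.exp_zero,
      Nat.factorial_zero, Nat.cast_one, zero_add, pow_one]
    rw [div_eq_div_iff hI h0, ← mul_assoc, I_mul_I]
  | succ n ih =>
    have hp : ∀ n : ℕ, IntegrableOn (fun t : ℝ => (t : ℂ) ^ n * cexp (I * ζ * t)) (Set.Ioi 0) :=
      fun n => integrableOn_mul_cexp (n := n) (by fun_prop)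
        (fun t ht => by simp [abs_of_pos ht]) hζ
    have hlim : Filter.Tendsto (fun t : ℝ => (t : ℂ) ^ (n + 1) * (cexp (I * ζ * t) / (I * ζ)))
        Filter.atTop (nhds 0) := by
      rw [tendsto_zero_iff_norm_tendsto_zero]
      have h1 := (Real.tendsto_pow_mul_exp_neg_atTop_nhds_zero (n + 1)).comp
        (Filter.tendsto_id.const_mul_atTop hζ)
      have h2 := h1.const_mul ((ζ.im ^ (n + 1))⁻¹ * ‖I * ζ‖⁻¹)
      rw [mul_zero] at h2
      refine h2.congr' ?_
      filter_upwards [Filter.eventually_ge_atTop 0] with t ht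
      rw [norm_mul ((t : ℂ) ^ (n + 1)), norm_div, norm_cexp_I_mul, norm_pow, norm_real, Real.norm_of_nonneg ht]
      have : ζ.im ^ (n + 1) ≠ 0 := by positivity
      simp only [Function.comp, id, neg_mul, mul_pow]
      field_simp
    have hlim0 : Filter.Tendsto (fun t : ℝ => (t : ℂ) ^ (n + 1) * (cexp (I * ζ * t) / (I * ζ)))
        (nhdsWithin 0 (Set.Ioi 0)) (nhds 0) := by
      have : Continuous fun t : ℝ => (t : ℂ) ^ (n + 1) * (cexp (I * ζ * t) / (I * ζ)) := by
        fun_prop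
      simpa using (this.tendsto 0).mono_left nhdsWithin_le_nhds
    have hparts := integral_Ioi_mul_deriv_eq_deriv_mul (a := (0 : ℝ)) (a' := (0 : ℂ)) (b' := (0 : ℂ))
      (u := fun t : ℝ => (t : ℂ) ^ (n + 1)) (v := fun t : ℝ => cexp (I * ζ * t) / (I * ζ))
      (u' := fun t : ℝ => (n + 1 : ℂ) * (t : ℂ) ^ n) (v' := fun t : ℝ => cexp (I * ζ * t))
      (fun t _ => by
        have := (hasDerivAt_pow (n + 1) (t : ℂ)).comp_ofReal
        simpa using this)
      (fun t _ => by
        have := (((hasDerivAt_id (t : ℂ)).const_mul (I * ζ)).cexp.comp_ofReal).div_const (I * ζ)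
        simpa [hI] using this)
      (hp (n + 1)) ?_ hlim0 hlim
    · rw [hparts]
      have : ∀ t : ℝ, (n + 1 : ℂ) * (t : ℂ) ^ n * (cexp (I * ζ * t) / (I * ζ)) =
          ((n + 1 : ℂ) / (I * ζ)) * ((t : ℂ) ^ n * cexp (I * ζ * t)) := fun t => by ring
      simp_rw [this]
      rw [integral_const_mul, ih, Nat.factorial_succ, pow_succ (I / ζ) (n + 1)]
      push_cast
      have : (I / ζ) = - 1 / (I * ζ) := by
        rw [div_eq_div_iff h0 hI, ← mul_assoc, I_mul_I]
      rw [this]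
      ring
    · have := (hp n).const_mul ((n + 1 : ℂ) / (I * ζ))
      refine this.congr (Filter.Eventually.of_forall fun t => ?_)
      simp only [Pi.mul_apply]
      ring

end Laplace

/-! ### Laplace transforms of truncated powers, uniform up to the real axis. -/

section Truncation

/-- A smooth cutoff which is `1` on `(-∞, 1]` and vanishes on `[2, ∞)`. -/
def cutoff (u : ℝ) : ℂ := (Real.smoothTransition (2 - u) : ℂ)

theorem contDiff_cutoff : ContDiff ℝ (⊤ : ℕ∞) cutoff :=
  ofRealCLM.contDiff.comp (Real.smoothTransition.contDiff.comp (contDiff_const.sub contDiff_id))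

theorem cutoff_eq_one {u : ℝ} (hu : u ≤ 1) : cutoff u = 1 := by
  rw [cutoff, Real.smoothTransition.one_of_one_le (by linarith), ofReal_one]

theorem cutoff_eq_zero {u : ℝ} (hu : 2 ≤ u) : cutoff u = 0 := by
  rw [cutoff, Real.smoothTransition.zero_of_nonpos (by linarith), ofReal_zero]

theorem norm_cutoff_le (u : ℝ) : ‖cutoff u‖ ≤ 1 := by
  rw [cutoff, norm_real, Real.norm_of_nonneg (Real.smoothTransition.nonneg _)]
  exact Real.smoothTransition.le_one _

/-- Decay of the one-sided Fourier transform of `u ^ n χ u` as the frequency grows. -/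
theorem exists_pow_mul_norm_integral_le (j : ℕ) : ∀ (n : ℕ) (_ : j ≤ n + 1) (χ : ℝ → ℂ)
    (_ : ContDiff ℝ (⊤ : ℕ∞) χ) (_ : ∀ u, 2 ≤ u → χ u = 0),
    ∃ K : ℝ, ∀ ζ : ℂ, 0 ≤ ζ.im →
      ‖ζ‖ ^ j * ‖∫ u in (0 : ℝ)..2, (u : ℂ) ^ n * χ u * cexp (I * ζ * u)‖ ≤ K := by
  induction j with
  | zero =>
    intro n _ χ hχ _
    refine ⟨∫ u in (0 : ℝ)..2, ‖(u : ℂ) ^ n * χ u‖, fun ζ hζ => ?_⟩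
    rw [pow_zero, one_mul]
    refine (intervalIntegral.norm_integral_le_integral_norm (by norm_num)).trans ?_
    have hc := hχ.continuous
    refine intervalIntegral.integral_mono_on (by norm_num)
      (Continuous.intervalIntegrable (by fun_prop) _ _)
      (Continuous.intervalIntegrable (by fun_prop) _ _) fun u hu => ?_
    rw [norm_mul]
    exact mul_le_of_le_one_right (norm_nonneg _) (norm_cexp_I_mul_le hζ hu.1)
  | succ j ih =>
    intro n hn χ hχ hχ2
    have hχ' : ContDiff ℝ (⊤ : ℕ∞) (deriv χ) := (contDiff_infty_iff_deriv.1 hχ).2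
    have hχ'2 : ∀ u, 2 ≤ u → deriv χ u = 0 := by
      have h1 : ∀ u ∈ Set.Ioi (2 : ℝ), deriv χ u = 0 := fun u hu => by
        have : χ =ᶠ[nhds u] fun _ => 0 := by
          filter_upwards [Ioi_mem_nhds hu] with x hx using hχ2 x (le_of_lt hx)
        simp [this.deriv_eq]
      intro u hu
      have h2 : Set.EqOn (deriv χ) (fun _ => 0) (closure (Set.Ioi 2)) :=
        Set.EqOn.closure h1 hχ'.continuous continuous_const
      exact h2 (by rw [closure_Ioi]; exact hu)
    obtain ⟨K₁, hK₁⟩ := ih n (by omega) (deriv χ) hχ' hχ'2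
    -- The term where the derivative falls on u ^ n. For n = 0 the truncated exponent n - 1 is
    -- harmless, since the coefficient n is zero.
    obtain ⟨K₂, hK₂⟩ : ∃ K : ℝ, ∀ ζ : ℂ, 0 ≤ ζ.im → ‖ζ‖ ^ j * (‖(n : ℂ)‖ *
        ‖∫ u in (0 : ℝ)..2, (u : ℂ) ^ (n - 1) * χ u * cexp (I * ζ * u)‖) ≤ K := by
      rcases n with _ | n
      · exact ⟨0, fun ζ _ => by simp⟩
      · obtain ⟨K, hK⟩ := ih n (by omega) χ hχ hχ2
        refine ⟨‖((n + 1 : ℕ) : ℂ)‖ * K, fun ζ hζ => ?_⟩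
        have := mul_le_mul_of_nonneg_left (hK ζ hζ) (norm_nonneg ((n + 1 : ℕ) : ℂ))
        simp only [Nat.add_sub_cancel]
        linarith
    -- The boundary term at 0 survives only for n = 0, and then j + 1 ≤ n + 1 forces j = 0. This is
    -- why n + 1 integrations by parts are possible and no more are claimed.
    obtain ⟨K₃, hK₃⟩ : ∃ K : ℝ, ∀ ζ : ℂ, ‖ζ‖ ^ j * ‖(0 : ℂ) ^ n * χ 0‖ ≤ K := by
      rcases n with _ | n
      · obtain rfl : j = 0 := by omega
        exact ⟨‖χ 0‖, fun ζ => by simp⟩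
      · exact ⟨0, fun ζ => by simp⟩
    refine ⟨K₁ + K₂ + K₃, fun ζ hζ => ?_⟩
    have hc := hχ.continuous
    have hc' := hχ'.continuous
    have hd : ∀ u : ℝ, HasDerivAt (fun u : ℝ => (u : ℂ) ^ n * χ u)
        (n * (u : ℂ) ^ (n - 1) * χ u + (u : ℂ) ^ n * deriv χ u) u := fun u => by
      have h1 := (hasDerivAt_pow n (u : ℂ)).comp_ofReal
      exact h1.mul (hχ.differentiable (by simp) u).hasDerivAt
    have hparts := intervalIntegral.integral_mul_deriv_eq_deriv_mul (a := 0) (b := 2)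
      (u := fun u : ℝ => (u : ℂ) ^ n * χ u) (v := fun u : ℝ => cexp (I * ζ * u))
      (v' := fun u : ℝ => cexp (I * ζ * u) * (I * ζ))
      (fun u _ => hd u)
      (fun u _ => by
        have := ((hasDerivAt_id (u : ℂ)).const_mul (I * ζ)).cexp.comp_ofReal
        simpa using this)
      (Continuous.intervalIntegrable (by fun_prop) _ _)
      (Continuous.intervalIntegrable (by fun_prop) _ _)
    have h1 : ∫ u in (0 : ℝ)..2, (u : ℂ) ^ n * χ u * (cexp (I * ζ * u) * (I * ζ)) =
        (∫ u in (0 : ℝ)..2, (u : ℂ) ^ n * χ u * cexp (I * ζ * u)) * (I * ζ) := by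
      rw [← intervalIntegral.integral_mul_const]
      simp_rw [mul_assoc]
    have h2 : ∫ u in (0 : ℝ)..2, (n * (u : ℂ) ^ (n - 1) * χ u + (u : ℂ) ^ n * deriv χ u) *
          cexp (I * ζ * u) =
        n * (∫ u in (0 : ℝ)..2, (u : ℂ) ^ (n - 1) * χ u * cexp (I * ζ * u)) +
        ∫ u in (0 : ℝ)..2, (u : ℂ) ^ n * deriv χ u * cexp (I * ζ * u) := by
      rw [← intervalIntegral.integral_const_mul, ← intervalIntegral.integral_add
        (Continuous.intervalIntegrable (by fun_prop) _ _)
        (Continuous.intervalIntegrable (by fun_prop) _ _)]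
      congr 1
      ext u
      ring
    rw [h1, h2, hχ2 2 le_rfl] at hparts
    have h3 : ‖∫ u in (0 : ℝ)..2, (u : ℂ) ^ n * χ u * cexp (I * ζ * u)‖ * ‖ζ‖ ≤
        ‖(0 : ℂ) ^ n * χ 0‖ +
        (‖(n : ℂ)‖ * ‖∫ u in (0 : ℝ)..2, (u : ℂ) ^ (n - 1) * χ u * cexp (I * ζ * u)‖ +
        ‖∫ u in (0 : ℝ)..2, (u : ℂ) ^ n * deriv χ u * cexp (I * ζ * u)‖) := by
      have := congrArg norm hparts
      rw [norm_mul, norm_mul, norm_I, one_mul] at this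
      rw [this]
      simp only [mul_zero, zero_mul, ofReal_zero, zero_sub, Complex.exp_zero, mul_one]
      refine (norm_sub_le _ _).trans ?_
      rw [norm_neg, ← norm_mul (n : ℂ)]
      gcongr
      exact norm_add_le _ _
    calc ‖ζ‖ ^ (j + 1) * ‖∫ u in (0 : ℝ)..2, (u : ℂ) ^ n * χ u * cexp (I * ζ * u)‖
        = ‖ζ‖ ^ j * (‖∫ u in (0 : ℝ)..2, (u : ℂ) ^ n * χ u * cexp (I * ζ * u)‖ * ‖ζ‖) := by ring
      _ ≤ _ := mul_le_mul_of_nonneg_left h3 (by positivity)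
      _ ≤ K₁ + K₂ + K₃ := by
        have := hK₁ ζ hζ
        have := hK₂ ζ hζ
        have := hK₃ ζ
        linarith

/-- The truncation of `t ^ n` at scale `T`. -/
def powTrunc (n : ℕ) (T : ℝ) (t : ℝ) : ℂ := (t : ℂ) ^ n * cutoff (t / T)

theorem continuous_powTrunc (n : ℕ) (T : ℝ) : Continuous (powTrunc n T) := by
  have := contDiff_cutoff.continuous
  unfold powTrunc
  fun_prop

theorem norm_powTrunc_le (n : ℕ) (T : ℝ) {t : ℝ} (ht : 0 < t) : ‖powTrunc n T t‖ ≤ t ^ n := by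
  rw [powTrunc, norm_mul, norm_pow, norm_real, Real.norm_of_nonneg ht.le]
  exact mul_le_of_le_one_right (by positivity) (norm_cutoff_le _)

theorem powTrunc_eq_pow (n : ℕ) {T t : ℝ} (hT : 0 < T) (ht : t ≤ T) :
    powTrunc n T t = (t : ℂ) ^ n := by
  rw [powTrunc, cutoff_eq_one ((div_le_one hT).2 ht), mul_one]

theorem integral_powTrunc_mul_cexp (n : ℕ) {T : ℝ} (hT : 0 < T) (ζ : ℂ) :
    ∫ t in Set.Ioi (0 : ℝ), powTrunc n T t * cexp (I * ζ * t) =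
      T ^ (n + 1) * ∫ u in (0 : ℝ)..2, (u : ℂ) ^ n * cutoff u * cexp (I * (T * ζ) * u) := by
  have h := integral_comp_mul_left_Ioi' (fun t : ℝ => powTrunc n T t * cexp (I * ζ * t)) 0 hT
  rw [mul_zero] at h
  have h2 : ∫ u in Set.Ioi (0 : ℝ), (u : ℂ) ^ n * cutoff u * cexp (I * (T * ζ) * u) =
      ∫ u in Set.Ioc (0 : ℝ) 2, (u : ℂ) ^ n * cutoff u * cexp (I * (T * ζ) * u) := by
    refine setIntegral_eq_of_subset_of_forall_sdiff_eq_zero measurableSet_Ioi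
      Set.Ioc_subset_Ioi_self fun u hu => ?_
    have : 2 ≤ u := by
      by_contra h
      exact hu.2 ⟨hu.1, by linarith⟩
    simp [cutoff_eq_zero this]
  rw [← h, real_smul, intervalIntegral.integral_of_le (by norm_num), ← h2, ← integral_const_mul,
    ← integral_const_mul]
  congr 1
  ext u
  rw [powTrunc, mul_div_cancel_left₀ _ hT.ne']
  push_cast
  ring_nf

/-- After rescaling t = T u the frequency is Tζ. No integration by parts controls the part 1 of (1 +
‖ζ‖)^(n+1), and n + 1 of them control the part ‖ζ‖^(n+1). No positive lower bound on Im ζ is needed.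
-/
theorem exists_one_add_pow_mul_norm_integral_le (n : ℕ) : ∃ K : ℝ, ∀ T : ℝ, 1 ≤ T → ∀ ζ : ℂ,
    0 ≤ ζ.im → (1 + ‖ζ‖) ^ (n + 1) *
      ‖∫ t in Set.Ioi (0 : ℝ), powTrunc n T t * cexp (I * ζ * t)‖ ≤ K * T ^ (n + 1) := by
  obtain ⟨K₀, h₀⟩ := exists_pow_mul_norm_integral_le 0 n (by omega) cutoff contDiff_cutoff
    fun u => cutoff_eq_zero
  obtain ⟨K₁, h₁⟩ := exists_pow_mul_norm_integral_le (n + 1) n le_rfl cutoff contDiff_cutoff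
    fun u => cutoff_eq_zero
  refine ⟨2 ^ n * (K₀ + K₁), fun T hT ζ hζ => ?_⟩
  have hT0 : 0 < T := by linarith
  have him : 0 ≤ ((T : ℂ) * ζ).im := by simpa using mul_nonneg hT0.le hζ
  rw [integral_powTrunc_mul_cexp n hT0]
  set J := ∫ u in (0 : ℝ)..2, (u : ℂ) ^ n * cutoff u * cexp (I * (T * ζ) * u) with hJ
  have e₀ := h₀ _ him
  have e₁ := h₁ _ him
  rw [← hJ] at e₀ e₁
  rw [pow_zero, one_mul] at e₀
  rw [norm_mul, norm_real, Real.norm_of_nonneg hT0.le, mul_pow] at e₁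
  rw [norm_mul, norm_pow, norm_real, Real.norm_of_nonneg hT0.le]
  have hp := add_pow_le (zero_le_one (α := ℝ)) (norm_nonneg ζ) (n + 1)
  rw [one_pow, Nat.add_sub_cancel] at hp
  have hTp : 1 ≤ T ^ (n + 1) := one_le_pow₀ hT
  have hK₁ : 0 ≤ K₁ := le_trans (by positivity) e₁
  calc (1 + ‖ζ‖) ^ (n + 1) * (T ^ (n + 1) * ‖J‖)
      ≤ 2 ^ n * (1 + ‖ζ‖ ^ (n + 1)) * (T ^ (n + 1) * ‖J‖) := by gcongr
    _ = 2 ^ n * (T ^ (n + 1) * ‖J‖ + T ^ (n + 1) * ‖ζ‖ ^ (n + 1) * ‖J‖) := by ring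
    _ ≤ 2 ^ n * (T ^ (n + 1) * K₀ + K₁ * T ^ (n + 1)) := by
      refine mul_le_mul_of_nonneg_left (add_le_add ?_ ?_) (by positivity)
      · gcongr
      · exact e₁.trans (le_mul_of_one_le_right hK₁ hTp)
    _ = _ := by ring

end Truncation

/-! ### The symbols of the resolvent powers and their time representations. -/

section Symbols

variable {V : Type*} [NormedAddCommGroup V]

/-- Splitting the cosine into exponentials leaves two Laplace transforms, at the frequencies z ± ρ.
-/
theorem cosMultiplier_eq {n : ℕ} {α : ℝ → ℂ} (hα : Continuous α)
    (hα' : ∀ t, 0 < t → ‖α t‖ ≤ t ^ n) {z : ℂ} (hz : 0 < z.im) (ξ : V) :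
    cosMultiplier (fun t => α t * cexp (I * z * t)) ξ =
      ((∫ t in Set.Ioi (0 : ℝ), α t * cexp (I * (z + (2 * Real.pi * ‖ξ‖ : ℝ)) * t)) +
        ∫ t in Set.Ioi (0 : ℝ), α t * cexp (I * (z - (2 * Real.pi * ‖ξ‖ : ℝ)) * t)) / 2 := by
  rw [← integral_add (integrableOn_mul_cexp hα hα' (by simpa using hz))
    (integrableOn_mul_cexp hα hα' (by simpa using hz)), ← integral_div, cosMultiplier]
  congr 1
  ext t
  set ρ : ℝ := 2 * Real.pi * ‖ξ‖
  have h1 : I * (z + ρ) * t = I * z * t + (t * ρ) * I := by ring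
  have h2 : I * (z - ρ) * t = I * z * t + -(t * ρ) * I := by ring
  rw [h1, h2, Complex.exp_add, Complex.exp_add, ofReal_cos, Complex.cos]
  push_cast
  ring

theorem mul_sinMultiplier_eq {n : ℕ} {α : ℝ → ℂ} (hα : Continuous α)
    (hα' : ∀ t, 0 < t → ‖α t‖ ≤ t ^ n) {z : ℂ} (hz : 0 < z.im) (ξ : V) :
    (2 * Real.pi * ‖ξ‖ : ℝ) * sinMultiplier (fun t => α t * cexp (I * z * t)) ξ =
      ((∫ t in Set.Ioi (0 : ℝ), α t * cexp (I * (z + (2 * Real.pi * ‖ξ‖ : ℝ)) * t)) -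
        ∫ t in Set.Ioi (0 : ℝ), α t * cexp (I * (z - (2 * Real.pi * ‖ξ‖ : ℝ)) * t)) / (2 * I) := by
  rw [← integral_sub (integrableOn_mul_cexp hα hα' (by simpa using hz))
    (integrableOn_mul_cexp hα hα' (by simpa using hz)), ← integral_div, sinMultiplier,
    ← integral_const_mul]
  refine setIntegral_congr_fun measurableSet_Ioi fun t ht => ?_
  set ρ : ℝ := 2 * Real.pi * ‖ξ‖
  have h0 : ρ * (t * Real.sinc (t * ρ)) = Real.sin (t * ρ) := by
    rcases eq_or_ne ρ 0 with h | h
    · simp [h]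
    · have ht : t ≠ 0 := ne_of_gt ht
      rw [Real.sinc_of_ne_zero (mul_ne_zero ht h)]
      field_simp
  have h0' : (ρ : ℂ) * ((t * Real.sinc (t * ρ) : ℝ) : ℂ) = Complex.sin (t * ρ) := by
    rw [← ofReal_mul, h0]
    push_cast
    rfl
  have h1 : I * (z + ρ) * t = I * z * t + (t * ρ) * I := by ring
  have h2 : I * (z - ρ) * t = I * z * t + -(t * ρ) * I := by ring
  rw [mul_left_comm, h0', h1, h2, Complex.exp_add, Complex.exp_add, Complex.sin]
  field_simp
  rw [I_sq]
  ring

theorem one_add_le_mul_one_add_norm_add {C ρ : ℝ} {z w : ℂ} (hz : ‖z‖ ≤ C)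
    (hw : ‖w‖ = ρ) : 1 + ρ ≤ (1 + C) * (1 + ‖z + w‖) := by
  have h : ρ ≤ ‖z + w‖ + C := by
    have := norm_sub_le (z + w) z
    rw [add_sub_cancel_left, hw] at this
    linarith
  have hC : 0 ≤ C := (norm_nonneg z).trans hz
  nlinarith [norm_nonneg (z + w)]

/-- Converts decay in z + r into decay in ρ = |r|: for ‖z‖ ≤ C one has 1 + ρ ≤ (1 + C)(1 + ‖z + r‖),
so the bound on z is essential here. -/
theorem exists_norm_integral_powTrunc_le (n : ℕ) (C : ℝ) : ∃ K : ℝ, 0 ≤ K ∧ ∀ T : ℝ, 1 ≤ T →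
    ∀ z : ℂ, 0 < z.im → ‖z‖ ≤ C → ∀ ρ r : ℝ, |r| = ρ →
      (1 + ρ) ^ (n + 1) * ‖∫ t in Set.Ioi (0 : ℝ), powTrunc n T t * cexp (I * (z + r) * t)‖ ≤
        K * T ^ (n + 1) := by
  obtain ⟨K, hK⟩ := exists_one_add_pow_mul_norm_integral_le n
  -- Read off from the estimate itself at T = 1, ζ = 0.
  have hK0 : 0 ≤ K := by
    have := hK 1 le_rfl 0 (by simp)
    simp only [one_pow, mul_one] at this
    exact le_trans (by positivity) this
  refine ⟨(1 + |C|) ^ (n + 1) * K, by positivity, fun T hT z hz hzC ρ r hr => ?_⟩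
  have h := hK T hT (z + r) (by simpa using hz.le)
  have hρ : 0 ≤ ρ := hr ▸ abs_nonneg r
  have h1 : 1 + ρ ≤ (1 + |C|) * (1 + ‖z + r‖) :=
    one_add_le_mul_one_add_norm_add (hzC.trans (le_abs_self C)) (by simpa using hr)
  calc _ ≤ ((1 + |C|) * (1 + ‖z + r‖)) ^ (n + 1) *
        ‖∫ t in Set.Ioi (0 : ℝ), powTrunc n T t * cexp (I * (z + r) * t)‖ := by gcongr
    _ = (1 + |C|) ^ (n + 1) * ((1 + ‖z + r‖) ^ (n + 1) *
        ‖∫ t in Set.Ioi (0 : ℝ), powTrunc n T t * cexp (I * (z + r) * t)‖) := by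
      rw [mul_pow]; ring
    _ ≤ (1 + |C|) ^ (n + 1) * (K * T ^ (n + 1)) := by gcongr
    _ = _ := by ring

theorem exists_norm_cosMultiplier_le (V : Type*) [NormedAddCommGroup V] (n : ℕ) (C : ℝ) :
    ∃ K : ℝ, 0 ≤ K ∧ ∀ T : ℝ, 1 ≤ T → ∀ z : ℂ, 0 < z.im → ‖z‖ ≤ C → ∀ ξ : V,
      (1 + 2 * Real.pi * ‖ξ‖) ^ (n + 1) *
        ‖cosMultiplier (fun t => powTrunc n T t * cexp (I * z * t)) ξ‖ ≤ K * T ^ (n + 1) := by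
  obtain ⟨K, hK0, hK⟩ := exists_norm_integral_powTrunc_le n C
  refine ⟨K, hK0, fun T hT z hz hzC ξ => ?_⟩
  rw [cosMultiplier_eq (continuous_powTrunc n T) (fun t => norm_powTrunc_le n T) hz]
  have hρ : |2 * Real.pi * ‖ξ‖| = 2 * Real.pi * ‖ξ‖ := abs_of_nonneg (by positivity)
  have h1 := hK T hT z hz hzC _ (2 * Real.pi * ‖ξ‖) hρ
  have h2 := hK T hT z hz hzC _ (-(2 * Real.pi * ‖ξ‖)) ((abs_neg _).trans hρ)
  rw [ofReal_neg, ← sub_eq_add_neg] at h2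
  rw [norm_div, Complex.norm_two]
  set A := ∫ t in Set.Ioi (0 : ℝ), powTrunc n T t * cexp (I * (z + (2 * Real.pi * ‖ξ‖ : ℝ)) * t)
  set B := ∫ t in Set.Ioi (0 : ℝ), powTrunc n T t * cexp (I * (z - (2 * Real.pi * ‖ξ‖ : ℝ)) * t)
  have h3 : (1 + 2 * Real.pi * ‖ξ‖) ^ (n + 1) * ‖A + B‖ ≤
      (1 + 2 * Real.pi * ‖ξ‖) ^ (n + 1) * (‖A‖ + ‖B‖) := by
    gcongr
    exact norm_add_le _ _
  linarith

/-- Only ρ times the multiplier is controlled uniformly; dividing by ρ leaves the low-frequency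
singularity that is treated later by a weight. -/
theorem exists_norm_sinMultiplier_le (V : Type*) [NormedAddCommGroup V] (n : ℕ) (C : ℝ) :
    ∃ K : ℝ, 0 ≤ K ∧ ∀ T : ℝ, 1 ≤ T → ∀ z : ℂ, 0 < z.im → ‖z‖ ≤ C → ∀ ξ : V,
      (1 + 2 * Real.pi * ‖ξ‖) ^ (n + 1) * ((2 * Real.pi * ‖ξ‖) *
        ‖sinMultiplier (fun t => powTrunc n T t * cexp (I * z * t)) ξ‖) ≤ K * T ^ (n + 1) := by
  obtain ⟨K, hK0, hK⟩ := exists_norm_integral_powTrunc_le n C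
  refine ⟨K, hK0, fun T hT z hz hzC ξ => ?_⟩
  have hρ : |2 * Real.pi * ‖ξ‖| = 2 * Real.pi * ‖ξ‖ := abs_of_nonneg (by positivity)
  have h := congrArg norm
    (mul_sinMultiplier_eq (continuous_powTrunc n T) (fun t => norm_powTrunc_le n T) hz ξ)
  rw [norm_mul, norm_real, Real.norm_eq_abs, hρ] at h
  rw [h]
  have h1 := hK T hT z hz hzC _ (2 * Real.pi * ‖ξ‖) hρ
  have h2 := hK T hT z hz hzC _ (-(2 * Real.pi * ‖ξ‖)) ((abs_neg _).trans hρ)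
  rw [ofReal_neg, ← sub_eq_add_neg] at h2
  rw [norm_div, norm_mul, Complex.norm_two, norm_I, mul_one]
  set A := ∫ t in Set.Ioi (0 : ℝ), powTrunc n T t * cexp (I * (z + (2 * Real.pi * ‖ξ‖ : ℝ)) * t)
  set B := ∫ t in Set.Ioi (0 : ℝ), powTrunc n T t * cexp (I * (z - (2 * Real.pi * ‖ξ‖ : ℝ)) * t)
  have h3 : (1 + 2 * Real.pi * ‖ξ‖) ^ (n + 1) * ‖A - B‖ ≤
      (1 + 2 * Real.pi * ‖ξ‖) ^ (n + 1) * (‖A‖ + ‖B‖) := by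
    gcongr
    exact norm_sub_le _ _
  linarith

/-- The symbol of `(-Δ - z²)⁻¹`. -/
def symL (z : ℂ) (ξ : V) : ℂ := (((2 * Real.pi * ‖ξ‖) ^ 2 : ℝ) - z ^ 2)⁻¹

/-- The symbols `(c, s)` with `(G₀ - z)⁻ᵏ = c + s G₀`. -/
def symPair (z : ℂ) : ℕ → V → ℂ × ℂ
  | 0, _ => (1, 0)
  | k + 1, ξ => (symL z ξ * (z * (symPair z k ξ).1 +
      ((2 * Real.pi * ‖ξ‖) ^ 2 : ℝ) * (symPair z k ξ).2),
      symL z ξ * (z * (symPair z k ξ).2 + (symPair z k ξ).1))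

/-- The even part of the symbol of `(G₀ - z)⁻ᵏ`. -/
def symC (z : ℂ) (k : ℕ) (ξ : V) : ℂ := (symPair z k ξ).1

/-- The odd part of the symbol of `(G₀ - z)⁻ᵏ`, divided by `G₀`. -/
def symS (z : ℂ) (k : ℕ) (ξ : V) : ℂ := (symPair z k ξ).2

@[simp] theorem symC_zero (z : ℂ) (ξ : V) : symC z 0 ξ = 1 := rfl

@[simp] theorem symS_zero (z : ℂ) (ξ : V) : symS z 0 ξ = 0 := rfl

theorem symC_succ (z : ℂ) (k : ℕ) (ξ : V) : symC z (k + 1) ξ =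
    symL z ξ * (z * symC z k ξ + ((2 * Real.pi * ‖ξ‖) ^ 2 : ℝ) * symS z k ξ) := rfl

theorem symS_succ (z : ℂ) (k : ℕ) (ξ : V) : symS z (k + 1) ξ =
    symL z ξ * (z * symS z k ξ + symC z k ξ) := rfl

theorem ofReal_sub_ne_zero {z : ℂ} (hz : z.im ≠ 0) (r : ℝ) : (r : ℂ) - z ≠ 0 := fun h => by
  have := congrArg Complex.im h
  simp [hz] at this

theorem sq_sub_sq_ne_zero {z : ℂ} (hz : z.im ≠ 0) (r : ℝ) : ((r ^ 2 : ℝ) : ℂ) - z ^ 2 ≠ 0 := by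
  have h1 := ofReal_sub_ne_zero hz r
  have h2 := ofReal_sub_ne_zero (z := -z) (by simpa using hz) r
  have : ((r ^ 2 : ℝ) : ℂ) - z ^ 2 = (r - z) * (r - -z) := by push_cast; ring
  rw [this]
  exact mul_ne_zero h1 h2

/-- The recursion multiplies c + r s by (r - z)⁻¹ = (r + z)/(ρ² - z²) and reduces r² to ρ². Taking r
= ±ρ identifies both symbols. -/
theorem symC_add_mul_symS {z : ℂ} (hz : z.im ≠ 0) (k : ℕ) (ξ : V) {r : ℝ}
    (hr : r ^ 2 = (2 * Real.pi * ‖ξ‖) ^ 2) :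
    symC z k ξ + r * symS z k ξ = ((r - z)⁻¹) ^ k := by
  induction k with
  | zero => simp
  | succ k ih =>
    have h1 := ofReal_sub_ne_zero hz r
    have h2 := sq_sub_sq_ne_zero hz r
    rw [pow_succ, ← ih, symC_succ, symS_succ, symL, ← hr]
    field_simp
    push_cast
    ring

theorem symC_eq {z : ℂ} (hz : z.im ≠ 0) (k : ℕ) (ξ : V) :
    2 * symC z k ξ = (((2 * Real.pi * ‖ξ‖ : ℝ) - z)⁻¹) ^ k +
      ((-(2 * Real.pi * ‖ξ‖ : ℝ) - z)⁻¹) ^ k := by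
  have h1 := symC_add_mul_symS hz k ξ (r := 2 * Real.pi * ‖ξ‖) rfl
  have h2 := symC_add_mul_symS hz k ξ (r := -(2 * Real.pi * ‖ξ‖)) (by ring)
  rw [ofReal_neg] at h2
  linear_combination h1 + h2

theorem mul_symS_eq {z : ℂ} (hz : z.im ≠ 0) (k : ℕ) (ξ : V) :
    2 * (2 * Real.pi * ‖ξ‖ : ℝ) * symS z k ξ = (((2 * Real.pi * ‖ξ‖ : ℝ) - z)⁻¹) ^ k -
      ((-(2 * Real.pi * ‖ξ‖ : ℝ) - z)⁻¹) ^ k := by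
  have h1 := symC_add_mul_symS hz k ξ (r := 2 * Real.pi * ‖ξ‖) rfl
  have h2 := symC_add_mul_symS hz k ξ (r := -(2 * Real.pi * ‖ξ‖)) (by ring)
  rw [ofReal_neg] at h2
  linear_combination h1 - h2

/-- The even part of (G₀ - z)(G₀ - z)⁻⁽ᵏ⁺¹⁾ = (G₀ - z)⁻ᵏ. It removes the need for a separate
estimate of the lower left entry. -/
theorem sq_mul_symS_succ {z : ℂ} (hz : z.im ≠ 0) (k : ℕ) (ξ : V) :
    ((2 * Real.pi * ‖ξ‖) ^ 2 : ℝ) * symS z (k + 1) ξ = symC z k ξ + z * symC z (k + 1) ξ := by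
  have := sq_sub_sq_ne_zero hz (2 * Real.pi * ‖ξ‖)
  rw [symS_succ, symC_succ, symL]
  generalize (((2 * Real.pi * ‖ξ‖) ^ 2 : ℝ) : ℂ) = q at *
  field_simp
  ring

/-- Reflecting z exchanges ρ and -ρ up to sign, so the lower half plane follows from the upper one.
-/
theorem neg_symmetry_symPair (z : ℂ) (k : ℕ) (ξ : V) :
    symC (-z) k ξ = (-1) ^ k * symC z k ξ ∧ symS (-z) k ξ = (-1) ^ (k + 1) * symS z k ξ := by
  induction k with
  | zero => simp
  | succ k ih =>
    have : symL (-z) ξ = symL z ξ := by simp [symL]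
    rw [symC_succ, symS_succ, symC_succ, symS_succ, ih.1, ih.2, this]
    constructor <;> ring

theorem symC_succ_eq_cosMultiplier {z : ℂ} (hz : 0 < z.im) (n : ℕ) (ξ : V) :
    symC z (n + 1) ξ =
      (I ^ (n + 1) / n.factorial) * cosMultiplier (fun t => (t : ℂ) ^ n * cexp (I * z * t)) ξ := by
  rw [cosMultiplier_eq (n := n) (by fun_prop) (fun t ht => by simp [abs_of_pos ht]) hz,
    integral_pow_mul_cexp n (by simpa using hz), integral_pow_mul_cexp n (by simpa using hz)]
  have h := symC_eq hz.ne' (n + 1) ξ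
  set ρ : ℂ := ((2 * Real.pi * ‖ξ‖ : ℝ) : ℂ)
  have hf : (n.factorial : ℂ) ≠ 0 := Nat.cast_ne_zero.2 n.factorial_ne_zero
  have hI : (I ^ 2 : ℂ) = -1 := I_sq
  have e1 : (ρ - z)⁻¹ = I * (I / (z - ρ)) := by
    rw [← mul_div_assoc, I_mul_I, ← neg_sub z ρ, inv_neg, div_eq_mul_inv]
    ring
  have e2 : (-ρ - z)⁻¹ = I * (I / (z + ρ)) := by
    rw [← mul_div_assoc, I_mul_I, ← neg_add', inv_neg, div_eq_mul_inv, add_comm ρ z]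
    ring
  rw [e1, e2, mul_pow, mul_pow] at h
  field_simp
  linear_combination h

/-- Compared after multiplication by ρ, hence away from ξ = 0; a null set is irrelevant for the
pairings. -/
theorem symS_succ_eq_sinMultiplier {z : ℂ} (hz : 0 < z.im) (n : ℕ) {ξ : V} (hξ : ξ ≠ 0) :
    symS z (n + 1) ξ = (-I * I ^ (n + 1) / n.factorial) *
      sinMultiplier (fun t => (t : ℂ) ^ n * cexp (I * z * t)) ξ := by
  have hs := mul_sinMultiplier_eq (n := n) (α := fun t => (t : ℂ) ^ n) (by fun_prop)
    (fun t ht => by simp [abs_of_pos ht]) hz ξ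
  rw [integral_pow_mul_cexp n (by simpa using hz), integral_pow_mul_cexp n (by simpa using hz)] at hs
  have h := mul_symS_eq hz.ne' (n + 1) ξ
  have hρ : ((2 * Real.pi * ‖ξ‖ : ℝ) : ℂ) ≠ 0 :=
    ofReal_ne_zero.2 (by have := norm_pos_iff.2 hξ; positivity)
  set ρ : ℂ := ((2 * Real.pi * ‖ξ‖ : ℝ) : ℂ)
  have hf : (n.factorial : ℂ) ≠ 0 := Nat.cast_ne_zero.2 n.factorial_ne_zero
  have e1 : (ρ - z)⁻¹ = I * (I / (z - ρ)) := by
    rw [← mul_div_assoc, I_mul_I, ← neg_sub z ρ, inv_neg, div_eq_mul_inv]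
    ring
  have e2 : (-ρ - z)⁻¹ = I * (I / (z + ρ)) := by
    rw [← mul_div_assoc, I_mul_I, ← neg_add', inv_neg, div_eq_mul_inv, add_comm ρ z]
    ring
  rw [e1, e2, mul_pow, mul_pow] at h
  set S := sinMultiplier (fun t => (t : ℂ) ^ n * cexp (I * z * t)) ξ
  apply mul_left_cancel₀ (mul_ne_zero two_ne_zero hρ)
  rw [h]
  have h2 : 2 * ρ * (-I * I ^ (n + 1) / n.factorial * S) =
      -I * I ^ (n + 1) / n.factorial * 2 * (ρ * S) := by ring
  rw [h2, hs]
  generalize (I / (z + ρ)) ^ (n + 1) = P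
  generalize (I / (z - ρ)) ^ (n + 1) = Q
  field_simp
  ring

end Symbols
end FreeWave

end

noncomputable section

namespace FreeWave

open Complex FourierTransform

/-! ### Fourier decay of rescaled radial cutoffs. -/

section Kernel

variable {V : Type*} [NormedAddCommGroup V] [InnerProductSpace ℝ V] [FiniteDimensional ℝ V]
  [MeasurableSpace V] [BorelSpace V]

/-- A Gaussian of width √c dominates polynomial weights at the price cᴺ. The power series of exp
supplies the factorial. -/
theorem one_add_pow_mul_exp_neg_le {y c : ℝ} (hy : 0 ≤ y) (hc : 1 ≤ c) (N : ℕ) :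
    (1 + y) ^ N * Real.exp (-Real.pi * (y / c)) ≤ N.factorial * Real.exp 1 * c ^ N := by
  have hc0 : 0 < c := by linarith
  have hu : 0 ≤ y / c := by positivity
  have h1 : 1 + y ≤ c * (1 + y / c) := by
    rw [mul_add, mul_div_cancel₀ _ hc0.ne']
    linarith
  have h2 : (1 + y / c) ^ N / N.factorial ≤ Real.exp (1 + y / c) :=
    Real.pow_div_factorial_le_exp _ (by positivity) N
  rw [div_le_iff₀ (by positivity), Real.exp_add] at h2
  have h3 : Real.exp (-Real.pi * (y / c)) ≤ Real.exp (-(y / c)) := by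
    apply Real.exp_le_exp.2
    have := Real.pi_gt_three
    nlinarith
  calc (1 + y) ^ N * Real.exp (-Real.pi * (y / c))
      ≤ (c * (1 + y / c)) ^ N * Real.exp (-(y / c)) := by gcongr
    _ = c ^ N * ((1 + y / c) ^ N * Real.exp (-(y / c))) := by rw [mul_pow]; ring
    _ ≤ c ^ N * ((Real.exp 1 * Real.exp (y / c) * N.factorial) * Real.exp (-(y / c))) := by gcongr
    _ = c ^ N * (Real.exp 1 * N.factorial * (Real.exp (y / c) * Real.exp (-(y / c)))) := by ring
    _ = _ := by rw [← Real.exp_add, add_neg_cancel, Real.exp_zero]; ring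

theorem inv_gaussParam_re (σ : ℝ) : ((gaussParam σ)⁻¹).re = 1 / ‖gaussParam σ‖ ^ 2 := by
  rw [inv_re, gaussParam_re, normSq_eq_norm_sq]

/-- The Fourier transform of a complex Gaussian at scale `R`. -/
theorem norm_fourier_gaussian_le {R : ℝ} (hR : 0 < R) (σ : ℝ) (ξ : V) (N : ℕ) :
    (1 + ‖R • ξ‖ ^ 2) ^ N *
      ‖𝓕 (fun x : V => cexp (-(Real.pi * gaussParam σ / R ^ 2) * ‖x‖ ^ 2)) ξ‖ ≤
    R ^ Module.finrank ℝ V * (N.factorial * Real.exp 1 * ‖gaussParam σ‖ ^ (2 * N)) := by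
  have hb : 0 < (Real.pi * gaussParam σ / R ^ 2).re := by
    have : Real.pi * gaussParam σ / R ^ 2 = (Real.pi / R ^ 2 : ℝ) * gaussParam σ := by
      push_cast; ring
    rw [this, re_ofReal_mul, gaussParam_re, mul_one]
    positivity
  have hp : (Real.pi : ℂ) ≠ 0 := ofReal_ne_zero.2 Real.pi_ne_zero
  have h0 := gaussParam_ne_zero σ
  have hR' : (R : ℂ) ≠ 0 := ofReal_ne_zero.2 hR.ne'
  rw [fourier_gaussian_innerProductSpace hb, norm_mul]
  have h1 : Real.pi / (Real.pi * gaussParam σ / R ^ 2) = ((R ^ 2 : ℝ) : ℂ) * (gaussParam σ)⁻¹ := by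
    push_cast
    field_simp
  have h2 : -(Real.pi : ℂ) ^ 2 * ‖ξ‖ ^ 2 / (Real.pi * gaussParam σ / R ^ 2) =
      ((-Real.pi * ‖R • ξ‖ ^ 2 : ℝ) : ℂ) * (gaussParam σ)⁻¹ := by
    rw [norm_smul, Real.norm_of_nonneg hR.le]
    push_cast
    field_simp
  have h3 : ‖(Real.pi / (Real.pi * gaussParam σ / R ^ 2)) ^ (Module.finrank ℝ V / 2 : ℂ)‖ ≤
      R ^ Module.finrank ℝ V := by
    have e : (Module.finrank ℝ V / 2 : ℂ) = ((Module.finrank ℝ V / 2 : ℝ) : ℂ) := by push_cast; rfl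
    rw [h1, e, norm_cpow_real, norm_mul, norm_real, Real.norm_of_nonneg (by positivity), norm_inv]
    have h4 : R ^ 2 * ‖gaussParam σ‖⁻¹ ≤ R ^ 2 :=
      mul_le_of_le_one_right (by positivity) (inv_le_one_of_one_le₀ (one_le_norm_gaussParam σ))
    refine (Real.rpow_le_rpow (by positivity) h4 (by positivity)).trans_eq ?_
    rw [← Real.rpow_natCast, ← Real.rpow_natCast, ← Real.rpow_mul hR.le]
    congr 1
    push_cast
    ring
  -- With p the Gaussian parameter, the real part of 1/p is 1/‖p‖², so the transformed Gaussian has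
  -- width ‖p‖. This explains the loss ‖p‖^(2N).
  rw [h2, norm_exp, re_ofReal_mul, inv_gaussParam_re]
  have h5 := one_add_pow_mul_exp_neg_le (sq_nonneg ‖R • ξ‖)
    (one_le_pow₀ (n := 2) (one_le_norm_gaussParam σ)) N
  rw [mul_left_comm, pow_mul]
  refine mul_le_mul h3 (le_trans (le_of_eq ?_) h5) (by positivity) (by positivity)
  congr 2
  ring

/-- Powers of the parameter are absorbed: up to a constant the product is the modulus of the Fourier
transform of another Schwartz function, an iterated derivative of β. -/
theorem integrable_norm_gaussParam_pow_mul (β : 𝓢(ℝ, ℂ)) (m : ℕ) :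
    Integrable fun σ => ‖𝓕 β σ‖ * ‖gaussParam σ‖ ^ m := by
  have h := ((𝓕 (expDeriv^[m] β)).integrable (μ := volume)).norm.const_mul ((Real.pi ^ m)⁻¹)
  refine h.congr (Filter.Eventually.of_forall fun σ => ?_)
  beta_reduce
  rw [fourier_iterate_expDeriv, norm_mul, norm_pow, norm_mul, norm_neg, norm_real,
    Real.norm_of_nonneg Real.pi_pos.le, mul_pow]
  have := Real.pi_pos
  field_simp

/-- Fourier decay, uniform in the scale `R`, of the cutoffs `q ((1 + ‖x‖²) / R²)`. -/
theorem exists_norm_fourierInv_scaled_le (V : Type*) [NormedAddCommGroup V] [InnerProductSpace ℝ V]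
    [FiniteDimensional ℝ V] [MeasurableSpace V] [BorelSpace V] {q : ℝ → ℂ}
    (hq : ContDiff ℝ (⊤ : ℕ∞) q) (hqc : HasCompactSupport q) (N : ℕ) :
    ∃ C : ℝ, 0 ≤ C ∧ ∀ R : ℝ, 0 < R → ∀ ξ : V, (1 + ‖R • ξ‖ ^ 2) ^ N *
      ‖𝓕⁻ (fun x : V => q ((1 + ‖x‖ ^ 2) / R ^ 2)) ξ‖ ≤ C * R ^ Module.finrank ℝ V := by
  have he : ContDiff ℝ (⊤ : ℕ∞) fun τ : ℝ => cexp (Real.pi * τ) :=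
    (contDiff_const.mul ofRealCLM.contDiff).cexp
  let β : 𝓢(ℝ, ℂ) := (hqc.mul_left (f := fun τ : ℝ => cexp (Real.pi * τ))).toSchwartzMap
    (he.mul hq)
  have hβ : ∀ τ, q τ = ∫ σ : ℝ, 𝓕 β σ * cexp (-(Real.pi * gaussParam σ) * τ) := fun τ => by
    have h : β τ = cexp (Real.pi * τ) * q τ := rfl
    rw [← exp_mul_eq_integral, h, ← mul_assoc, ← Complex.exp_add]
    simp
  have hint := integrable_norm_gaussParam_pow_mul β (2 * N)
  refine ⟨∫ σ, ‖𝓕 β σ‖ * ‖gaussParam σ‖ ^ (2 * N) * (N.factorial * Real.exp 1), by positivity,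
    fun R hR ξ => ?_⟩
  have hR' : (R : ℂ) ≠ 0 := ofReal_ne_zero.2 hR.ne'
  -- Subordination: the cutoff is a superposition of Gaussians at scale R, each of which is
  -- estimated separately.
  have hF : 𝓕⁻ (fun x : V => q ((1 + ‖x‖ ^ 2) / R ^ 2)) ξ =
      ∫ σ : ℝ, 𝓕 β σ * cexp (-(Real.pi * gaussParam σ) * (1 / R ^ 2 : ℝ)) *
        𝓕 (fun x : V => cexp (-(Real.pi * gaussParam σ / R ^ 2) * ‖x‖ ^ 2)) (-ξ) := by
    rw [Real.fourierInv_eq_fourier_neg, Real.fourier_eq']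
    simp_rw [Real.fourier_eq', hβ, smul_eq_mul, ← integral_const_mul]
    rw [integral_integral_swap]
    · congr 1
      ext σ
      congr 1
      ext x
      have : -(Real.pi * gaussParam σ) * ((1 + ‖x‖ ^ 2) / R ^ 2 : ℝ) =
          -(Real.pi * gaussParam σ) * (1 / R ^ 2 : ℝ) +
          -(Real.pi * gaussParam σ / R ^ 2) * ‖x‖ ^ 2 := by
        push_cast
        field_simp
        ring
      rw [this, Complex.exp_add]
      ring
    · refine Integrable.mono' (g := fun p : V × ℝ =>
        Real.exp (-(Real.pi / R ^ 2) * ‖p.1‖ ^ 2) * ‖𝓕 β p.2‖) ?_ ?_ ?_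
      · refine Integrable.mul_prod (f := fun x : V => Real.exp (-(Real.pi / R ^ 2) * ‖x‖ ^ 2))
          (g := fun σ => ‖𝓕 β σ‖) ?_ (𝓕 β).integrable.norm
        have := (GaussianFourier.integrable_cexp_neg_mul_sq_norm_add
          (b := (Real.pi / R ^ 2 : ℝ)) (by rw [ofReal_re]; positivity) 0 (0 : V)).norm
        refine this.congr (Filter.Eventually.of_forall fun x => ?_)
        beta_reduce
        rw [norm_exp]
        congr 1
        rw [zero_mul, add_zero, ← ofReal_neg, ← ofReal_pow, ← ofReal_mul, ofReal_re]
      · apply Continuous.aestronglyMeasurable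
        have h1 := (𝓕 β).continuous
        have h2 := continuous_gaussParam
        simp only [Function.uncurry_def]
        fun_prop
      · refine Filter.Eventually.of_forall fun p => ?_
        simp only [Function.uncurry, norm_mul, norm_cexp_neg_pi_gaussParam]
        rw [norm_exp_ofReal_mul_I, one_mul, mul_comm]
        refine mul_le_mul_of_nonneg_right (Real.exp_le_exp.2 ?_) (norm_nonneg _)
        have : 0 ≤ Real.pi * (1 / R ^ 2) := by have := Real.pi_pos; positivity
        have e : -Real.pi * ((1 + ‖p.1‖ ^ 2) / R ^ 2) =
          -(Real.pi / R ^ 2) * ‖p.1‖ ^ 2 - Real.pi * (1 / R ^ 2) := by ring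
        linarith
  have hP : 0 < (1 + ‖R • ξ‖ ^ 2) ^ N := by positivity
  have hb : ∀ σ : ℝ, ‖𝓕 β σ * cexp (-(Real.pi * gaussParam σ) * (1 / R ^ 2 : ℝ)) *
        𝓕 (fun x : V => cexp (-(Real.pi * gaussParam σ / R ^ 2) * ‖x‖ ^ 2)) (-ξ)‖ ≤
      ‖𝓕 β σ‖ * ‖gaussParam σ‖ ^ (2 * N) * (N.factorial * Real.exp 1) *
        (R ^ Module.finrank ℝ V / (1 + ‖R • ξ‖ ^ 2) ^ N) := fun σ => by
    have h1 := norm_fourier_gaussian_le hR σ (-ξ) N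
    rw [smul_neg, norm_neg, mul_comm, ← le_div_iff₀ hP] at h1
    rw [norm_mul, norm_mul, norm_cexp_neg_pi_gaussParam]
    have h2 : Real.exp (-Real.pi * (1 / R ^ 2)) ≤ 1 := by
      apply Real.exp_le_one_iff.2
      have : 0 ≤ Real.pi * (1 / R ^ 2) := by have := Real.pi_pos; positivity
      linarith
    refine (mul_le_mul (mul_le_mul_of_nonneg_left h2 (norm_nonneg _)) h1 (norm_nonneg _)
      (by positivity)).trans_eq ?_
    ring
  have hn := norm_integral_le_of_norm_le
    ((hint.mul_const (N.factorial * Real.exp 1)).mul_const _) (Filter.Eventually.of_forall hb)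
  rw [integral_mul_const, ← mul_div_assoc, le_div_iff₀ hP, ← hF] at hn
  rwa [mul_comm]

end Kernel
end FreeWave

end

noncomputable section

namespace FreeWave

open Complex FourierTransform

/-! ### Weighted convolution estimates in L², with the singularity 1/‖ξ‖. -/

section Convolution

set_option linter.unusedSectionVars false

variable {V : Type*} [NormedAddCommGroup V] [InnerProductSpace ℝ V] [FiniteDimensional ℝ V]
  [MeasurableSpace V] [BorelSpace V]

/-- The `L²` norm of a nonnegative function. -/
def l2n (v : V → ℝ≥0∞) : ℝ≥0∞ := (∫⁻ ξ, v ξ ^ (2 : ℝ)) ^ (1 / (2 : ℝ))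

theorem l2n_mono {v w : V → ℝ≥0∞} (h : ∀ ξ, v ξ ≤ w ξ) : l2n v ≤ l2n w := by
  unfold l2n
  gcongr with ξ
  exact h ξ

theorem l2n_const_mul {c : ℝ≥0∞} (hc : c ≠ ⊤) (v : V → ℝ≥0∞) :
    l2n (fun ξ => c * v ξ) = c * l2n v := by
  unfold l2n
  simp_rw [ENNReal.mul_rpow_of_nonneg _ _ (zero_le_two : (0 : ℝ) ≤ 2)]
  rw [lintegral_const_mul' _ _ (by finiteness), ENNReal.mul_rpow_of_nonneg _ _ (by positivity),
    ← ENNReal.rpow_mul]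
  norm_num

theorem l2n_add_le {v w : V → ℝ≥0∞} (hv : Measurable v) (hw : Measurable w) :
    l2n (fun ξ => v ξ + w ξ) ≤ l2n v + l2n w :=
  ENNReal.lintegral_Lp_add_le hv.aemeasurable hw.aemeasurable one_le_two

theorem lintegral_mul_le_l2n {v w : V → ℝ≥0∞} (hv : Measurable v) (hw : Measurable w) :
    ∫⁻ ξ, v ξ * w ξ ≤ l2n v * l2n w :=
  ENNReal.lintegral_mul_le_Lp_mul_Lq volume Real.HolderConjugate.two_two hv.aemeasurable
    hw.aemeasurable

theorem l2n_comp_neg (v : V → ℝ≥0∞) : l2n (fun ξ => v (-ξ)) = l2n v := by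
  unfold l2n
  rw [lintegral_neg_eq_self (fun ξ => v ξ ^ (2 : ℝ))]

theorem lintegral_comp_smul_of_pos {φ : V → ℝ≥0∞} (hφ : Measurable φ) {R : ℝ} (hR : 0 < R) :
    ∫⁻ ξ, φ (R • ξ) = (ENNReal.ofReal R ^ Module.finrank ℝ V)⁻¹ * ∫⁻ ξ, φ ξ := by
  have h := lintegral_map (μ := volume) hφ (measurable_const_smul R : Measurable fun ξ : V => R • ξ)
  rw [← h, Measure.map_addHaar_smul _ hR.ne', lintegral_smul_measure, smul_eq_mul,
    abs_of_pos (by positivity), ENNReal.ofReal_inv_of_pos (by positivity), ENNReal.ofReal_pow hR.le]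

theorem l2n_comp_smul_of_pos {φ : V → ℝ≥0∞} (hφ : Measurable φ) {R : ℝ} (hR : 0 < R) :
    l2n (fun ξ => φ (R • ξ)) =
      (ENNReal.ofReal R ^ Module.finrank ℝ V)⁻¹ ^ (1 / (2 : ℝ)) * l2n φ := by
  unfold l2n
  rw [lintegral_comp_smul_of_pos (φ := fun ξ => φ ξ ^ (2 : ℝ)) (by fun_prop) hR,
    ENNReal.mul_rpow_of_nonneg _ _ (by positivity)]

/-- The convolution of nonnegative functions. -/
def lconv (κ v : V → ℝ≥0∞) (ξ : V) : ℝ≥0∞ := ∫⁻ η, κ (ξ - η) * v η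

theorem measurable_lconv {κ v : V → ℝ≥0∞} (hκ : Measurable κ) (hv : Measurable v) :
    Measurable (lconv κ v) := by
  unfold lconv
  apply Measurable.lintegral_prod_right' (f := fun p : V × V => κ (p.1 - p.2) * v p.2)
  fun_prop

theorem lintegral_sub_left_comp (κ : V → ℝ≥0∞) (ξ : V) : ∫⁻ η, κ (ξ - η) = ∫⁻ η, κ η := by
  rw [lintegral_sub_left_eq_self κ ξ]

/-- Cauchy–Schwarz gives a pointwise bound, needed near the singularity, where Young's inequality is
not enough. -/
theorem lconv_le {κ v : V → ℝ≥0∞} (hκ : Measurable κ) (hv : Measurable v) (ξ : V) :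
    lconv κ v ξ ≤ l2n κ * l2n v := by
  refine (lintegral_mul_le_l2n (by fun_prop) hv).trans_eq ?_
  unfold l2n
  rw [lintegral_sub_left_comp (fun η => κ η ^ (2 : ℝ))]

/-- Young's inequality `‖κ * v‖₂ ≤ ‖κ‖₁ ‖v‖₂`. -/
theorem l2n_lconv_le {κ v : V → ℝ≥0∞} (hκ : Measurable κ) (hv : Measurable v) :
    l2n (lconv κ v) ≤ (∫⁻ ξ, κ ξ) * l2n v := by
  have h1 : ∀ ξ, lconv κ v ξ ^ (2 : ℝ) ≤
      (∫⁻ η, κ η) * ∫⁻ η, κ (ξ - η) * v η ^ (2 : ℝ) := fun ξ => by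
    have h := lintegral_mul_le_l2n (v := fun η => κ (ξ - η) ^ (1 / (2 : ℝ)))
      (w := fun η => κ (ξ - η) ^ (1 / (2 : ℝ)) * v η) (by fun_prop) (by fun_prop)
    have e : ∀ x y : ℝ≥0∞, x ^ (1 / (2 : ℝ)) * (x ^ (1 / (2 : ℝ)) * y) = x * y := fun x y => by
      rw [← mul_assoc, ← ENNReal.rpow_add_of_nonneg _ _ (by norm_num) (by norm_num)]
      norm_num
    simp_rw [e] at h
    refine (ENNReal.rpow_le_rpow h zero_le_two).trans_eq ?_
    unfold l2n
    simp_rw [ENNReal.mul_rpow_of_nonneg _ _ (zero_le_two : (0 : ℝ) ≤ 2), ← ENNReal.rpow_mul]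
    norm_num
    rw [lintegral_sub_left_comp κ]
  have h2 : ∫⁻ ξ, lconv κ v ξ ^ (2 : ℝ) ≤ (∫⁻ η, κ η) ^ (2 : ℝ) * ∫⁻ η, v η ^ (2 : ℝ) := by
    calc _ ≤ ∫⁻ ξ, (∫⁻ η, κ η) * ∫⁻ η, κ (ξ - η) * v η ^ (2 : ℝ) := lintegral_mono h1
      _ = (∫⁻ η, κ η) * ∫⁻ ξ, ∫⁻ η, κ (ξ - η) * v η ^ (2 : ℝ) := by
        rw [lintegral_const_mul]
        apply Measurable.lintegral_prod_right' (f := fun p : V × V => κ (p.1 - p.2) * v p.2 ^ (2 : ℝ))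
        fun_prop
      _ = (∫⁻ η, κ η) * ∫⁻ η, ∫⁻ ξ, κ (ξ - η) * v η ^ (2 : ℝ) := by
        rw [lintegral_lintegral_swap]
        apply Measurable.aemeasurable
        fun_prop
      _ = (∫⁻ η, κ η) * ∫⁻ η, (∫⁻ ξ, κ ξ) * v η ^ (2 : ℝ) := by
        congr 2
        ext η
        rw [lintegral_mul_const _ (by fun_prop), lintegral_sub_right_eq_self κ η]
      _ = _ := by
        rw [lintegral_const_mul _ (by fun_prop), ← mul_assoc]
        norm_num [sq]
  refine (ENNReal.rpow_le_rpow h2 (by norm_num : (0 : ℝ) ≤ 1 / 2)).trans_eq ?_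
  unfold l2n
  rw [ENNReal.mul_rpow_of_nonneg _ _ (by norm_num), ← ENNReal.rpow_mul]
  norm_num

/-- The `L¹` normalised kernel `R^d (1 + ‖R ξ‖²)^{-d}`. -/
def japKernel (R : ℝ) (ξ : V) : ℝ≥0∞ :=
  ENNReal.ofReal (R ^ Module.finrank ℝ V * ((1 + ‖R • ξ‖ ^ 2) ^ Module.finrank ℝ V)⁻¹)

theorem measurable_japKernel (R : ℝ) : Measurable (japKernel R : V → ℝ≥0∞) := by
  unfold japKernel
  fun_prop

theorem japKernel_eq {R : ℝ} (hR : 0 < R) (ξ : V) :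
    japKernel R ξ = ENNReal.ofReal R ^ Module.finrank ℝ V * japKernel 1 (R • ξ) := by
  unfold japKernel
  rw [ENNReal.ofReal_mul (by positivity), ENNReal.ofReal_pow hR.le]
  simp

theorem lintegral_japKernel_one_lt_top (hd : 1 ≤ Module.finrank ℝ V) :
    ∫⁻ ξ : V, japKernel 1 ξ < ⊤ := by
  have h := integrable_rpow_neg_one_add_norm_sq (E := V) (μ := volume)
    (r := 2 * Module.finrank ℝ V) (by
      have : (1 : ℝ) ≤ Module.finrank ℝ V := by exact_mod_cast hd
      linarith)
  refine lt_of_le_of_lt (lintegral_mono fun ξ => ?_) h.2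
  rw [japKernel, ← Real.enorm_of_nonneg (by positivity), one_pow, one_mul, one_smul,
    neg_div, mul_div_cancel_left₀ _ two_ne_zero]
  beta_reduce
  rw [Real.rpow_neg (by positivity), Real.rpow_natCast]

theorem l2n_japKernel_one_lt_top (hd : 1 ≤ Module.finrank ℝ V) :
    l2n (japKernel 1 : V → ℝ≥0∞) < ⊤ := by
  refine ENNReal.rpow_lt_top_of_nonneg (by norm_num) (lt_of_le_of_lt (lintegral_mono fun ξ => ?_)
    (lintegral_japKernel_one_lt_top hd)).ne
  have h : japKernel 1 ξ ≤ 1 := by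
    rw [japKernel, ENNReal.ofReal_le_one, one_pow, one_mul]
    exact inv_le_one_of_one_le₀ (one_le_pow₀ (by nlinarith [sq_nonneg ‖(1 : ℝ) • ξ‖]))
  calc japKernel 1 ξ ^ (2 : ℝ) = japKernel 1 ξ * japKernel 1 ξ := by
        rw [show (2 : ℝ) = (2 : ℕ) by norm_num, ENNReal.rpow_natCast, sq]
    _ ≤ japKernel 1 ξ * 1 := by gcongr
    _ = _ := mul_one _

/-- The singularity `1 / ‖ξ‖`, cut off to the unit ball. -/
def invBall (ξ : V) : ℝ≥0∞ := (Metric.ball (0 : V) 1).indicator (fun ξ => ENNReal.ofReal ‖ξ‖⁻¹) ξ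

theorem measurable_invBall : Measurable (invBall : V → ℝ≥0∞) :=
  Measurable.indicator (by fun_prop) measurableSet_ball

/-- In polar coordinates the integrand is r⁻² rᵈ⁻¹ = rᵈ⁻³, bounded on the unit interval because d ≥
3. -/
theorem l2n_invBall_lt_top (hd : 3 ≤ Module.finrank ℝ V) : l2n (invBall : V → ℝ≥0∞) < ⊤ := by
  have : Nontrivial V := Module.nontrivial_of_finrank_pos (R := ℝ) (by omega)
  have h := (integrableOn_fun_norm_addHaar (E := V) (μ := volume) (f := fun t : ℝ => t⁻¹ ^ 2)
    (r := 1)).2 ?_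
  · refine ENNReal.rpow_lt_top_of_nonneg (by norm_num) (lt_of_le_of_lt (le_of_eq ?_) h.2).ne
    rw [← lintegral_indicator measurableSet_ball]
    congr 1
    ext ξ
    unfold invBall
    by_cases hξ : ξ ∈ Metric.ball (0 : V) 1
    · rw [Set.indicator_of_mem hξ, Set.indicator_of_mem hξ, Real.enorm_of_nonneg (by positivity),
        ENNReal.ofReal_pow (by positivity)]
      exact_mod_cast ENNReal.rpow_natCast _ 2
    · rw [Set.indicator_of_notMem hξ, Set.indicator_of_notMem hξ]
      simp
  · refine (Continuous.integrableOn_Icc (f := fun y : ℝ => y ^ (Module.finrank ℝ V - 3))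
      (by fun_prop) (a := 0) (b := 1)).mono_set Set.Ioo_subset_Icc_self |>.congr_fun ?_
      measurableSet_Ioo
    intro y hy
    have hy0 : y ≠ 0 := hy.1.ne'
    obtain ⟨e, he⟩ := Nat.exists_eq_add_of_le hd
    rw [he]
    simp only [smul_eq_mul, show 3 + e - 1 = e + 2 by omega, show 3 + e - 3 = e by omega]
    field_simp
    ring

/-- The plain bound is Young's inequality. Outside the ball of radius 1/R the factor 1/‖ξ‖ is at
most R. Inside it, the sup bound on the convolution costs R^(d/2), while the L² norm of 1/‖ξ‖ is of
size R R^(-d/2). Either way only one power of R is lost. -/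
theorem exists_l2n_lconv_japKernel_le (hd : 3 ≤ Module.finrank ℝ V) :
    ∃ A : ℝ≥0∞, A ≠ ⊤ ∧ ∀ R : ℝ, 1 ≤ R → ∀ v : V → ℝ≥0∞, Measurable v →
      l2n (lconv (japKernel R) v) ≤ A * l2n v ∧
      l2n (fun ξ => ENNReal.ofReal (1 + ‖ξ‖⁻¹) * lconv (japKernel R) v ξ) ≤
        A * ENNReal.ofReal R * l2n v := by
  have hA1 := lintegral_japKernel_one_lt_top (V := V) (by omega)
  have hA2 := l2n_japKernel_one_lt_top (V := V) (by omega)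
  have hA3 := l2n_invBall_lt_top hd
  set A1 := ∫⁻ ξ : V, japKernel 1 ξ
  set A2 := l2n (japKernel 1 : V → ℝ≥0∞)
  set A3 := l2n (invBall : V → ℝ≥0∞)
  refine ⟨2 * A1 + A3 * A2, by finiteness, fun R hR v hv => ?_⟩
  have hR0 : 0 < R := by linarith
  set c := ENNReal.ofReal R ^ Module.finrank ℝ V with hc
  have hc0 : c ≠ 0 := by simp [hc, hR0]
  have hct : c ≠ ⊤ := by simp [hc]
  have hk1 : ∫⁻ ξ : V, japKernel R ξ = A1 := by
    simp_rw [japKernel_eq hR0, ← hc]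
    rw [lintegral_const_mul' _ _ hct, lintegral_comp_smul_of_pos (measurable_japKernel 1) hR0,
      ← mul_assoc, ENNReal.mul_inv_cancel hc0 hct, one_mul]
  have hk2 : l2n (japKernel R : V → ℝ≥0∞) = c * (c⁻¹ ^ (1 / (2 : ℝ)) * A2) := by
    rw [← l2n_comp_smul_of_pos (measurable_japKernel 1) hR0, ← l2n_const_mul hct]
    congr 1
    ext ξ
    exact japKernel_eq hR0 ξ
  have hmk := measurable_japKernel (V := V) R
  have hmb := measurable_invBall (V := V)
  have hY := l2n_lconv_le hmk hv
  rw [hk1] at hY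
  have hRR : (ENNReal.ofReal R) ≠ ⊤ := by finiteness
  refine ⟨hY.trans ?_, ?_⟩
  · gcongr
    calc A1 ≤ 2 * A1 := by rw [two_mul]; exact le_self_add
      _ ≤ _ := le_self_add
  have hp : ∀ ξ : V, ENNReal.ofReal (1 + ‖ξ‖⁻¹) * lconv (japKernel R) v ξ ≤
      2 * ENNReal.ofReal R * lconv (japKernel R) v ξ +
        (ENNReal.ofReal R * l2n (japKernel R : V → ℝ≥0∞) * l2n v) * invBall (R • ξ) := fun ξ => by
    have h1 : ENNReal.ofReal (1 + ‖ξ‖⁻¹) ≤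
        2 * ENNReal.ofReal R + ENNReal.ofReal R * invBall (R • ξ) := by
      have h2 : (2 : ℝ≥0∞) * ENNReal.ofReal R = ENNReal.ofReal (2 * R) := by
        rw [ENNReal.ofReal_mul zero_le_two]; simp
      rw [h2]
      by_cases hξ : R • ξ ∈ Metric.ball (0 : V) 1
      · rw [invBall, Set.indicator_of_mem hξ, ← ENNReal.ofReal_mul hR0.le,
          ← ENNReal.ofReal_add (by positivity) (by positivity)]
        apply ENNReal.ofReal_le_ofReal
        rw [norm_smul, Real.norm_of_nonneg hR0.le, mul_inv, ← mul_assoc,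
          mul_inv_cancel₀ hR0.ne', one_mul]
        linarith
      · refine le_add_right (ENNReal.ofReal_le_ofReal ?_)
        rw [mem_ball_zero_iff, not_lt, norm_smul, Real.norm_of_nonneg hR0.le] at hξ
        have hx : 0 < ‖ξ‖ := by
          by_contra h
          have : ‖ξ‖ = 0 := le_antisymm (not_lt.1 h) (norm_nonneg _)
          rw [this] at hξ
          linarith
        have : ‖ξ‖⁻¹ ≤ R := by rwa [inv_le_iff_one_le_mul₀ hx]
        linarith
    calc _ ≤ (2 * ENNReal.ofReal R + ENNReal.ofReal R * invBall (R • ξ)) *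
          lconv (japKernel R) v ξ := by gcongr
      _ = 2 * ENNReal.ofReal R * lconv (japKernel R) v ξ +
          ENNReal.ofReal R * invBall (R • ξ) * lconv (japKernel R) v ξ := by rw [add_mul]
      _ ≤ 2 * ENNReal.ofReal R * lconv (japKernel R) v ξ +
          ENNReal.ofReal R * invBall (R • ξ) * (l2n (japKernel R) * l2n v) := by
        gcongr
        exact lconv_le hmk hv ξ
      _ = _ := by ring
  -- The right-hand side is then infinite, provided its constant is not zero. In the remaining case
  -- the scalars pulled out of `l2n` are finite.
  by_cases hvt : l2n v = ⊤
  · have hA10 : A1 ≠ 0 := by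
      rw [← hk1]
      intro h0
      rw [lintegral_eq_zero_iff hmk] at h0
      have h1 : ∀ ξ : V, japKernel R ξ ≠ 0 := fun ξ => by
        rw [japKernel, ne_eq, ENNReal.ofReal_eq_zero, not_le]
        positivity
      obtain ⟨ξ, hξ⟩ := h0.exists
      exact h1 ξ hξ
    rw [hvt, ENNReal.mul_top]
    · exact le_top
    · simp [hA10, hR0]
  refine (l2n_mono hp).trans ((l2n_add_le ?_ ?_).trans ?_)
  · exact (measurable_lconv hmk hv).const_mul _
  · exact (hmb.comp (measurable_const_smul R)).const_mul _
  rw [l2n_const_mul (by finiteness), l2n_const_mul, l2n_comp_smul_of_pos hmb hR0, hk2, ← hc]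
  · have hcc : c⁻¹ ^ (1 / (2 : ℝ)) * c⁻¹ ^ (1 / (2 : ℝ)) * c = 1 := by
      rw [← ENNReal.rpow_add_of_nonneg _ _ (by norm_num) (by norm_num)]
      norm_num
      exact ENNReal.inv_mul_cancel hc0 hct
    calc _ ≤ 2 * ENNReal.ofReal R * (A1 * l2n v) +
        ENNReal.ofReal R * (c * (c⁻¹ ^ (1 / (2 : ℝ)) * A2)) * l2n v *
          (c⁻¹ ^ (1 / (2 : ℝ)) * A3) := by gcongr
      _ = 2 * ENNReal.ofReal R * (A1 * l2n v) + ENNReal.ofReal R * A2 * A3 * l2n v *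
          (c⁻¹ ^ (1 / (2 : ℝ)) * c⁻¹ ^ (1 / (2 : ℝ)) * c) := by ring
      _ = (2 * A1 + A3 * A2) * ENNReal.ofReal R * l2n v := by rw [hcc]; ring
  · rw [hk2]
    have : c⁻¹ ≠ ⊤ := ENNReal.inv_ne_top.2 hc0
    finiteness

end Convolution
end FreeWave

end

noncomputable section

namespace FreeWave

open Complex FourierTransform

/-! ### Dyadic pieces of the weight and their action on Sobolev norms. -/

section Weights

set_option linter.unusedSectionVars false

variable {V : Type*} [NormedAddCommGroup V] [InnerProductSpace ℝ V] [FiniteDimensional ℝ V]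
  [MeasurableSpace V] [BorelSpace V]

/-- The weight `⟨ξ⟩^s = (1 + ‖ξ‖²)^(s/2)`. -/
def bw (s : ℝ) (ξ : V) : ℝ := (1 + ‖ξ‖ ^ 2) ^ (s / 2)

theorem bw_pos (s : ℝ) (ξ : V) : 0 < bw s ξ := Real.rpow_pos_of_pos (by positivity) _

theorem bw_neg_arg (s : ℝ) (ξ : V) : bw s (-ξ) = bw s ξ := by simp [bw]

theorem bw_mul_bw (s t : ℝ) (ξ : V) : bw s ξ * bw t ξ = bw (s + t) ξ := by
  rw [bw, bw, bw, ← Real.rpow_add (by positivity), add_div]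

theorem bw_zero (ξ : V) : bw 0 ξ = 1 := by simp [bw]

theorem bw_neg_mul_bw (s : ℝ) (ξ : V) : bw (-s) ξ * bw s ξ = 1 := by
  rw [bw_mul_bw, neg_add_cancel, bw_zero]

theorem continuous_bw (s : ℝ) : Continuous (bw s : V → ℝ) := by
  unfold bw
  exact Continuous.rpow_const (by fun_prop) fun ξ => Or.inl (by positivity)

theorem one_add_norm_sq_le (ξ η : V) :
    1 + ‖ξ‖ ^ 2 ≤ 2 * (1 + ‖ξ - η‖ ^ 2) * (1 + ‖η‖ ^ 2) := by
  have h : ‖ξ‖ ≤ ‖ξ - η‖ + ‖η‖ := by simpa using norm_add_le (ξ - η) η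
  have h2 : ‖ξ‖ ^ 2 ≤ (‖ξ - η‖ + ‖η‖) ^ 2 := by gcongr
  nlinarith [sq_nonneg (‖ξ - η‖ - ‖η‖), sq_nonneg (‖ξ - η‖ * ‖η‖)]

theorem bw_le_of_nonneg {s : ℝ} (hs : 0 ≤ s) (ξ η : V) :
    bw s ξ ≤ 2 ^ (s / 2) * bw s (ξ - η) * bw s η := by
  unfold bw
  rw [← Real.mul_rpow (by positivity) (by positivity), ← Real.mul_rpow (by positivity)
    (by positivity)]
  exact Real.rpow_le_rpow (by positivity) (one_add_norm_sq_le ξ η) (by positivity)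

/-- Peetre's inequality. -/
theorem bw_le (s : ℝ) (ξ η : V) :
    bw s ξ ≤ 2 ^ (|s| / 2) * bw |s| (ξ - η) * bw s η := by
  rcases le_total 0 s with hs | hs
  · rw [abs_of_nonneg hs]
    exact bw_le_of_nonneg hs ξ η
  · rw [abs_of_nonpos hs]
    have h := bw_le_of_nonneg (neg_nonneg.2 hs) η ξ
    rw [← neg_sub ξ η, bw_neg_arg] at h
    calc bw s ξ = bw s ξ * (bw (-s) η * bw s η) := by rw [bw_neg_mul_bw, mul_one]
      _ ≤ bw s ξ * (2 ^ (-s / 2) * bw (-s) (ξ - η) * bw (-s) ξ * bw s η) := by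
        have := bw_pos s ξ
        have := bw_pos s η
        gcongr
      _ = 2 ^ (-s / 2) * bw (-s) (ξ - η) * bw s η * (bw (-s) ξ * bw s ξ) := by ring
      _ = _ := by rw [bw_neg_mul_bw, mul_one]

theorem bw_le_pow {s : ℝ} {N : ℕ} (hs : s / 2 ≤ N) {R : ℝ} (hR : 1 ≤ R) (hs0 : 0 ≤ s) (ξ : V) :
    bw s ξ ≤ (1 + ‖R • ξ‖ ^ 2) ^ N := by
  have h1 : 1 + ‖ξ‖ ^ 2 ≤ 1 + ‖R • ξ‖ ^ 2 := by
    have h : ‖ξ‖ ≤ ‖R • ξ‖ := by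
      rw [norm_smul, Real.norm_of_nonneg (by linarith)]
      exact le_mul_of_one_le_left (norm_nonneg _) hR
    gcongr
  calc bw s ξ ≤ (1 + ‖R • ξ‖ ^ 2) ^ (s / 2) :=
        Real.rpow_le_rpow (by positivity) h1 (by positivity)
    _ ≤ (1 + ‖R • ξ‖ ^ 2) ^ (N : ℝ) :=
        Real.rpow_le_rpow_of_exponent_le (by nlinarith [sq_nonneg ‖R • ξ‖]) hs
    _ = _ := Real.rpow_natCast _ _

/-- The modulus of `⟨ξ⟩^s g ξ`, as a nonnegative function. -/
def bwn (s : ℝ) (g : 𝓢(V, ℂ)) (ξ : V) : ℝ≥0∞ := ENNReal.ofReal (bw s ξ) * ‖g ξ‖ₑ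

theorem measurable_bwn (s : ℝ) (g : 𝓢(V, ℂ)) : Measurable (bwn s g) := by
  have := (continuous_bw (V := V) s).measurable
  have := g.continuous.measurable
  unfold bwn
  fun_prop

theorem fourierInv_pairing_apply (φ f : 𝓢(V, ℂ)) (ξ : V) :
    𝓕⁻ (SchwartzMap.pairing (ContinuousLinearMap.mul ℂ ℂ) φ f) ξ =
      ∫ η, 𝓕⁻ φ (ξ - η) * 𝓕⁻ f η := by
  have h := SchwartzMap.convolution_apply (ContinuousLinearMap.mul ℂ ℂ) (𝓕⁻ φ) (𝓕⁻ f) ξ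
  have h2 : SchwartzMap.convolution (ContinuousLinearMap.mul ℂ ℂ) (𝓕⁻ φ) (𝓕⁻ f) =
      𝓕⁻ (SchwartzMap.pairing (ContinuousLinearMap.mul ℂ ℂ) φ f) := by
    rw [← FourierTransform.fourierInv_fourier_eq (F := 𝓢(V, ℂ)) (SchwartzMap.convolution _ _ _),
      SchwartzMap.fourier_convolution]
    simp
  rw [← h2, h, ← MeasureTheory.convolution_flip, MeasureTheory.convolution]
  simp only [ContinuousLinearMap.flip_apply, ContinuousLinearMap.mul_apply']

/-- Multiplication by φ is convolution on the Fourier side, and Peetre's inequality moves ⟨ξ⟩ˢ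
through it. Of the decay exponent N + d, the part N absorbs ⟨·⟩^|s| (using R ≥ 1) and the part d
leaves the integrable kernel. -/
theorem bwn_fourierInv_pairing_le (s : ℝ) {N : ℕ} (hN : |s| / 2 ≤ N) {c R : ℝ} (hR : 1 ≤ R)
    (φ f : 𝓢(V, ℂ)) (hφ : ∀ ξ, (1 + ‖R • ξ‖ ^ 2) ^ (N + Module.finrank ℝ V) * ‖𝓕⁻ φ ξ‖ ≤
      c * R ^ Module.finrank ℝ V) (ξ : V) :
    bwn s (𝓕⁻ (SchwartzMap.pairing (ContinuousLinearMap.mul ℂ ℂ) φ f)) ξ ≤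
      ENNReal.ofReal (2 ^ (|s| / 2) * c) * lconv (japKernel R) (bwn s (𝓕⁻ f)) ξ := by
  have hR0 : 0 < R := by linarith
  have hc : 0 ≤ c := by
    have h := le_trans (by positivity) (hφ 0)
    exact nonneg_of_mul_nonneg_left h (by positivity)
  have hφ' : ∀ ζ, bw |s| ζ * ‖𝓕⁻ φ ζ‖ ≤
      c * (R ^ Module.finrank ℝ V * ((1 + ‖R • ζ‖ ^ 2) ^ Module.finrank ℝ V)⁻¹) := fun ζ => by
    have hp : 0 < (1 + ‖R • ζ‖ ^ 2) ^ Module.finrank ℝ V := by positivity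
    rw [← mul_assoc, ← div_eq_mul_inv, le_div_iff₀ hp]
    calc bw |s| ζ * ‖𝓕⁻ φ ζ‖ * (1 + ‖R • ζ‖ ^ 2) ^ Module.finrank ℝ V
        ≤ (1 + ‖R • ζ‖ ^ 2) ^ N * ‖𝓕⁻ φ ζ‖ * (1 + ‖R • ζ‖ ^ 2) ^ Module.finrank ℝ V := by
          have := bw_le_pow hN hR (abs_nonneg s) ζ
          gcongr
      _ = (1 + ‖R • ζ‖ ^ 2) ^ (N + Module.finrank ℝ V) * ‖𝓕⁻ φ ζ‖ := by rw [pow_add]; ring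
      _ ≤ _ := hφ ζ
  rw [bwn, fourierInv_pairing_apply, lconv, ← lintegral_const_mul' _ _ (by finiteness)]
  calc _ ≤ ENNReal.ofReal (bw s ξ) * ∫⁻ η, ‖𝓕⁻ φ (ξ - η) * 𝓕⁻ f η‖ₑ := by
        gcongr
        exact enorm_integral_le_lintegral_enorm _
    _ = ∫⁻ η, ENNReal.ofReal (bw s ξ) * ‖𝓕⁻ φ (ξ - η) * 𝓕⁻ f η‖ₑ := by
        rw [lintegral_const_mul' _ _ (by finiteness)]
    _ ≤ _ := lintegral_mono fun η => ?_
  rw [enorm_mul, bwn, japKernel, ← ofReal_norm, ← mul_assoc, ← mul_assoc, ← mul_assoc,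
    ← ENNReal.ofReal_mul (bw_pos s ξ).le, ← ENNReal.ofReal_mul (by positivity),
    ← ENNReal.ofReal_mul (by positivity)]
  refine mul_le_mul' (ENNReal.ofReal_le_ofReal ?_) le_rfl
  have := bw_pos s η
  calc bw s ξ * ‖𝓕⁻ φ (ξ - η)‖
      ≤ 2 ^ (|s| / 2) * bw |s| (ξ - η) * bw s η * ‖𝓕⁻ φ (ξ - η)‖ := by
        gcongr
        exact bw_le s ξ η
    _ = 2 ^ (|s| / 2) * (bw |s| (ξ - η) * ‖𝓕⁻ φ (ξ - η)‖) * bw s η := by ring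
    _ ≤ 2 ^ (|s| / 2) * (c * (R ^ Module.finrank ℝ V *
          ((1 + ‖R • (ξ - η)‖ ^ 2) ^ Module.finrank ℝ V)⁻¹)) * bw s η := by
        have := hφ' (ξ - η)
        exact mul_le_mul_of_nonneg_right (mul_le_mul_of_nonneg_left this (by positivity))
          (by positivity)
    _ = _ := by ring

/-- The profile of the dyadic pieces of `⟨x⟩^{-a}`. -/
def profile (a τ : ℝ) : ℂ := ((τ ^ (-a / 2) : ℝ) : ℂ) * (cutoff τ - cutoff (4 * τ))

theorem profile_eq_zero_of_le (a : ℝ) {τ : ℝ} (h : τ ≤ 1 / 4) : profile a τ = 0 := by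
  rw [profile, cutoff_eq_one (by linarith), cutoff_eq_one (by linarith), sub_self, mul_zero]

theorem profile_eq_zero_of_ge (a : ℝ) {τ : ℝ} (h : 2 ≤ τ) : profile a τ = 0 := by
  rw [profile, cutoff_eq_zero h, cutoff_eq_zero (by linarith), sub_self, mul_zero]

theorem contDiff_profile (a : ℝ) : ContDiff ℝ (⊤ : ℕ∞) (profile a) := by
  rw [contDiff_iff_contDiffAt]
  intro τ
  rcases lt_or_ge τ (1 / 4) with h | h
  · refine contDiffAt_const (c := (0 : ℂ)) |>.congr_of_eventuallyEq ?_
    filter_upwards [Iio_mem_nhds h] with y hy using profile_eq_zero_of_le a (le_of_lt hy)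
  · have h1 : ContDiffAt ℝ (⊤ : ℕ∞) (fun τ : ℝ => ((τ ^ (-a / 2) : ℝ) : ℂ)) τ :=
      ofRealCLM.contDiff.contDiffAt.comp τ (Real.contDiffAt_rpow_const_of_ne (by linarith))
    have h2 : ContDiff ℝ (⊤ : ℕ∞) fun τ : ℝ => cutoff τ - cutoff (4 * τ) :=
      contDiff_cutoff.sub (contDiff_cutoff.comp (contDiff_const.mul contDiff_id))
    exact h1.mul h2.contDiffAt

theorem hasCompactSupport_profile (a : ℝ) : HasCompactSupport (profile a) :=
  HasCompactSupport.intro (isCompact_Icc (a := 0) (b := 2)) fun τ hτ => by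
    rw [Set.mem_Icc, not_and_or, not_le, not_le] at hτ
    rcases hτ with h | h
    · exact profile_eq_zero_of_le a (by linarith)
    · exact profile_eq_zero_of_ge a h.le

/-- The dyadic pieces of `⟨x⟩^{-a}`. -/
def weightPiece (a : ℝ) (j : ℕ) (x : V) : ℂ :=
  ((2 ^ (-a * j) : ℝ) : ℂ) * profile a ((1 + ‖x‖ ^ 2) / (2 ^ j) ^ 2)

theorem weightPiece_eq (a : ℝ) (j : ℕ) (x : V) : weightPiece a j x =
    (bw (-a) x : ℂ) * (cutoff ((1 + ‖x‖ ^ 2) / 4 ^ j) - cutoff (4 * ((1 + ‖x‖ ^ 2) / 4 ^ j))) := by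
  have h4 : ((2 : ℝ) ^ j) ^ 2 = 4 ^ j := by rw [← pow_mul, mul_comm, pow_mul]; norm_num
  rw [weightPiece, profile, h4, ← mul_assoc, ← ofReal_mul, bw,
    Real.div_rpow (by positivity) (by positivity)]
  congr 3
  have : ((4 : ℝ) ^ j) ^ (-a / 2) = 2 ^ (-a * j) := by
    rw [← h4, ← pow_mul, ← Real.rpow_natCast, ← Real.rpow_mul zero_le_two]
    congr 1
    push_cast
    ring
  rw [this]
  field_simp

theorem weightPiece_eq_zero (a : ℝ) (j : ℕ) {x : V} (h : 2 * 2 ^ j ≤ ‖x‖) :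
    weightPiece a j x = 0 := by
  rw [weightPiece, profile_eq_zero_of_ge, mul_zero]
  rw [le_div_iff₀ (by positivity)]
  have : (2 * 2 ^ j : ℝ) ^ 2 ≤ ‖x‖ ^ 2 := by gcongr
  nlinarith [sq_nonneg ((2 : ℝ) ^ j)]

/-- The differences of cutoffs at consecutive scales telescope. -/
theorem sum_weightPiece (a : ℝ) (n : ℕ) (x : V) :
    ∑ j ∈ Finset.range (n + 1), weightPiece a j x =
      (bw (-a) x : ℂ) * cutoff ((1 + ‖x‖ ^ 2) / 4 ^ n) := by
  induction n with
  | zero =>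
    -- The innermost cutoff is absent because 4(1 + ‖x‖²) ≥ 2, so there is no extra piece near the
    -- origin.
    rw [zero_add, Finset.sum_range_one, weightPiece_eq, pow_zero, div_one,
      cutoff_eq_zero (u := 4 * (1 + ‖x‖ ^ 2)) (by nlinarith [sq_nonneg ‖x‖]), sub_zero]
  | succ n ih =>
    have : 4 * ((1 + ‖x‖ ^ 2) / 4 ^ (n + 1)) = (1 + ‖x‖ ^ 2) / 4 ^ n := by
      rw [pow_succ]
      field_simp
      ring
    rw [Finset.sum_range_succ, ih, weightPiece_eq, this]
    ring

theorem contDiff_weightPiece (a : ℝ) (j : ℕ) :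
    ContDiff ℝ (⊤ : ℕ∞) (weightPiece a j : V → ℂ) :=
  contDiff_const.mul ((contDiff_profile a).comp
    ((contDiff_const.add (contDiff_norm_sq ℝ)).div_const _))

theorem hasCompactSupport_weightPiece (a : ℝ) (j : ℕ) :
    HasCompactSupport (weightPiece a j : V → ℂ) :=
  HasCompactSupport.intro (isCompact_closedBall (0 : V) (2 * 2 ^ j)) fun x hx => by
    rw [mem_closedBall_zero_iff, not_le] at hx
    exact weightPiece_eq_zero a j hx.le

theorem hasTemperateGrowth_weightPiece (a : ℝ) (j : ℕ) :
    (weightPiece a j : V → ℂ).HasTemperateGrowth :=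
  (hasCompactSupport_weightPiece a j).hasTemperateGrowth (contDiff_weightPiece a j)

/-- Multiplication by the dyadic pieces of `⟨x⟩^{-a}` on the Fourier side. -/
theorem exists_l2n_weightPiece_le (hd : 3 ≤ Module.finrank ℝ V) (a s : ℝ) :
    ∃ A : ℝ≥0∞, A ≠ ⊤ ∧ ∀ (j : ℕ) (f : 𝓢(V, ℂ)),
      l2n (bwn s (𝓕⁻ (SchwartzMap.smulLeftCLM ℂ (weightPiece a j) f))) ≤
        A * ENNReal.ofReal (2 ^ (-a * j)) * l2n (bwn s (𝓕⁻ f)) ∧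
      l2n (fun ξ => ENNReal.ofReal (1 + ‖ξ‖⁻¹) *
          bwn s (𝓕⁻ (SchwartzMap.smulLeftCLM ℂ (weightPiece a j) f)) ξ) ≤
        A * ENNReal.ofReal (2 ^ ((1 - a) * j)) * l2n (bwn s (𝓕⁻ f)) := by
  obtain ⟨A, hA, hconv⟩ := exists_l2n_lconv_japKernel_le hd
  obtain ⟨N, hN⟩ := exists_nat_ge (|s| / 2)
  obtain ⟨c, hc, hker⟩ := exists_norm_fourierInv_scaled_le V (contDiff_profile a)
    (hasCompactSupport_profile a) (N + Module.finrank ℝ V)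
  refine ⟨ENNReal.ofReal (2 ^ (|s| / 2) * c) * A, ENNReal.mul_ne_top ENNReal.ofReal_ne_top hA, fun j f => ?_⟩
  have hR : (1 : ℝ) ≤ 2 ^ j := one_le_pow₀ one_le_two
  let φ : 𝓢(V, ℂ) := (hasCompactSupport_weightPiece a j).toSchwartzMap (contDiff_weightPiece a j)
  have hφ : ∀ ξ, (1 + ‖(2 ^ j : ℝ) • ξ‖ ^ 2) ^ (N + Module.finrank ℝ V) * ‖𝓕⁻ φ ξ‖ ≤
      (2 ^ (-a * j) * c) * (2 ^ j) ^ Module.finrank ℝ V := fun ξ => by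
    have e : 𝓕⁻ φ ξ = ((2 ^ (-a * j) : ℝ) : ℂ) *
        𝓕⁻ (fun x : V => profile a ((1 + ‖x‖ ^ 2) / (2 ^ j) ^ 2)) ξ := by
      rw [SchwartzMap.fourierInv_coe, Real.fourierInv_eq, Real.fourierInv_eq, ← integral_const_mul]
      congr 1
      ext x
      change _ • weightPiece a j x = _
      rw [weightPiece, Circle.smul_def, Circle.smul_def, smul_eq_mul, smul_eq_mul]
      ring
    have h := hker (2 ^ j) (by positivity) ξ
    rw [e, norm_mul, norm_real, Real.norm_of_nonneg (by positivity), mul_left_comm, mul_assoc]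
    gcongr
  have hpair : SchwartzMap.smulLeftCLM ℂ (weightPiece a j) f =
      SchwartzMap.pairing (ContinuousLinearMap.mul ℂ ℂ) φ f := by
    ext x
    rw [SchwartzMap.smulLeftCLM_apply_apply (hasTemperateGrowth_weightPiece a j),
      SchwartzMap.pairing_apply_apply]
    rfl
  have hp := bwn_fourierInv_pairing_le s hN hR φ f hφ
  rw [← hpair] at hp
  have hm := measurable_bwn s (𝓕⁻ f)
  obtain ⟨h1, h2⟩ := hconv (2 ^ j) hR _ hm
  have e1 : ENNReal.ofReal (2 ^ (|s| / 2) * (2 ^ (-a * j) * c)) =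
      ENNReal.ofReal (2 ^ (-a * j)) * ENNReal.ofReal (2 ^ (|s| / 2) * c) := by
    rw [← ENNReal.ofReal_mul (by positivity)]
    congr 1
    ring
  rw [e1] at hp
  constructor
  · refine (l2n_mono hp).trans ?_
    rw [l2n_const_mul (by finiteness)]
    calc _ ≤ ENNReal.ofReal (2 ^ (-a * j)) * ENNReal.ofReal (2 ^ (|s| / 2) * c) *
        (A * l2n (bwn s (𝓕⁻ f))) := by gcongr
      _ = _ := by ring
  · refine (l2n_mono (w := fun ξ => ENNReal.ofReal (2 ^ (-a * j)) *
      ENNReal.ofReal (2 ^ (|s| / 2) * c) * (ENNReal.ofReal (1 + ‖ξ‖⁻¹) *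
        lconv (japKernel (2 ^ j)) (bwn s (𝓕⁻ f)) ξ)) fun ξ => ?_).trans ?_
    · calc _ ≤ ENNReal.ofReal (1 + ‖ξ‖⁻¹) * (ENNReal.ofReal (2 ^ (-a * j)) *
          ENNReal.ofReal (2 ^ (|s| / 2) * c) *
            lconv (japKernel (2 ^ j)) (bwn s (𝓕⁻ f)) ξ) := by
            gcongr
            exact hp ξ
        _ = _ := by ring
    rw [l2n_const_mul (by finiteness)]
    have e2 : ENNReal.ofReal (2 ^ ((1 - a) * j)) =
        ENNReal.ofReal (2 ^ (-a * j)) * ENNReal.ofReal (2 ^ j) := by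
      rw [← ENNReal.ofReal_mul (by positivity), ← Real.rpow_natCast, ← Real.rpow_add two_pos]
      congr 2
      ring
    rw [e2]
    calc _ ≤ ENNReal.ofReal (2 ^ (-a * j)) * ENNReal.ofReal (2 ^ (|s| / 2) * c) *
        (A * ENNReal.ofReal (2 ^ j) * l2n (bwn s (𝓕⁻ f))) := by gcongr
      _ = _ := by ring

end Weights
end FreeWave

end

noncomputable section

namespace FreeWave

open Complex FourierTransform Filter Topology

/-! ### Summing the dyadic pieces of both weights. -/

section Pairing

set_option linter.unusedSectionVars false

variable {V : Type*} [NormedAddCommGroup V] [InnerProductSpace ℝ V] [FiniteDimensional ℝ V]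
  [MeasurableSpace V] [BorelSpace V]

theorem hasTemperateGrowth_bw (s : ℝ) : (fun ξ : V => (bw s ξ : ℂ)).HasTemperateGrowth :=
  Function.HasTemperateGrowth.comp Function.Complex.hasTemperateGrowth_ofReal
    (Function.hasTemperateGrowth_one_add_norm_sq_rpow V (s / 2))

theorem bw_le_one {s : ℝ} (hs : s ≤ 0) (x : V) : bw s x ≤ 1 :=
  Real.rpow_le_one_of_one_le_of_nonpos (by nlinarith [sq_nonneg ‖x‖]) (by linarith)

theorem integral_mul_fourier_eq {u : V → ℂ} (hu : Integrable u) (F : 𝓢(V, ℂ)) :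
    ∫ ξ, u ξ * 𝓕 F ξ = ∫ x, 𝓕 u x * F x := by
  have h := VectorFourier.integral_bilin_fourierIntegral_eq_flip (ContinuousLinearMap.mul ℂ ℂ)
    (L := innerₗ V) (μ := volume) (ν := volume) Real.continuous_fourierChar continuous_inner
    hu F.integrable
  simpa using! h.symm

/-- Multiplication by `⟨x⟩^{-a}` is the sum of its dyadic pieces. -/
theorem tendsto_sum_integral_weightPiece {a : ℝ} (ha : 0 ≤ a) {u : V → ℂ} (hu : Integrable u)
    (f : 𝓢(V, ℂ)) :
    Tendsto (fun n => ∑ j ∈ Finset.range n,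
      ∫ ξ, u ξ * 𝓕 (SchwartzMap.smulLeftCLM ℂ (weightPiece a j) f) ξ) atTop
      (𝓝 (∫ ξ, u ξ * 𝓕 (SchwartzMap.smulLeftCLM ℂ (fun x => (bw (-a) x : ℂ)) f) ξ)) := by
  rw [← tendsto_add_atTop_iff_nat 1]
  have hb : ∀ x, ‖𝓕 u x‖ ≤ ∫ ξ, ‖u ξ‖ := fun x =>
    VectorFourier.norm_fourierIntegral_le_integral_norm _ _ _ _ _
  have hcu : Continuous (𝓕 u) := VectorFourier.fourierIntegral_continuous
    Real.continuous_fourierChar continuous_inner hu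
  have hint : ∀ g : 𝓢(V, ℂ), Integrable fun x => 𝓕 u x * g x := fun g =>
    g.integrable.bdd_mul hcu.aestronglyMeasurable (Eventually.of_forall hb)
  -- On the physical side the transform of u is bounded and continuous, so the partial sums converge
  -- by dominated convergence.
  simp_rw [integral_mul_fourier_eq hu]
  have hs : ∀ n, ∑ j ∈ Finset.range (n + 1),
      ∫ x, 𝓕 u x * SchwartzMap.smulLeftCLM ℂ (weightPiece a j) f x =
      ∫ x, 𝓕 u x * (((bw (-a) x : ℂ) * cutoff ((1 + ‖x‖ ^ 2) / 4 ^ n)) * f x) := fun n => by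
    rw [← integral_finsetSum _ fun j _ => hint _]
    congr 1
    ext x
    rw [← sum_weightPiece, Finset.sum_mul, Finset.mul_sum]
    refine Finset.sum_congr rfl fun j _ => ?_
    rw [SchwartzMap.smulLeftCLM_apply_apply (hasTemperateGrowth_weightPiece a j), smul_eq_mul]
  simp_rw [hs, SchwartzMap.smulLeftCLM_apply_apply (hasTemperateGrowth_bw (-a)), smul_eq_mul]
  refine tendsto_integral_of_dominated_convergence (fun x => (∫ ξ, ‖u ξ‖) * ‖f x‖) (fun n => ?_)
    (f.integrable.norm.const_mul _) (fun n => Eventually.of_forall fun x => ?_)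
    (Eventually.of_forall fun x => ?_)
  · have h1 := continuous_bw (V := V) (-a)
    have h2 := contDiff_cutoff.continuous
    have h3 := f.continuous
    exact Continuous.aestronglyMeasurable (by fun_prop)
  · rw [norm_mul, norm_mul, norm_mul, norm_real, Real.norm_of_nonneg (bw_pos _ _).le]
    refine mul_le_mul (hb x) (mul_le_of_le_one_left (norm_nonneg _) ?_)
      (mul_nonneg (mul_nonneg (bw_pos _ _).le (norm_nonneg _)) (norm_nonneg _))
      ((norm_nonneg _).trans (hb x))
    exact mul_le_one₀ (bw_le_one (by linarith) x) (norm_nonneg _) (norm_cutoff_le _)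
  · refine tendsto_const_nhds.congr' ?_
    have h4 : Tendsto (fun n : ℕ => (4 : ℝ) ^ n) atTop atTop :=
      tendsto_pow_atTop_atTop_of_one_lt (by norm_num)
    filter_upwards [h4.eventually_ge_atTop (1 + ‖x‖ ^ 2)] with n hn
    rw [cutoff_eq_one ((div_le_one (by positivity)).2 hn), mul_one]

theorem enorm_le_of_tendsto_sum {z : ℕ → ℂ} {w : ℂ}
    (h : Tendsto (fun n => ∑ j ∈ Finset.range n, z j) atTop (𝓝 w)) {c q : ℝ≥0∞}
    (hz : ∀ j, ‖z j‖ₑ ≤ c * q ^ j) : ‖w‖ₑ ≤ c * (1 - q)⁻¹ := by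
  refine le_of_tendsto h.enorm (Eventually.of_forall fun n => ?_)
  calc ‖∑ j ∈ Finset.range n, z j‖ₑ ≤ ∑ j ∈ Finset.range n, ‖z j‖ₑ := enorm_sum_le _ _
    _ ≤ ∑ j ∈ Finset.range n, c * q ^ j := Finset.sum_le_sum fun j _ => hz j
    _ = c * ∑ j ∈ Finset.range n, q ^ j := by rw [Finset.mul_sum]
    _ ≤ c * ∑' j, q ^ j := by gcongr; exact ENNReal.sum_le_tsum _
    _ = _ := by rw [ENNReal.tsum_geometric]

theorem enorm_integral_smulLeftCLM_le {a : ℝ} (ha : 0 ≤ a) {u : V → ℂ} (hu : Integrable u)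
    (f : 𝓢(V, ℂ)) {c q : ℝ≥0∞}
    (h : ∀ j, ‖∫ ξ, u ξ * 𝓕 (SchwartzMap.smulLeftCLM ℂ (weightPiece a j) f) ξ‖ₑ ≤ c * q ^ j) :
    ‖∫ ξ, u ξ * 𝓕 (SchwartzMap.smulLeftCLM ℂ (fun x => (bw (-a) x : ℂ)) f) ξ‖ₑ ≤
      c * (1 - q)⁻¹ :=
  enorm_le_of_tendsto_sum (tendsto_sum_integral_weightPiece ha hu f) h

theorem fourier_apply_neg (f : 𝓢(V, ℂ)) (ξ : V) : 𝓕 f (-ξ) = 𝓕⁻ f ξ := by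
  rw [SchwartzMap.fourierInv_coe, SchwartzMap.fourier_coe, Real.fourierInv_eq_fourier_neg]

/-- The version for the second slot of the pairing, which carries the inverse transform; reflection
in ξ reduces it to the first. -/
theorem enorm_integral_smulLeftCLM_le' {a : ℝ} (ha : 0 ≤ a) {u : V → ℂ} (hu : Integrable u)
    (f : 𝓢(V, ℂ)) {c q : ℝ≥0∞}
    (h : ∀ j, ‖∫ ξ, u ξ * 𝓕⁻ (SchwartzMap.smulLeftCLM ℂ (weightPiece a j) f) ξ‖ₑ ≤ c * q ^ j) :
    ‖∫ ξ, u ξ * 𝓕⁻ (SchwartzMap.smulLeftCLM ℂ (fun x => (bw (-a) x : ℂ)) f) ξ‖ₑ ≤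
      c * (1 - q)⁻¹ := by
  have e : ∀ g : 𝓢(V, ℂ), ∫ ξ, u ξ * 𝓕⁻ g ξ = ∫ ξ, u (-ξ) * 𝓕 g ξ := fun g => by
    rw [← integral_neg_eq_self]
    simp_rw [← fourier_apply_neg, neg_neg]
  simp_rw [e] at h ⊢
  exact enorm_integral_smulLeftCLM_le ha hu.comp_neg f h

/-- The weight `1 + θ / ‖ξ‖`, for `θ = 0, 1`. -/
def lowWeight (θ : ℕ) (ξ : V) : ℝ := 1 + θ * ‖ξ‖⁻¹

theorem l2n_lowWeight_fourier (θ : ℕ) (s : ℝ) (f : 𝓢(V, ℂ)) :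
    l2n (fun ξ => ENNReal.ofReal (lowWeight θ ξ) * bwn s (𝓕 f) ξ) =
      l2n (fun ξ => ENNReal.ofReal (lowWeight θ ξ) * bwn s (𝓕⁻ f) ξ) := by
  rw [← l2n_comp_neg]
  simp only [lowWeight, bwn, norm_neg, bw_neg_arg, fourier_apply_neg]

theorem exists_l2n_lowWeight_le (hd : 3 ≤ Module.finrank ℝ V) (a s : ℝ) :
    ∃ A : ℝ≥0∞, A ≠ ⊤ ∧ ∀ θ ≤ 1, ∀ (j : ℕ) (f : 𝓢(V, ℂ)),
      l2n (fun ξ => ENNReal.ofReal (lowWeight θ ξ) *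
          bwn s (𝓕⁻ (SchwartzMap.smulLeftCLM ℂ (weightPiece a j) f)) ξ) ≤
        A * ENNReal.ofReal (2 ^ ((θ - a) * j)) * l2n (bwn s (𝓕⁻ f)) := by
  obtain ⟨A, hA, h⟩ := exists_l2n_weightPiece_le hd a s
  refine ⟨A, hA, fun θ hθ j f => ?_⟩
  interval_cases θ
  · simpa [lowWeight] using (h j f).1
  · simpa [lowWeight] using (h j f).2

theorem measurable_lowWeight (θ : ℕ) : Measurable (lowWeight θ : V → ℝ) := by
  unfold lowWeight
  fun_prop

/-- Cauchy–Schwarz with ⟨ξ⟩^(-γ) split as ⟨ξ⟩^σ ⟨ξ⟩^(-σ-γ). The parameters p and q choose which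
factor carries the low-frequency weight. -/
theorem enorm_integral_mul_le {θ : ℕ} {σ γ c : ℝ} {m' : V → ℂ}
    (hm : ∀ ξ ≠ 0, ‖m' ξ‖ ≤ c * bw (-γ) ξ * lowWeight θ ξ) (hd : 0 < Module.finrank ℝ V)
    (F H : 𝓢(V, ℂ)) (p q : ℕ) (hpq : θ = p + q) (hp0 : p = 0 ∨ q = 0) :
    ‖∫ ξ, m' ξ * F ξ * H ξ‖ₑ ≤ ENNReal.ofReal c *
      l2n (fun ξ => ENNReal.ofReal (lowWeight p ξ) * bwn σ F ξ) *
      l2n (fun ξ => ENNReal.ofReal (lowWeight q ξ) * bwn (-σ - γ) H ξ) := by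
  have : Nontrivial V := Module.nontrivial_of_finrank_pos (R := ℝ) hd
  rw [mul_assoc]
  refine (enorm_integral_le_lintegral_enorm _).trans ?_
  refine le_trans ?_ (mul_le_mul_right (lintegral_mul_le_l2n
    (((measurable_lowWeight p).ennreal_ofReal).mul (measurable_bwn σ F))
    (((measurable_lowWeight q).ennreal_ofReal).mul (measurable_bwn _ H))) _)
  rw [← lintegral_const_mul' _ _ (by finiteness)]
  refine lintegral_mono_ae ?_
  filter_upwards [Measure.ae_ne volume (0 : V)] with ξ hξ
  have hlow : lowWeight θ ξ = lowWeight p ξ * lowWeight q ξ := by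
    rcases hp0 with rfl | rfl <;> simp [lowWeight, hpq]
  have hl : ∀ r : ℕ, 0 ≤ lowWeight r ξ := fun r => by unfold lowWeight; positivity
  have hb : bw (-γ) ξ = bw σ ξ * bw (-σ - γ) ξ := by rw [bw_mul_bw]; congr 1; ring
  have hc : 0 ≤ c := by
    have h1 : 0 < lowWeight θ ξ := by unfold lowWeight; positivity
    have h2 := bw_pos (-γ) ξ
    have h3 := (norm_nonneg _).trans (hm ξ hξ)
    rw [mul_assoc] at h3
    exact nonneg_of_mul_nonneg_left h3 (by positivity)
  have h1 : ‖m' ξ‖ₑ ≤ ENNReal.ofReal c * ((ENNReal.ofReal (lowWeight p ξ) *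
      ENNReal.ofReal (bw σ ξ)) * (ENNReal.ofReal (lowWeight q ξ) *
      ENNReal.ofReal (bw (-σ - γ) ξ))) := by
    rw [← ENNReal.ofReal_mul (hl p), ← ENNReal.ofReal_mul (hl q), ← ENNReal.ofReal_mul
      (mul_nonneg (hl p) (bw_pos _ _).le), ← ENNReal.ofReal_mul hc, ← ofReal_norm]
    refine ENNReal.ofReal_le_ofReal ((hm ξ hξ).trans_eq ?_)
    rw [hb, hlow]
    ring
  rw [enorm_mul, enorm_mul]
  calc _ ≤ ENNReal.ofReal c * ((ENNReal.ofReal (lowWeight p ξ) *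
      ENNReal.ofReal (bw σ ξ)) * (ENNReal.ofReal (lowWeight q ξ) *
      ENNReal.ofReal (bw (-σ - γ) ξ))) * ‖F ξ‖ₑ * ‖H ξ‖ₑ := by gcongr
    _ = _ := by
      simp only [bwn, Pi.mul_apply]
      ring

/-- A symbol that may be replaced, on functions supported in the ball of radius `2 * 2 ^ n`, by
one of size `K 2^(κ n) ⟨ξ⟩^(-γ) (1 + θ / ‖ξ‖)`, defines an operator of order `-γ` between the
spaces with weight `⟨x⟩^a`, `a > κ`. -/
theorem exists_enorm_integral_weight_le (hd : 3 ≤ Module.finrank ℝ V) {κ θ : ℕ} (hθ : θ ≤ 1)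
    (hθκ : θ ≤ κ) {a : ℝ} (ha : κ < a) (σ γ : ℝ) :
    ∃ A : ℝ≥0∞, A ≠ ⊤ ∧ ∀ (m : V → ℂ) (B K : ℝ), AEStronglyMeasurable m → (∀ ξ, ‖m ξ‖ ≤ B) →
      (∀ n : ℕ, ∃ m' : V → ℂ,
        (∀ ξ ≠ 0, ‖m' ξ‖ ≤ K * 2 ^ (κ * n) * bw (-γ) ξ * lowWeight θ ξ) ∧
        ∀ F H : 𝓢(V, ℂ), (∀ x, 2 * 2 ^ n ≤ ‖x‖ → F x = 0) → (∀ x, 2 * 2 ^ n ≤ ‖x‖ → H x = 0) →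
          ∫ ξ, m ξ * 𝓕 F ξ * 𝓕⁻ H ξ = ∫ ξ, m' ξ * 𝓕 F ξ * 𝓕⁻ H ξ) →
      ∀ f h : 𝓢(V, ℂ),
        ‖∫ ξ, m ξ * 𝓕 (SchwartzMap.smulLeftCLM ℂ (fun x => (bw (-a) x : ℂ)) f) ξ *
          𝓕⁻ (SchwartzMap.smulLeftCLM ℂ (fun x => (bw (-a) x : ℂ)) h) ξ‖ₑ ≤
        A * ENNReal.ofReal K * l2n (bwn σ (𝓕⁻ f)) * l2n (bwn (-σ - γ) (𝓕⁻ h)) := by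
  obtain ⟨A₁, hA₁, h₁⟩ := exists_l2n_lowWeight_le hd a σ
  obtain ⟨A₂, hA₂, h₂⟩ := exists_l2n_lowWeight_le hd a (-σ - γ)
  -- The common ratio of both geometric series, less than 1 exactly because a > κ.
  set q : ℝ≥0∞ := ENNReal.ofReal (2 ^ (κ - a)) with hq
  have hq1 : q < 1 := by
    rw [hq, ENNReal.ofReal_lt_one]
    exact Real.rpow_lt_one_of_one_lt_of_neg one_lt_two (by linarith)
  have hq2 : (1 - q)⁻¹ ≠ ⊤ := ENNReal.inv_ne_top.2 (tsub_pos_of_lt hq1).ne'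
  have ha0 : 0 ≤ a := (Nat.cast_nonneg κ).trans ha.le
  refine ⟨A₁ * A₂ * ((1 - q)⁻¹ * (1 - q)⁻¹),
    ENNReal.mul_ne_top (ENNReal.mul_ne_top hA₁ hA₂) (ENNReal.mul_ne_top hq2 hq2),
    fun m B K hm hB hK f h => ?_⟩
  have hK0 : ∀ n : ℕ, ENNReal.ofReal (K * 2 ^ (κ * n)) =
      ENNReal.ofReal K * ENNReal.ofReal (2 ^ ((κ : ℝ) * n)) := fun n => by
    rw [mul_comm, ENNReal.ofReal_mul (by positivity), mul_comm]
    congr 2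
    rw [← Real.rpow_natCast]
    push_cast
    rfl
  have hqpow : ∀ n : ℕ, q ^ n = ENNReal.ofReal (2 ^ ((κ - a) * n)) := fun n => by
    rw [hq, ← ENNReal.ofReal_pow (by positivity), ← Real.rpow_natCast, ← Real.rpow_mul zero_le_two]
  have hsupp : ∀ {i n : ℕ} (g : 𝓢(V, ℂ)), i ≤ n → ∀ x, 2 * 2 ^ n ≤ ‖x‖ →
      SchwartzMap.smulLeftCLM ℂ (weightPiece a i) g x = 0 := fun {i n} g hin x hx => by
    rw [SchwartzMap.smulLeftCLM_apply_apply (hasTemperateGrowth_weightPiece a i),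
      weightPiece_eq_zero a i, zero_smul]
    refine le_trans ?_ hx
    have : (2 : ℝ) ^ i ≤ 2 ^ n := pow_le_pow_right₀ one_le_two hin
    linarith
  have hmain : ∀ i j : ℕ, ‖∫ ξ, m ξ * 𝓕 (SchwartzMap.smulLeftCLM ℂ (weightPiece a i) f) ξ *
      𝓕⁻ (SchwartzMap.smulLeftCLM ℂ (weightPiece a j) h) ξ‖ₑ ≤
      (A₁ * A₂ * ENNReal.ofReal K * l2n (bwn σ (𝓕⁻ f)) * l2n (bwn (-σ - γ) (𝓕⁻ h))) * q ^ i *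
        q ^ j := fun i j => by
    -- The larger index fixes the ball and costs 2^(κ max(i,j)). The singular factor goes to the
    -- smaller index, where its cost 2^(θ min(i,j)) is covered by θ ≤ κ. On the larger index the
    -- total would be 2^((κ+θ-a) max(i,j)), which need not be summable.
    rcases le_total i j with hij | hij
    · obtain ⟨m', hm', he⟩ := hK j
      rw [he _ _ (hsupp f hij) (hsupp h le_rfl)]
      refine (enorm_integral_mul_le (σ := σ) hm' (by omega) _ _ θ 0 rfl
        (Or.inr rfl)).trans ?_
      rw [l2n_lowWeight_fourier, hK0]
      calc _ ≤ ENNReal.ofReal K * ENNReal.ofReal (2 ^ ((κ : ℝ) * j)) *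
            (A₁ * ENNReal.ofReal (2 ^ ((θ - a) * i)) * l2n (bwn σ (𝓕⁻ f))) *
            (A₂ * ENNReal.ofReal (2 ^ (((0 : ℕ) - a) * j)) * l2n (bwn (-σ - γ) (𝓕⁻ h))) := by
            gcongr
            · exact h₁ θ hθ i f
            · exact h₂ 0 zero_le_one j h
        _ = A₁ * A₂ * ENNReal.ofReal K * l2n (bwn σ (𝓕⁻ f)) * l2n (bwn (-σ - γ) (𝓕⁻ h)) *
            ENNReal.ofReal (2 ^ ((θ - a) * i)) * (ENNReal.ofReal (2 ^ ((κ : ℝ) * j)) *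
              ENNReal.ofReal (2 ^ (((0 : ℕ) - a) * j))) := by ring
        _ ≤ A₁ * A₂ * ENNReal.ofReal K * l2n (bwn σ (𝓕⁻ f)) * l2n (bwn (-σ - γ) (𝓕⁻ h)) *
            ENNReal.ofReal (2 ^ ((κ - a) * i)) * ENNReal.ofReal (2 ^ ((κ - a) * j)) := by
            rw [← ENNReal.ofReal_mul (by positivity), ← Real.rpow_add two_pos]
            have hθκ' : (θ : ℝ) ≤ κ := by exact_mod_cast hθκ
            have e1 : (κ : ℝ) * j + ((0 : ℕ) - a) * j = (κ - a) * j := by push_cast; ring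
            rw [e1]
            gcongr
            exact one_le_two
        _ = _ := by rw [← hqpow, ← hqpow]
    · obtain ⟨m', hm', he⟩ := hK i
      rw [he _ _ (hsupp f le_rfl) (hsupp h hij)]
      refine (enorm_integral_mul_le (σ := σ) hm' (by omega) _ _ 0 θ (zero_add θ).symm
        (Or.inl rfl)).trans ?_
      rw [l2n_lowWeight_fourier, hK0]
      calc _ ≤ ENNReal.ofReal K * ENNReal.ofReal (2 ^ ((κ : ℝ) * i)) *
            (A₁ * ENNReal.ofReal (2 ^ (((0 : ℕ) - a) * i)) * l2n (bwn σ (𝓕⁻ f))) *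
            (A₂ * ENNReal.ofReal (2 ^ ((θ - a) * j)) * l2n (bwn (-σ - γ) (𝓕⁻ h))) := by
            gcongr
            · exact h₁ 0 zero_le_one i f
            · exact h₂ θ hθ j h
        _ = A₁ * A₂ * ENNReal.ofReal K * l2n (bwn σ (𝓕⁻ f)) * l2n (bwn (-σ - γ) (𝓕⁻ h)) *
            (ENNReal.ofReal (2 ^ ((κ : ℝ) * i)) * ENNReal.ofReal (2 ^ (((0 : ℕ) - a) * i))) *
              ENNReal.ofReal (2 ^ ((θ - a) * j)) := by ring
        _ ≤ A₁ * A₂ * ENNReal.ofReal K * l2n (bwn σ (𝓕⁻ f)) * l2n (bwn (-σ - γ) (𝓕⁻ h)) *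
            ENNReal.ofReal (2 ^ ((κ - a) * i)) * ENNReal.ofReal (2 ^ ((κ - a) * j)) := by
            rw [← ENNReal.ofReal_mul (by positivity), ← Real.rpow_add two_pos]
            have hθκ' : (θ : ℝ) ≤ κ := by exact_mod_cast hθκ
            have e1 : (κ : ℝ) * i + ((0 : ℕ) - a) * i = (κ - a) * i := by push_cast; ring
            rw [e1]
            gcongr
            exact one_le_two
        _ = _ := by rw [← hqpow, ← hqpow]
  have hint : ∀ g : 𝓢(V, ℂ), Integrable fun ξ => m ξ * g ξ := fun g =>
    g.integrable.bdd_mul hm (Eventually.of_forall hB)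
  -- The pieces of the second weight are summed with i fixed, and those of the first weight
  -- afterwards. The crude bound B on m serves only for integrability.
  have h3 : ∀ i, ‖∫ ξ, m ξ * 𝓕 (SchwartzMap.smulLeftCLM ℂ (weightPiece a i) f) ξ *
      𝓕⁻ (SchwartzMap.smulLeftCLM ℂ (fun x => (bw (-a) x : ℂ)) h) ξ‖ₑ ≤
      (A₁ * A₂ * ENNReal.ofReal K * l2n (bwn σ (𝓕⁻ f)) * l2n (bwn (-σ - γ) (𝓕⁻ h))) * q ^ i *
        (1 - q)⁻¹ := fun i =>
    enorm_integral_smulLeftCLM_le' ha0 (hint _) h (hmain i)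
  have h4 := enorm_integral_smulLeftCLM_le (c := A₁ * A₂ * ENNReal.ofReal K *
    l2n (bwn σ (𝓕⁻ f)) * l2n (bwn (-σ - γ) (𝓕⁻ h)) * (1 - q)⁻¹) (q := q) ha0
    (hint (𝓕⁻ (SchwartzMap.smulLeftCLM ℂ (fun x => (bw (-a) x : ℂ)) h))) f (fun i => by
      simp_rw [mul_right_comm (m _)]
      exact (h3 i).trans_eq (mul_right_comm _ _ _))
  simp_rw [mul_right_comm (m _)] at h4
  exact h4.trans_eq (by ring)

end Pairing
end FreeWave

end

noncomputable section

namespace FreeWave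

open Complex FourierTransform Filter Topology

/-! ### Bounds at fixed z, for integrability only. -/

section SymbolBounds

variable {V : Type*} [NormedAddCommGroup V]

theorem continuous_symL {z : ℂ} (hz : z.im ≠ 0) : Continuous (symL z : V → ℂ) := by
  unfold symL
  exact Continuous.inv₀ (by fun_prop) fun ξ => sq_sub_sq_ne_zero hz _

theorem continuous_symC_symS {z : ℂ} (hz : z.im ≠ 0) (k : ℕ) :
    Continuous (symC z k : V → ℂ) ∧ Continuous (symS z k : V → ℂ) := by
  have hL := continuous_symL (V := V) hz
  induction k with
  | zero => exact ⟨continuous_const, continuous_const⟩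
  | succ k ih =>
    obtain ⟨h1, h2⟩ := ih
    refine ⟨?_, ?_⟩
    · rw [show (symC z (k + 1) : V → ℂ) = _ from funext (symC_succ z k)]
      fun_prop
    · rw [show (symS z (k + 1) : V → ℂ) = _ from funext (symS_succ z k)]
      fun_prop

theorem abs_im_le_norm_ofReal_sub (z : ℂ) (r : ℝ) : |z.im| ≤ ‖(r : ℂ) - z‖ := by
  simpa using abs_im_le_norm ((r : ℂ) - z)

theorem norm_symL_le {z : ℂ} (hz : z.im ≠ 0) (ξ : V) : ‖symL z ξ‖ ≤ (|z.im| ^ 2)⁻¹ := by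
  have h1 := abs_im_le_norm_ofReal_sub z (2 * Real.pi * ‖ξ‖)
  have h2 := abs_im_le_norm_ofReal_sub (-z) (2 * Real.pi * ‖ξ‖)
  rw [neg_im, abs_neg] at h2
  have h0 : 0 < |z.im| := abs_pos.2 hz
  rw [symL, norm_inv]
  apply inv_anti₀ (by positivity)
  have : (((2 * Real.pi * ‖ξ‖) ^ 2 : ℝ) : ℂ) - z ^ 2 =
    (((2 * Real.pi * ‖ξ‖ : ℝ) : ℂ) - z) * (((2 * Real.pi * ‖ξ‖ : ℝ) : ℂ) - -z) := by
    push_cast; ring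
  rw [this, norm_mul, sq]
  gcongr

theorem norm_symC_le {z : ℂ} (hz : z.im ≠ 0) (k : ℕ) (ξ : V) :
    ‖symC z k ξ‖ ≤ (|z.im|⁻¹) ^ k := by
  have h0 : 0 < |z.im| := abs_pos.2 hz
  have h := congrArg norm (symC_eq hz k ξ)
  have hb : ∀ r : ℝ, ‖(((r : ℂ) - z)⁻¹) ^ k‖ ≤ (|z.im|⁻¹) ^ k := fun r => by
    rw [norm_pow, norm_inv]
    have := abs_im_le_norm_ofReal_sub z r
    gcongr
  have h1 := norm_add_le ((((2 * Real.pi * ‖ξ‖ : ℝ) - z : ℂ)⁻¹) ^ k)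
    (((-(2 * Real.pi * ‖ξ‖ : ℝ) - z : ℂ)⁻¹) ^ k)
  have h2 := hb (2 * Real.pi * ‖ξ‖)
  have h3 := hb (-(2 * Real.pi * ‖ξ‖))
  rw [ofReal_neg] at h3
  rw [norm_mul, Complex.norm_ofNat] at h
  linarith

/-- Degenerates as Im z → 0; it makes the pairings absolutely convergent and never enters the
uniform constants. -/
theorem exists_norm_symS_le {z : ℂ} (hz : z.im ≠ 0) (k : ℕ) :
    ∃ B : ℝ, ∀ ξ : V, ‖symS z k ξ‖ ≤ B := by
  induction k with
  | zero => exact ⟨0, fun ξ => by simp⟩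
  | succ k ih =>
    obtain ⟨B, hB⟩ := ih
    refine ⟨(|z.im| ^ 2)⁻¹ * (‖z‖ * B + (|z.im|⁻¹) ^ k), fun ξ => ?_⟩
    rw [symS_succ, norm_mul]
    refine mul_le_mul (norm_symL_le hz ξ) ((norm_add_le _ _).trans ?_) (norm_nonneg _)
      (by positivity)
    rw [norm_mul]
    exact add_le_add (mul_le_mul_of_nonneg_left (hB ξ) (norm_nonneg _)) (norm_symC_le hz k ξ)

end SymbolBounds

/-! ### Uniform bounds for the weighted pairings. -/

section Estimates

set_option linter.unusedSectionVars false

variable {V : Type*} [NormedAddCommGroup V] [InnerProductSpace ℝ V] [FiniteDimensional ℝ V]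
  [MeasurableSpace V] [BorelSpace V]

theorem bw_natCast_le (n : ℕ) (ξ : V) : bw n ξ ≤ (1 + 2 * Real.pi * ‖ξ‖) ^ n := by
  have h : 1 + ‖ξ‖ ^ 2 ≤ (1 + 2 * Real.pi * ‖ξ‖) ^ 2 := by
    have h1 : ‖ξ‖ ≤ 2 * Real.pi * ‖ξ‖ :=
      le_mul_of_one_le_left (norm_nonneg _) (by linarith [Real.pi_gt_three])
    have h2 := norm_nonneg ξ
    nlinarith
  have h0 : 0 ≤ 1 + 2 * Real.pi * ‖ξ‖ := by have := Real.pi_pos; positivity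
  calc bw n ξ ≤ ((1 + 2 * Real.pi * ‖ξ‖) ^ 2) ^ ((n : ℝ) / 2) :=
        Real.rpow_le_rpow (by positivity) h (by positivity)
    _ = _ := by
        rw [← Real.rpow_natCast, ← Real.rpow_natCast, ← Real.rpow_mul h0]
        congr 1
        push_cast
        ring

theorem le_mul_bw_neg {n : ℕ} {ξ : V} {x y : ℝ} (hx : 0 ≤ x)
    (h : (1 + 2 * Real.pi * ‖ξ‖) ^ n * x ≤ y) : x ≤ y * bw (-n) ξ := by
  have h1 : bw n ξ * x ≤ y := (mul_le_mul_of_nonneg_right (bw_natCast_le n ξ) hx).trans h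
  calc x = (bw n ξ * x) * bw (-n) ξ := by
        rw [mul_right_comm, mul_comm (bw n ξ), bw_neg_mul_bw, one_mul]
    _ ≤ _ := mul_le_mul_of_nonneg_right h1 (bw_pos _ _).le

/-- The Fourier transform of `𝓕 F * 𝓕⁻ H` vanishes outside the ball of radius `2 R` if `F` and
`H` vanish outside the ball of radius `R`. -/
theorem fourier_pairing_eq_zero {R : ℝ} {F H : 𝓢(V, ℂ)} (hF : ∀ x, R ≤ ‖x‖ → F x = 0)
    (hH : ∀ x, R ≤ ‖x‖ → H x = 0) {x : V} (hx : 2 * R ≤ ‖x‖) :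
    𝓕 (SchwartzMap.pairing (ContinuousLinearMap.mul ℂ ℂ) (𝓕 F) (𝓕⁻ H)) x = 0 := by
  rw [← neg_neg x, fourier_apply_neg, fourierInv_pairing_apply]
  have : ∀ η, 𝓕⁻ (𝓕 F) (-x - η) * 𝓕⁻ (𝓕⁻ H) η = 0 := fun η => by
    rw [FourierTransform.fourierInv_fourier_eq (F := 𝓢(V, ℂ)), ← fourier_apply_neg,
      FourierTransform.fourier_fourierInv_eq (F := 𝓢(V, ℂ))]
    rcases le_total R ‖-η‖ with h | h
    · rw [hH _ h, mul_zero]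
    · rw [hF, zero_mul]
      have h2 := norm_sub_norm_le (-x) η
      rw [norm_neg] at h h2
      linarith
  simp only [this, integral_zero]

variable {m : ℕ}

/-- The product of the two transforms has its own transform supported in the ball of radius 2R, so
times t > 2R do not contribute and the truncation at scale 2R changes nothing. -/
theorem integral_symC_eq (hm : 1 ≤ m) (hd : Module.finrank ℝ V = 2 * m + 1) {z : ℂ}
    (hz : 0 < z.im) (n : ℕ) {R : ℝ} (hR : 0 < R) {F H : 𝓢(V, ℂ)}
    (hF : ∀ x, R ≤ ‖x‖ → F x = 0) (hH : ∀ x, R ≤ ‖x‖ → H x = 0) :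
    ∫ ξ, symC z (n + 1) ξ * 𝓕 F ξ * 𝓕⁻ H ξ = ∫ ξ, ((I ^ (n + 1) / n.factorial) *
      cosMultiplier (fun t => powTrunc n (2 * R) t * cexp (I * z * t)) ξ) * 𝓕 F ξ * 𝓕⁻ H ξ := by
  have h := integral_cosMultiplier_congr hm hd (R := 2 * R) (by positivity)
    (fun x hx => fourier_pairing_eq_zero hF hH hx)
    (a := fun t => (t : ℂ) ^ n * cexp (I * z * t))
    (b := fun t => powTrunc n (2 * R) t * cexp (I * z * t))
    (integrableOn_mul_cexp (n := n) (by fun_prop) (fun t ht => by simp [abs_of_pos ht]) hz)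
    (integrableOn_mul_cexp (continuous_powTrunc _ _) (fun t => norm_powTrunc_le _ _) hz)
    (fun t ht htR => by rw [powTrunc_eq_pow n (by positivity) htR])
  simp only [SchwartzMap.pairing_apply_apply, ContinuousLinearMap.mul_apply', mul_assoc] at h
  simp_rw [symC_succ_eq_cosMultiplier hz, mul_assoc, integral_const_mul, h]

theorem integral_symS_eq (hm : 1 ≤ m) (hd : Module.finrank ℝ V = 2 * m + 1) {z : ℂ}
    (hz : 0 < z.im) (n : ℕ) {R : ℝ} (hR : 0 < R) {F H : 𝓢(V, ℂ)}
    (hF : ∀ x, R ≤ ‖x‖ → F x = 0) (hH : ∀ x, R ≤ ‖x‖ → H x = 0) :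
    ∫ ξ, symS z (n + 1) ξ * 𝓕 F ξ * 𝓕⁻ H ξ = ∫ ξ, ((-I * I ^ (n + 1) / n.factorial) *
      sinMultiplier (fun t => powTrunc n (2 * R) t * cexp (I * z * t)) ξ) * 𝓕 F ξ * 𝓕⁻ H ξ := by
  have : Nontrivial V := Module.nontrivial_of_finrank_pos (R := ℝ) (by omega)
  have hc := continuous_powTrunc n (2 * R)
  have h := integral_sinMultiplier_congr hm hd (R := 2 * R) (by positivity)
    (fun x hx => fourier_pairing_eq_zero hF hH hx)
    (a := fun t => (t : ℂ) ^ n * cexp (I * z * t))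
    (b := fun t => powTrunc n (2 * R) t * cexp (I * z * t))
    (by
      simp_rw [← mul_assoc]
      exact integrableOn_mul_cexp (n := n + 1) (by fun_prop)
        (fun t ht => by simp [abs_of_pos ht, pow_succ']) hz)
    (Continuous.aestronglyMeasurable (by fun_prop))
    (by
      simp_rw [← mul_assoc]
      refine integrableOn_mul_cexp (n := n + 1) (by fun_prop) (fun t ht => ?_) hz
      rw [norm_mul, norm_real, Real.norm_of_nonneg ht.le, pow_succ']
      exact mul_le_mul_of_nonneg_left (norm_powTrunc_le _ _ ht) ht.le)
    (Continuous.aestronglyMeasurable (by fun_prop))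
    (fun t ht htR => by rw [powTrunc_eq_pow n (by positivity) htR])
  simp only [SchwartzMap.pairing_apply_apply, ContinuousLinearMap.mul_apply', mul_assoc] at h
  calc _ = ∫ ξ, ((-I * I ^ (n + 1) / n.factorial) *
        sinMultiplier (fun t => (t : ℂ) ^ n * cexp (I * z * t)) ξ) * 𝓕 F ξ * 𝓕⁻ H ξ := by
        refine integral_congr_ae ?_
        filter_upwards [Measure.ae_ne volume (0 : V)] with ξ hξ
        rw [symS_succ_eq_sinMultiplier hz n hξ]
    _ = _ := by simp_rw [mul_assoc, integral_const_mul, h]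

theorem norm_I_pow_div_factorial_le (n : ℕ) : ‖(I ^ (n + 1) / n.factorial : ℂ)‖ ≤ 1 := by
  rw [norm_div, norm_pow, norm_I, one_pow, norm_natCast]
  exact div_le_one_of_le₀ (by exact_mod_cast n.factorial_pos) (by positivity)

/-- The pairing `⟨m(D) ⟨x⟩^{-a} f, ⟨x⟩^{-a} h⟩`. -/
def weightedPairing (a : ℝ) (m : V → ℂ) (f h : 𝓢(V, ℂ)) : ℂ :=
  ∫ ξ, m ξ * 𝓕 (SchwartzMap.smulLeftCLM ℂ (fun x => (bw (-a) x : ℂ)) f) ξ *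
    𝓕⁻ (SchwartzMap.smulLeftCLM ℂ (fun x => (bw (-a) x : ℂ)) h) ξ

theorem weightedPairing_const_mul (a : ℝ) (c : ℂ) (m : V → ℂ) (f h : 𝓢(V, ℂ)) :
    weightedPairing a (fun ξ => c * m ξ) f h = c * weightedPairing a m f h := by
  simp_rw [weightedPairing, mul_assoc, integral_const_mul]

theorem pow_two_mul_two_mul_pow (n N : ℕ) : ((2 : ℝ) * (2 * 2 ^ N)) ^ (n + 1) =
    4 ^ (n + 1) * 2 ^ ((n + 1) * N) := by
  rw [← mul_assoc, mul_pow, ← pow_mul, mul_comm N]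
  norm_num

/-- The truncated symbol at scale 2ᴺ has size 2^(kN) ⟨ξ⟩⁻ᵏ with no low-frequency singularity, so the
dyadic summation applies with growth exponent k and θ = 0. -/
theorem exists_enorm_weightedPairing_symC_le (hm : 1 ≤ m) (hd : Module.finrank ℝ V = 2 * m + 1)
    (k : ℕ) {a : ℝ} (ha : k < a) (C σ : ℝ) :
    ∃ A : ℝ≥0∞, A ≠ ⊤ ∧ ∀ z : ℂ, z.im ≠ 0 → ‖z‖ ≤ C → ∀ f h : 𝓢(V, ℂ),
      ‖weightedPairing a (symC z k) f h‖ₑ ≤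
        A * l2n (bwn σ (𝓕⁻ f)) * l2n (bwn (-σ - k) (𝓕⁻ h)) := by
  obtain ⟨A, hA, hcore⟩ := exists_enorm_integral_weight_le (V := V) (by omega) (κ := k) (θ := 0)
    zero_le_one (Nat.zero_le k) ha σ k
  suffices h : ∃ K : ℝ, ∀ z : ℂ, 0 < z.im → ‖z‖ ≤ C → ∀ f h : 𝓢(V, ℂ),
      ‖weightedPairing a (symC z k) f h‖ₑ ≤
        A * ENNReal.ofReal K * l2n (bwn σ (𝓕⁻ f)) * l2n (bwn (-σ - k) (𝓕⁻ h)) by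
    obtain ⟨K, hK⟩ := h
    refine ⟨A * ENNReal.ofReal K, ENNReal.mul_ne_top hA ENNReal.ofReal_ne_top,
      fun z hz hzC f h => ?_⟩
    -- In the lower half plane the reflected symbol differs only by a sign.
    rcases lt_or_gt_of_ne hz with hz | hz
    · have e : (symC z k : V → ℂ) = fun ξ => (-1) ^ k * symC (-z) k ξ := by
        ext ξ
        simpa using (neg_symmetry_symPair (-z) k ξ).1
      rw [e, weightedPairing_const_mul, enorm_mul]
      simpa using hK (-z) (by simpa using hz) (by simpa using hzC) f h
    · exact hK z hz hzC f h
  cases k with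
  -- The symbol is 1, which has no time representation; the weights alone are handled without
  -- truncation.
  | zero =>
    refine ⟨1, fun z hz hzC f h => hcore (symC z 0) 1 1 ?_ ?_ (fun n => ⟨symC z 0, ?_, ?_⟩) f h⟩
    · exact (continuous_symC_symS hz.ne' 0).1.aestronglyMeasurable
    · simp
    · simp [lowWeight, bw_zero]
    · simp
  | succ n =>
    obtain ⟨K, hK0, hK⟩ := exists_norm_cosMultiplier_le V n C
    refine ⟨K * 4 ^ (n + 1), fun z hz hzC f h => hcore (symC z (n + 1)) _ _
      (continuous_symC_symS hz.ne' _).1.aestronglyMeasurable (norm_symC_le hz.ne' _)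
      (fun N => ⟨_, ?_, fun F H hF hH => integral_symC_eq hm hd hz n (by positivity) hF hH⟩) f h⟩
    intro ξ hξ
    -- Pieces up to index N vanish outside radius 2 · 2ᴺ, and the truncation time is twice that
    -- radius.
    have h1 := hK (2 * (2 * 2 ^ N)) (by
      have : (1 : ℝ) ≤ 2 ^ N := one_le_pow₀ one_le_two
      linarith) z hz hzC ξ
    rw [norm_mul]
    have h2 := le_mul_bw_neg (norm_nonneg _) h1
    refine (mul_le_of_le_one_left (norm_nonneg _) (norm_I_pow_div_factorial_le n)).trans
      (h2.trans_eq ?_)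
    rw [pow_two_mul_two_mul_pow]
    simp only [lowWeight, Nat.cast_zero, zero_mul, add_zero, mul_one]
    ring

/-- One order better than the even part, because of the extra 1/ρ, at the price of the low-frequency
weight θ = 1. The requirement θ ≤ k holds since the symbol is zero for k = 0. -/
theorem exists_enorm_weightedPairing_symS_le (hm : 1 ≤ m) (hd : Module.finrank ℝ V = 2 * m + 1)
    (k : ℕ) {a : ℝ} (ha : k < a) (C σ : ℝ) :
    ∃ A : ℝ≥0∞, A ≠ ⊤ ∧ ∀ z : ℂ, z.im ≠ 0 → ‖z‖ ≤ C → ∀ f h : 𝓢(V, ℂ),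
      ‖weightedPairing a (symS z k) f h‖ₑ ≤
        A * l2n (bwn σ (𝓕⁻ f)) * l2n (bwn (-σ - (k + 1)) (𝓕⁻ h)) := by
  cases k with
  | zero => exact ⟨0, ENNReal.zero_ne_top, fun z hz hzC f h => by simp [weightedPairing]⟩
  | succ n =>
  obtain ⟨A, hA, hcore⟩ := exists_enorm_integral_weight_le (V := V) (by omega) (κ := n + 1)
    (θ := 1) le_rfl (by omega) ha σ (n + 2 : ℕ)
  have eγ : ((n + 2 : ℕ) : ℝ) = ((n + 1 : ℕ) : ℝ) + 1 := by push_cast; ring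
  rw [eγ] at hcore
  suffices h : ∃ K : ℝ, ∀ z : ℂ, 0 < z.im → ‖z‖ ≤ C → ∀ f h : 𝓢(V, ℂ),
      ‖weightedPairing a (symS z (n + 1)) f h‖ₑ ≤
        A * ENNReal.ofReal K * l2n (bwn σ (𝓕⁻ f)) *
          l2n (bwn (-σ - ((n + 1 : ℕ) + 1)) (𝓕⁻ h)) by
    obtain ⟨K, hK⟩ := h
    refine ⟨A * ENNReal.ofReal K, ENNReal.mul_ne_top hA ENNReal.ofReal_ne_top,
      fun z hz hzC f h => ?_⟩
    rcases lt_or_gt_of_ne hz with hz | hz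
    · have e : (symS z (n + 1) : V → ℂ) = fun ξ => (-1) ^ (n + 2) * symS (-z) (n + 1) ξ := by
        ext ξ
        simpa using (neg_symmetry_symPair (-z) (n + 1) ξ).2
      rw [e, weightedPairing_const_mul, enorm_mul]
      simpa using hK (-z) (by simpa using hz) (by simpa using hzC) f h
    · exact hK z hz hzC f h
  obtain ⟨K, hK0, hK⟩ := exists_norm_sinMultiplier_le V n C
  refine ⟨K * 4 ^ (n + 1), fun z hz hzC f h => ?_⟩
  obtain ⟨B, hB⟩ := exists_norm_symS_le (V := V) hz.ne' (n + 1)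
  refine hcore (symS z (n + 1)) B _
    (continuous_symC_symS hz.ne' _).2.aestronglyMeasurable hB
    (fun N => ⟨_, ?_, fun F H hF hH => integral_symS_eq hm hd hz n (by positivity) hF hH⟩) f h
  intro ξ hξ
  have h1 := hK (2 * (2 * 2 ^ N)) (by
    have : (1 : ℝ) ≤ 2 ^ N := one_le_pow₀ one_le_two
    linarith) z hz hzC ξ
  rw [norm_mul, neg_mul, neg_div, norm_neg, mul_div_assoc, norm_mul, norm_I, one_mul]
  refine (mul_le_of_le_one_left (norm_nonneg _) (norm_I_pow_div_factorial_le n)).trans ?_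
  rw [pow_two_mul_two_mul_pow] at h1
  set S := ‖sinMultiplier (fun t => powTrunc n (2 * (2 * 2 ^ N)) t * cexp (I * z * t)) ξ‖ with hS
  have hS0 : 0 ≤ S := norm_nonneg _
  have hx : 0 < ‖ξ‖ := norm_pos_iff.2 hξ
  have hρ : 0 < 2 * Real.pi * ‖ξ‖ := by positivity
  -- Trades the factor ρ for one more power of 1 + ρ: the quotient (1 + ρ)/ρ is at most 1 + 1/‖ξ‖.
  have hle : (1 + 2 * Real.pi * ‖ξ‖) * (2 * Real.pi * ‖ξ‖)⁻¹ ≤ lowWeight 1 ξ := by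
    rw [add_mul, mul_inv_cancel₀ hρ.ne', one_mul, lowWeight, Nat.cast_one, one_mul, add_comm]
    gcongr
    exact le_mul_of_one_le_left hx.le (by linarith [Real.pi_gt_three])
  have h2 : (1 + 2 * Real.pi * ‖ξ‖) ^ (n + 2) * S ≤
      K * (4 ^ (n + 1) * 2 ^ ((n + 1) * N)) * lowWeight 1 ξ := by
    calc (1 + 2 * Real.pi * ‖ξ‖) ^ (n + 2) * S =
        ((1 + 2 * Real.pi * ‖ξ‖) ^ (n + 1) * (2 * Real.pi * ‖ξ‖ * S)) *
          ((1 + 2 * Real.pi * ‖ξ‖) * (2 * Real.pi * ‖ξ‖)⁻¹) := by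
          field_simp
          ring
      _ ≤ _ := by gcongr
  refine (le_mul_bw_neg hS0 h2).trans_eq ?_
  rw [eγ]
  ring

end Estimates
end FreeWave

end

noncomputable section

namespace FreeWave

open Complex FourierTransform Filter Topology

/-! ### From bounds on pairings to bounded operators between Sobolev spaces. -/

section Duality

variable {d : ℕ}

/-- A tempered distribution in `H^s`, as an element of `H^s`. -/
def Sobolev.mk {s : ℝ} (u : Distr d) (hu : MemSobolev s 2 u) : Sobolev d s := ⟨u, hu⟩

@[simp] theorem Sobolev.toDistr_mk {s : ℝ} (u : Distr d) (hu : MemSobolev s 2 u) :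
    (Sobolev.mk u hu).toDistr = u := rfl

theorem denseRange_schwartz_toLp :
    DenseRange (SchwartzMap.toLpCLM ℂ ℂ 2 (volume : Measure (EuclideanSpace ℝ (Fin d)))) :=
  SchwartzMap.denseRange_toLpCLM (F := ℂ) (p := 2) (by norm_num)

/-- A distribution which is bounded in the `L²` norm is an `L²` function. -/
theorem exists_toTemperedDistribution_eq (w : Distr d) {M : ℝ}
    (h : ∀ φ : 𝓢(EuclideanSpace ℝ (Fin d), ℂ), ‖w φ‖ ≤ M * ‖φ.toLp 2‖) :
    ∃ g : L2 d, (g : Distr d) = w ∧ ∀ M' : ℝ, 0 ≤ M' →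
      (∀ φ : 𝓢(EuclideanSpace ℝ (Fin d), ℂ), ‖w φ‖ ≤ M' * ‖φ.toLp 2‖) → ‖g‖ ≤ M' := by
  let e : 𝓢(EuclideanSpace ℝ (Fin d), ℂ) →ₗ[ℂ] L2 d := (SchwartzMap.toLpCLM ℂ ℂ 2 volume).toLinearMap
  let l : 𝓢(EuclideanSpace ℝ (Fin d), ℂ) →ₗ[ℂ] ℂ :=
    { toFun := fun φ => w φ, map_add' := fun _ _ => map_add _ _ _, map_smul' := fun _ _ => map_smul _ _ _ }
  let L : L2 d →L[ℂ] ℂ := l.extendOfNorm e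
  have hL : ∀ φ : 𝓢(EuclideanSpace ℝ (Fin d), ℂ), L (φ.toLp 2) = w φ := fun φ =>
    LinearMap.extendOfNorm_eq denseRange_schwartz_toLp ⟨M, h⟩ φ
  let g₀ : L2 d := (InnerProductSpace.toDual ℂ (L2 d)).symm L
  -- The action of a distribution is bilinear whereas the Riesz representation is sesquilinear,
  -- hence the conjugate.
  refine ⟨star g₀, ?_, fun M' hM' h' => ?_⟩
  · ext φ
    rw [← hL, ← InnerProductSpace.toDual_symm_apply, L2.inner_def, Lp.toTemperedDistribution_apply]
    refine integral_congr_ae ?_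
    filter_upwards [Lp.coeFn_star g₀, φ.coeFn_toLp 2 volume] with x h1 h2
    rw [h1, h2, Pi.star_apply, RCLike.inner_apply, smul_eq_mul]
    rfl
  · have hn : ‖star g₀‖ = ‖g₀‖ := by
      rw [Lp.norm_def, Lp.norm_def, eLpNorm_congr_ae (Lp.coeFn_star g₀), eLpNorm_star]
    rw [hn, LinearIsometryEquiv.norm_map]
    exact LinearMap.opNorm_extendOfNorm_le denseRange_schwartz_toLp hM' h'

theorem ofReal_norm_toLp_two (φ : 𝓢(EuclideanSpace ℝ (Fin d), ℂ)) :
    ENNReal.ofReal ‖φ.toLp 2‖ = l2n fun x => ‖φ x‖ₑ := by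
  rw [SchwartzMap.norm_toLp, ENNReal.ofReal_toReal (φ.eLpNorm_lt_top 2 volume).ne,
    eLpNorm_eq_lintegral_rpow_enorm_toReal (by norm_num) (by norm_num)]
  simp [l2n]

theorem l2n_bwn_fourier {V : Type*} [NormedAddCommGroup V] [InnerProductSpace ℝ V]
    [FiniteDimensional ℝ V] [MeasurableSpace V] [BorelSpace V] (s : ℝ) (f : 𝓢(V, ℂ)) :
    l2n (bwn s (𝓕 f)) = l2n (bwn s (𝓕⁻ f)) := by
  simpa [lowWeight] using l2n_lowWeight_fourier 0 s f

theorem l2n_fourierInv (φ : 𝓢(EuclideanSpace ℝ (Fin d), ℂ)) :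
    l2n (fun x => ‖𝓕⁻ φ x‖ₑ) = ENNReal.ofReal ‖φ.toLp 2‖ := by
  have h := SchwartzMap.norm_fourier_toL2_eq (𝓕⁻ φ)
  rw [FourierTransform.fourier_fourierInv_eq (F := 𝓢(EuclideanSpace ℝ (Fin d), ℂ))] at h
  rw [h, ofReal_norm_toLp_two]

theorem l2n_fourier (φ : 𝓢(EuclideanSpace ℝ (Fin d), ℂ)) :
    l2n (fun x => ‖𝓕 φ x‖ₑ) = ENNReal.ofReal ‖φ.toLp 2‖ := by
  rw [← SchwartzMap.norm_fourier_toL2_eq, ofReal_norm_toLp_two]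

/-- The operator `⟨x⟩^{-a} m(D) ⟨x⟩^{-a}` on tempered distributions. -/
def weightedMultiplier (d : ℕ) (a : ℝ) (m : EuclideanSpace ℝ (Fin d) → ℂ) :
    Distr d →L[ℂ] Distr d :=
  weight d (-a) ∘L fourierMultiplierCLM ℂ m ∘L weight d (-a)

/-- Transposing the operator onto the test function leaves a bilinear pairing; moving the remaining
Fourier transform onto the weighted f explains the presence of both 𝓕 and 𝓕⁻. -/
theorem weightedMultiplier_apply_apply (a : ℝ) {m : EuclideanSpace ℝ (Fin d) → ℂ}
    (hm : m.HasTemperateGrowth) (f φ : 𝓢(EuclideanSpace ℝ (Fin d), ℂ)) :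
    weightedMultiplier d a m (f : Distr d) φ = weightedPairing a m f φ := by
  have hw := hasTemperateGrowth_bw (V := EuclideanSpace ℝ (Fin d)) (-a)
  set W : 𝓢(EuclideanSpace ℝ (Fin d), ℂ) →L[ℂ] 𝓢(EuclideanSpace ℝ (Fin d), ℂ) :=
    SchwartzMap.smulLeftCLM ℂ (fun x => (bw (-a) x : ℂ)) with hW
  change (f : Distr d) (W (𝓕 (SchwartzMap.smulLeftCLM ℂ m (𝓕⁻ (W φ))))) = _
  rw [SchwartzMap.coe_apply]
  calc _ = ∫ x, 𝓕 (SchwartzMap.smulLeftCLM ℂ m (𝓕⁻ (W φ))) x * W f x := by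
        congr 1
        ext x
        rw [hW, SchwartzMap.smulLeftCLM_apply_apply hw, SchwartzMap.smulLeftCLM_apply_apply hw]
        simp only [smul_eq_mul]
        ring
    _ = _ := by
        rw [SchwartzMap.integral_fourier_mul_eq, weightedPairing]
        congr 1
        ext x
        rw [SchwartzMap.smulLeftCLM_apply_apply hm, smul_eq_mul]
        ring

/-- The inequality is closed in g, so g may be taken to be Schwartz. The pairing bound is then
applied to the Bessel potentials of g and φ, whose weighted norms are plain L² norms. -/
theorem enorm_besselPotential_weightedMultiplier_le {a s s' : ℝ}
    {m : EuclideanSpace ℝ (Fin d) → ℂ} (hm : m.HasTemperateGrowth) {M : ℝ}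
    (h : ∀ f h : 𝓢(EuclideanSpace ℝ (Fin d), ℂ), ‖weightedPairing a m f h‖ₑ ≤
      ENNReal.ofReal M * l2n (bwn s (𝓕⁻ f)) * l2n (bwn (-s') (𝓕⁻ h))) (hM : 0 ≤ M)
    (g : L2 d) (φ : 𝓢(EuclideanSpace ℝ (Fin d), ℂ)) :
    ‖besselPotential _ ℂ s' (weightedMultiplier d a m (besselPotential _ ℂ (-s) (g : Distr d))) φ‖ ≤
      M * ‖g‖ * ‖φ.toLp 2‖ := by
  have hw := fun r => hasTemperateGrowth_bw (V := EuclideanSpace ℝ (Fin d)) r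
  induction g using denseRange_schwartz_toLp.induction_on with
  | hp =>
    refine isClosed_le ?_ (by fun_prop)
    have h1 := (besselPotential (EuclideanSpace ℝ (Fin d)) ℂ s' ∘L weightedMultiplier d a m ∘L
      besselPotential _ ℂ (-s) ∘L Lp.toTemperedDistributionCLM ℂ volume 2).continuous
    have h2 := (PointwiseConvergenceCLM.evalCLM (RingHom.id ℂ) ℂ φ).continuous
    exact (h2.comp h1).norm
  | ih u =>
    rw [SchwartzMap.toLpCLM_apply, Lp.toTemperedDistribution_toLp_eq]
    have e1 : besselPotential _ ℂ (-s) (u : Distr d) =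
        (SchwartzMap.fourierMultiplierCLM ℂ
          (fun ξ : EuclideanSpace ℝ (Fin d) => (bw (-s) ξ : ℂ)) u : Distr d) :=
      fourierMultiplierCLM_toTemperedDistributionCLM_eq (hw (-s)) u
    have e2 : ∀ T : Distr d, besselPotential _ ℂ s' T φ = T (𝓕 (SchwartzMap.smulLeftCLM ℂ
        (fun ξ : EuclideanSpace ℝ (Fin d) => (bw s' ξ : ℂ)) (𝓕⁻ φ))) := fun T => rfl
    rw [e1, e2, weightedMultiplier_apply_apply a hm]
    have h3 := h (SchwartzMap.fourierMultiplierCLM ℂ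
      (fun ξ : EuclideanSpace ℝ (Fin d) => (bw (-s) ξ : ℂ)) u) (𝓕 (SchwartzMap.smulLeftCLM ℂ
        (fun ξ : EuclideanSpace ℝ (Fin d) => (bw s' ξ : ℂ)) (𝓕⁻ φ)))
    have e3 : ∀ (r : ℝ) (v : 𝓢(EuclideanSpace ℝ (Fin d), ℂ)), bwn (-r) (SchwartzMap.smulLeftCLM ℂ
        (fun ξ : EuclideanSpace ℝ (Fin d) => (bw r ξ : ℂ)) v) = fun ξ => ‖v ξ‖ₑ := fun r v => by
      ext ξ
      rw [bwn, SchwartzMap.smulLeftCLM_apply_apply (hw r), enorm_smul, ← mul_assoc,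
        ← ofReal_norm ((bw r ξ : ℝ) : ℂ), norm_real, Real.norm_of_nonneg (bw_pos _ _).le,
        ← ENNReal.ofReal_mul (bw_pos _ _).le, bw_neg_mul_bw, ENNReal.ofReal_one, one_mul]
    rw [← l2n_bwn_fourier, SchwartzMap.fourierMultiplierCLM_apply,
      FourierTransform.fourier_fourierInv_eq (F := 𝓢(EuclideanSpace ℝ (Fin d), ℂ)),
      FourierTransform.fourierInv_fourier_eq (F := 𝓢(EuclideanSpace ℝ (Fin d), ℂ)), e3] at h3
    have e4 := e3 (-s) (𝓕 u)
    rw [neg_neg] at e4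
    rw [e4, l2n_fourierInv, l2n_fourier, ← ENNReal.ofReal_mul hM,
      ← ENNReal.ofReal_mul (by positivity), ← ofReal_norm,
      ENNReal.ofReal_le_ofReal_iff (by positivity)] at h3
    exact h3

/-- A bound on the weighted pairing gives a bounded operator between Sobolev spaces. -/
theorem exists_sobolev_clm {a s s' : ℝ} {m : EuclideanSpace ℝ (Fin d) → ℂ}
    (hm : m.HasTemperateGrowth) {M : ℝ} (hM : 0 ≤ M)
    (h : ∀ f h : 𝓢(EuclideanSpace ℝ (Fin d), ℂ), ‖weightedPairing a m f h‖ₑ ≤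
      ENNReal.ofReal M * l2n (bwn s (𝓕⁻ f)) * l2n (bwn (-s') (𝓕⁻ h))) :
    ∃ T : Sobolev d s →L[ℂ] Sobolev d s',
      (∀ u, (T u).toDistr = weightedMultiplier d a m u.toDistr) ∧ ‖T‖ ≤ M := by
  have key : ∀ u : Sobolev d s, ∃ g : L2 d,
      besselPotential _ ℂ s' (weightedMultiplier d a m u.toDistr) = (g : Distr d) ∧
        ‖g‖ ≤ M * ‖u‖ := fun u => by
    have hb := enorm_besselPotential_weightedMultiplier_le hm h hM u.toL2
    rw [← u.besselPotential_toDistr] at hb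
    simp only [besselPotential_besselPotential_apply, add_neg_cancel, besselPotential_zero,
      ContinuousLinearMap.id_apply] at hb
    obtain ⟨g, hg, hg'⟩ := exists_toTemperedDistribution_eq _ hb
    exact ⟨g, hg.symm, hg' _ (by positivity) hb⟩
  have hmem : ∀ u : Sobolev d s, MemSobolev s' 2 (weightedMultiplier d a m u.toDistr) := fun u =>
    (key u).imp fun _ h => h.1
  let T₀ : Sobolev d s →ₗ[ℂ] Sobolev d s' :=
    { toFun := fun u => Sobolev.mk (weightedMultiplier d a m u.toDistr)
        (hmem u)
      map_add' := fun u v => Sobolev.toDistr_injective (by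
        rw [Sobolev.toDistr_mk, map_add Sobolev.toDistr u v, map_add Sobolev.toDistr,
          Sobolev.toDistr_mk, Sobolev.toDistr_mk, map_add])
      map_smul' := fun c u => Sobolev.toDistr_injective (by
        rw [Sobolev.toDistr_mk, map_smul Sobolev.toDistr c u, RingHom.id_apply,
          map_smul Sobolev.toDistr, Sobolev.toDistr_mk, map_smul]) }
  have hT₀ : ∀ u, (T₀ u).toDistr = weightedMultiplier d a m u.toDistr := fun u => rfl
  refine ⟨T₀.mkContinuous M fun u => ?_, hT₀, LinearMap.mkContinuous_norm_le _ hM _⟩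
  obtain ⟨g, hg, hgn⟩ := key u
  have : (T₀ u).toL2 = g := by
    apply Sobolev.toTemperedDistribution_injective
    have := (T₀ u).besselPotential_toDistr
    rw [hT₀, hg] at this
    exact this.symm
  rw [Sobolev.norm_eq, this]
  exact hgn

end Duality
end FreeWave

end

noncomputable section

namespace FreeWave

open Complex FourierTransform Filter Topology

/-! ### Temperate growth of the symbols and the algebra of Fourier multipliers. -/

section Multipliers

variable {V : Type*} [NormedAddCommGroup V] [InnerProductSpace ℝ V]

/-- The symbol `(2 π ‖ξ‖)²` of `-Δ`. -/
def symLaplace (ξ : V) : ℂ := ((2 * Real.pi * ‖ξ‖) ^ 2 : ℝ)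

theorem hasTemperateGrowth_symLaplace : (symLaplace : V → ℂ).HasTemperateGrowth := by
  have h : (symLaplace : V → ℂ) = fun ξ => (((2 * Real.pi) ^ 2 * ‖ξ‖ ^ 2 : ℝ) : ℂ) := by
    ext ξ
    rw [symLaplace, mul_pow]
  rw [h]
  fun_prop

theorem hasTemperateGrowth_inv_one_add_sq {F : Type*} [NormedAddCommGroup F]
    [InnerProductSpace ℝ F] {y : V → F} (hy : y.HasTemperateGrowth) :
    (fun ξ => (1 + ‖y ξ‖ ^ 2)⁻¹).HasTemperateGrowth := by
  have h := (Function.hasTemperateGrowth_one_add_norm_sq_rpow F (-1)).comp hy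
  refine (show (fun ξ => (1 + ‖y ξ‖ ^ 2)⁻¹) = _ from ?_) ▸ h
  ext ξ
  simp [Real.rpow_neg_one]

/-- Everything is reduced to 1/(1 + ‖y‖²) with y of temperate growth. If z² = p + iq is not real,
the denominator is rationalised and y = (ρ² - p)/q. If z² is real, z is purely imaginary and y is a
multiple of ξ. -/
theorem hasTemperateGrowth_symL {z : ℂ} (hz : z.im ≠ 0) :
    (symL z : V → ℂ).HasTemperateGrowth := by
  have hρ : (fun ξ : V => (2 * Real.pi * ‖ξ‖) ^ 2).HasTemperateGrowth := by
    have h : (fun ξ : V => (2 * Real.pi * ‖ξ‖) ^ 2) = fun ξ => (2 * Real.pi) ^ 2 * ‖ξ‖ ^ 2 := by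
      ext ξ
      rw [mul_pow]
    rw [h]
    fun_prop
  by_cases hq : (z ^ 2).im = 0
  · have hre : z.re = 0 := by
      rw [sq, mul_im] at hq
      have : z.im * z.re = 0 := by linarith
      exact (mul_eq_zero.1 this).resolve_left hz
    have hz2 : z ^ 2 = ((-z.im ^ 2 : ℝ) : ℂ) := by
      apply Complex.ext
      · rw [sq, mul_re, hre, ofReal_re]; ring
      · rw [hq, ofReal_im]
    have h1 := hasTemperateGrowth_inv_one_add_sq (V := V)
      (y := fun ξ => (2 * Real.pi / z.im) • ξ) (by fun_prop)
    have h : (symL z : V → ℂ) = fun ξ =>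
        (((z.im ^ 2)⁻¹ * (1 + ‖(2 * Real.pi / z.im) • ξ‖ ^ 2)⁻¹ : ℝ) : ℂ) := by
      ext ξ
      rw [symL, hz2, ← ofReal_sub, ← ofReal_inv, ← mul_inv, norm_smul, mul_pow (‖_‖),
        Real.norm_eq_abs, sq_abs]
      congr 2
      field_simp
      ring
    rw [h]
    fun_prop
  · set p := (z ^ 2).re with hp
    set q := (z ^ 2).im with hq'
    have h1 := hasTemperateGrowth_inv_one_add_sq (V := V)
      (y := fun ξ => q⁻¹ * ((2 * Real.pi * ‖ξ‖) ^ 2 - p)) (by fun_prop)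
    have h : (symL z : V → ℂ) = fun ξ =>
        (((q ^ 2)⁻¹ * (1 + ‖q⁻¹ * ((2 * Real.pi * ‖ξ‖) ^ 2 - p)‖ ^ 2)⁻¹ : ℝ) : ℂ) *
          ((((2 * Real.pi * ‖ξ‖) ^ 2 : ℝ) : ℂ) - (p - q * I)) := by
      ext ξ
      have hz2 : z ^ 2 = p + q * I := by rw [hp, hq', re_add_im]
      rw [symL, hz2]
      generalize (2 * Real.pi * ‖ξ‖) ^ 2 = r
      have hN : 0 < (r - p) ^ 2 + q ^ 2 := by positivity
      have e : (q ^ 2)⁻¹ * (1 + ‖q⁻¹ * (r - p)‖ ^ 2)⁻¹ = ((r - p) ^ 2 + q ^ 2)⁻¹ := by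
        rw [← mul_inv, Real.norm_eq_abs, sq_abs]
        congr 1
        field_simp
        ring
      rw [e]
      symm
      apply eq_inv_of_mul_eq_one_left
      have e2 : ((r : ℂ) - (p - q * I)) * (r - (p + q * I)) = (((r - p) ^ 2 + q ^ 2 : ℝ) : ℂ) := by
        push_cast
        linear_combination (-(q : ℂ) ^ 2) * I_sq
      rw [mul_assoc, e2, ← ofReal_mul, inv_mul_cancel₀ hN.ne', ofReal_one]
    rw [h]
    fun_prop

theorem hasTemperateGrowth_symC_symS {z : ℂ} (hz : z.im ≠ 0) (k : ℕ) :
    (symC z k : V → ℂ).HasTemperateGrowth ∧ (symS z k : V → ℂ).HasTemperateGrowth := by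
  have hL := hasTemperateGrowth_symL (V := V) hz
  have hρ := hasTemperateGrowth_symLaplace (V := V)
  induction k with
  | zero => exact ⟨.const 1, .const 0⟩
  | succ k ih =>
    obtain ⟨h1, h2⟩ := ih
    refine ⟨?_, ?_⟩
    · rw [show (symC z (k + 1) : V → ℂ) = fun ξ => symL z ξ * (z * symC z k ξ +
        symLaplace ξ * symS z k ξ) from funext (symC_succ z k)]
      fun_prop
    · rw [show (symS z (k + 1) : V → ℂ) = _ from funext (symS_succ z k)]
      fun_prop

variable [FiniteDimensional ℝ V] [MeasurableSpace V] [BorelSpace V]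

theorem fourierMultiplierCLM_add {g₁ g₂ : V → ℂ} (h₁ : g₁.HasTemperateGrowth)
    (h₂ : g₂.HasTemperateGrowth) : fourierMultiplierCLM ℂ (fun ξ => g₁ ξ + g₂ ξ) =
      fourierMultiplierCLM ℂ g₁ + fourierMultiplierCLM ℂ g₂ := by
  ext1 f
  have := smulLeftCLM_add (F := ℂ) h₁ h₂
  rw [add_apply, fourierMultiplierCLM_apply, fourierMultiplierCLM_apply,
    fourierMultiplierCLM_apply, ← FourierTransform.fourierInv_add, ← add_apply,
    ← this]
  rfl

theorem fourierMultiplierCLM_const_mul {g : V → ℂ} (h : g.HasTemperateGrowth) (c : ℂ) :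
    fourierMultiplierCLM ℂ (fun ξ => c * g ξ) = c • fourierMultiplierCLM ℂ g :=
  fourierMultiplierCLM_smul h c

theorem fourierMultiplierCLM_comp {g₁ g₂ : V → ℂ} (h₁ : g₁.HasTemperateGrowth)
    (h₂ : g₂.HasTemperateGrowth) (f : 𝓢'(V, ℂ)) :
    fourierMultiplierCLM ℂ g₁ (fourierMultiplierCLM ℂ g₂ f) =
      fourierMultiplierCLM ℂ (fun ξ => g₁ ξ * g₂ ξ) f := by
  rw [fourierMultiplierCLM_fourierMultiplierCLM_apply h₂ h₁, mul_comm]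
  rfl

theorem laplacian_eq_neg_fourierMultiplierCLM (f : 𝓢'(V, ℂ)) :
    Δ f = -fourierMultiplierCLM ℂ symLaplace f := by
  have h : (symLaplace : V → ℂ) = fun ξ => (((2 * Real.pi) ^ 2 : ℝ) : ℂ) * ((‖ξ‖ ^ 2 : ℝ) : ℂ) := by
    ext ξ
    rw [symLaplace, mul_pow, ofReal_mul]
  have hn : (fun ξ : V => ((‖ξ‖ ^ 2 : ℝ) : ℂ)).HasTemperateGrowth := by
    fun_prop
  rw [laplacian_eq_fourierMultiplierCLM, h, fourierMultiplierCLM_const_mul hn,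
    smul_apply, neg_smul, Complex.coe_smul]

end Multipliers

end FreeWave

end

noncomputable section

namespace FreeWave

open Complex FourierTransform Filter Topology

/-! ### The resolvent as a matrix of Fourier multipliers. -/

section Resolvent

variable {d : ℕ}

/-- The operator on pairs with matrix of Fourier multipliers `(A, B; C, D)`. -/
def pairMultiplier (A B C D : EuclideanSpace ℝ (Fin d) → ℂ) :
    (Distr d × Distr d) →L[ℂ] (Distr d × Distr d) :=
  (fourierMultiplierCLM ℂ A ∘L ContinuousLinearMap.fst ℂ (Distr d) (Distr d) +
    fourierMultiplierCLM ℂ B ∘L ContinuousLinearMap.snd ℂ (Distr d) (Distr d)).prod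
  (fourierMultiplierCLM ℂ C ∘L ContinuousLinearMap.fst ℂ (Distr d) (Distr d) +
    fourierMultiplierCLM ℂ D ∘L ContinuousLinearMap.snd ℂ (Distr d) (Distr d))

theorem pairMultiplier_apply (A B C D : EuclideanSpace ℝ (Fin d) → ℂ) (u : Distr d × Distr d) :
    pairMultiplier A B C D u =
      (fourierMultiplierCLM ℂ A u.1 + fourierMultiplierCLM ℂ B u.2,
        fourierMultiplierCLM ℂ C u.1 + fourierMultiplierCLM ℂ D u.2) := rfl

theorem fourierMultiplierCLM_comp_add_comp {A B A' B' C' D' : EuclideanSpace ℝ (Fin d) → ℂ}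
    (hA : A.HasTemperateGrowth) (hB : B.HasTemperateGrowth)
    (hA' : A'.HasTemperateGrowth) (hB' : B'.HasTemperateGrowth) (hC' : C'.HasTemperateGrowth)
    (hD' : D'.HasTemperateGrowth) (u v : Distr d) :
    fourierMultiplierCLM ℂ A (fourierMultiplierCLM ℂ A' u + fourierMultiplierCLM ℂ B' v) +
      fourierMultiplierCLM ℂ B (fourierMultiplierCLM ℂ C' u + fourierMultiplierCLM ℂ D' v) =
    fourierMultiplierCLM ℂ (fun ξ => A ξ * A' ξ + B ξ * C' ξ) u +
      fourierMultiplierCLM ℂ (fun ξ => A ξ * B' ξ + B ξ * D' ξ) v := by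
  rw [map_add, map_add, fourierMultiplierCLM_comp hA hA', fourierMultiplierCLM_comp hA hB',
    fourierMultiplierCLM_comp hB hC', fourierMultiplierCLM_comp hB hD',
    fourierMultiplierCLM_add (g₁ := fun ξ => A ξ * A' ξ) (g₂ := fun ξ => B ξ * C' ξ)
      (hA.mul hA') (hB.mul hC'),
    fourierMultiplierCLM_add (g₁ := fun ξ => A ξ * B' ξ) (g₂ := fun ξ => B ξ * D' ξ)
      (hA.mul hB') (hB.mul hD'),
    add_apply, add_apply]
  abel

theorem pairMultiplier_mul {A B C D A' B' C' D' : EuclideanSpace ℝ (Fin d) → ℂ}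
    (hA : A.HasTemperateGrowth) (hB : B.HasTemperateGrowth) (hC : C.HasTemperateGrowth)
    (hD : D.HasTemperateGrowth) (hA' : A'.HasTemperateGrowth) (hB' : B'.HasTemperateGrowth)
    (hC' : C'.HasTemperateGrowth) (hD' : D'.HasTemperateGrowth) :
    pairMultiplier A B C D * pairMultiplier A' B' C' D' =
      pairMultiplier (fun ξ => A ξ * A' ξ + B ξ * C' ξ) (fun ξ => A ξ * B' ξ + B ξ * D' ξ)
        (fun ξ => C ξ * A' ξ + D ξ * C' ξ) (fun ξ => C ξ * B' ξ + D ξ * D' ξ) := by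
  refine ContinuousLinearMap.ext fun u => Prod.ext ?_ ?_
  · exact fourierMultiplierCLM_comp_add_comp hA hB hA' hB' hC' hD' _ _
  · exact fourierMultiplierCLM_comp_add_comp hC hD hA' hB' hC' hD' _ _

theorem pairMultiplier_one :
    pairMultiplier (d := d) (fun _ => 1) (fun _ => 0) (fun _ => 0) (fun _ => 1) = 1 := by
  refine ContinuousLinearMap.ext fun u => ?_
  rw [pairMultiplier_apply]
  simp

theorem freeGeneratorSub_apply (z : ℂ) (u : Distr d × Distr d) :
    freeGeneratorSub d z u = (I • u.2 - z • u.1, I • Δ u.1 - z • u.2) := by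
  refine Prod.ext ?_ ?_ <;> simp [freeGeneratorSub, freeGenerator]

theorem freeGeneratorSub_eq (z : ℂ) : freeGeneratorSub d z =
    pairMultiplier (fun _ => -z) (fun _ => I) (fun ξ => -I * symLaplace ξ) (fun _ => -z) := by
  refine ContinuousLinearMap.ext fun u => ?_
  rw [freeGeneratorSub_apply, pairMultiplier_apply, laplacian_eq_neg_fourierMultiplierCLM,
    fourierMultiplierCLM_const_mul hasTemperateGrowth_symLaplace]
  simp only [fourierMultiplierCLM_const, smul_apply, neg_apply, ContinuousLinearMap.id_apply,
    neg_smul, smul_neg]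
  refine Prod.ext ?_ ?_ <;> simp only <;> abel

/-- The matrix of Fourier multipliers of `(G₀ - z)^{-k}`. -/
def resolventPow (d : ℕ) (z : ℂ) (k : ℕ) : (Distr d × Distr d) →L[ℂ] (Distr d × Distr d) :=
  pairMultiplier (symC z k) (fun ξ => I * symS z k ξ) (fun ξ => -I * (symLaplace ξ * symS z k ξ))
    (symC z k)

theorem resolventPow_zero (z : ℂ) : resolventPow d z 0 = 1 := by
  rw [← pairMultiplier_one, resolventPow]
  congr 1 <;> ext ξ <;> simp

theorem symL_mul_cancel {z : ℂ} (hz : z.im ≠ 0) (ξ : EuclideanSpace ℝ (Fin d)) :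
    symL z ξ * (symLaplace ξ - z ^ 2) = 1 :=
  inv_mul_cancel₀ (sq_sub_sq_ne_zero hz _)

/-- Entrywise this is (G₀ - z)(c + s G₀) with G₀² = ρ²: the even part is ρ² s - z c, the odd part c
- z s. Both orders of composition are needed for invertibility. -/
theorem resolventPow_succ {z : ℂ} (hz : z.im ≠ 0) (k : ℕ) :
    freeGeneratorSub d z * resolventPow d z (k + 1) = resolventPow d z k ∧
      resolventPow d z (k + 1) * freeGeneratorSub d z = resolventPow d z k := by
  obtain ⟨hc, hs⟩ := hasTemperateGrowth_symC_symS (V := EuclideanSpace ℝ (Fin d)) hz (k + 1)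
  have hρ := hasTemperateGrowth_symLaplace (V := EuclideanSpace ℝ (Fin d))
  have e1 : ∀ ξ : EuclideanSpace ℝ (Fin d),
      symLaplace ξ * symS z (k + 1) ξ - z * symC z (k + 1) ξ = symC z k ξ := fun ξ => by
    have h := sq_mul_symS_succ hz k ξ
    rw [symLaplace, h]
    ring
  have e2 : ∀ ξ : EuclideanSpace ℝ (Fin d),
      symC z (k + 1) ξ - z * symS z (k + 1) ξ = symS z k ξ := fun ξ => by
    have h := symL_mul_cancel hz ξ
    rw [symC_succ, symS_succ]
    change symL z ξ * (z * symC z k ξ + symLaplace ξ * symS z k ξ) - _ = _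
    linear_combination symS z k ξ * h
  rw [freeGeneratorSub_eq, resolventPow, pairMultiplier_mul, pairMultiplier_mul, resolventPow]
  · constructor
    all_goals
      congr 1
      all_goals
        ext ξ
        first
        | linear_combination e1 ξ - symLaplace ξ * symS z (k + 1) ξ * I_sq
        | linear_combination I * e2 ξ
        | linear_combination (-I * symLaplace ξ) * e2 ξ
  all_goals fun_prop

theorem freeGeneratorSub_mul_resolventPow_one {z : ℂ} (hz : z.im ≠ 0) :
    freeGeneratorSub d z * resolventPow d z 1 = 1 ∧
      resolventPow d z 1 * freeGeneratorSub d z = 1 := by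
  simpa only [resolventPow_zero, zero_add] using resolventPow_succ (d := d) hz 0

theorem isUnit_freeGeneratorSub {z : ℂ} (hz : z.im ≠ 0) : IsUnit (freeGeneratorSub d z) :=
  ⟨⟨_, _, (freeGeneratorSub_mul_resolventPow_one hz).1,
    (freeGeneratorSub_mul_resolventPow_one hz).2⟩, rfl⟩

theorem freeResolvent_eq {z : ℂ} (hz : z.im ≠ 0) : freeResolvent d z = resolventPow d z 1 :=
  Ring.inverse_unit ⟨_, _, (freeGeneratorSub_mul_resolventPow_one hz).1,
    (freeGeneratorSub_mul_resolventPow_one hz).2⟩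

theorem freeResolvent_pow {z : ℂ} (hz : z.im ≠ 0) (k : ℕ) :
    freeResolvent d z ^ k = resolventPow d z k := by
  rw [freeResolvent_eq hz]
  induction k with
  | zero => rw [pow_zero, resolventPow_zero]
  | succ k ih =>
    rw [pow_succ', ih, ← (resolventPow_succ hz k).1, ← mul_assoc,
      (freeGeneratorSub_mul_resolventPow_one hz).2, one_mul]

theorem mem_range_toPair {s : ℝ} (u : Distr d × Distr d) :
    u ∈ Set.range (toPair : EnergySpace d s → _) ↔
      MemSobolev (s + 1) 2 u.1 ∧ MemSobolev s 2 u.2 := by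
  constructor
  · rintro ⟨f, rfl⟩
    exact ⟨f.fst.memSobolev, f.snd.memSobolev⟩
  · rintro ⟨h1, h2⟩
    exact ⟨WithLp.toLp 2 (Sobolev.mk u.1 h1, Sobolev.mk u.2 h2), rfl⟩

/-- ⟨ξ⟩² times the symbol is bounded, since ρ² L = 1 + z² L and L itself is bounded off the real
axis. -/
theorem memSobolev_symL {z : ℂ} (hz : z.im ≠ 0) {s : ℝ} {u : Distr d} (hu : MemSobolev s 2 u) :
    MemSobolev (s + 2) 2 (fourierMultiplierCLM ℂ (symL z) u) := by
  have hL := hasTemperateGrowth_symL (V := EuclideanSpace ℝ (Fin d)) hz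
  have hb := hasTemperateGrowth_bw (V := EuclideanSpace ℝ (Fin d)) 2
  rw [add_comm, ← memSobolev_besselPotential_iff]
  change MemSobolev s 2 (fourierMultiplierCLM ℂ
    (fun ξ : EuclideanSpace ℝ (Fin d) => (bw 2 ξ : ℂ)) _)
  rw [fourierMultiplierCLM_comp hb hL]
  refine hu.fourierMultiplierCLM_of_bounded (hb.mul hL)
    ⟨(1 + ‖z‖ ^ 2) * (|z.im| ^ 2)⁻¹ + 1, fun ξ => ?_⟩
  have h1 := norm_symL_le hz ξ
  have h2 := symL_mul_cancel hz ξ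
  have h3 : symL z ξ * symLaplace ξ = 1 + z ^ 2 * symL z ξ := by linear_combination h2
  have h4 : bw 2 ξ ≤ 1 + ‖symLaplace ξ‖ := by
    rw [bw, div_self two_ne_zero, Real.rpow_one, symLaplace, norm_real,
      Real.norm_of_nonneg (by positivity)]
    have : ‖ξ‖ ≤ 2 * Real.pi * ‖ξ‖ :=
      le_mul_of_one_le_left (norm_nonneg _) (by linarith [Real.pi_gt_three])
    gcongr
  calc ‖(bw 2 ξ : ℂ) * symL z ξ‖ = bw 2 ξ * ‖symL z ξ‖ := by
        rw [norm_mul, norm_real, Real.norm_of_nonneg (bw_pos _ _).le]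
    _ ≤ (1 + ‖symLaplace ξ‖) * ‖symL z ξ‖ := by gcongr
    _ = ‖symL z ξ‖ + ‖symL z ξ * symLaplace ξ‖ := by rw [norm_mul]; ring
    _ ≤ ‖symL z ξ‖ + (1 + ‖z‖ ^ 2 * ‖symL z ξ‖) := by
        rw [h3]
        gcongr
        refine (norm_add_le _ _).trans_eq ?_
        rw [norm_one, norm_mul, norm_pow]
    _ = (1 + ‖z‖ ^ 2) * ‖symL z ξ‖ + 1 := by ring
    _ ≤ _ := by gcongr

/-- Injectivity comes from the inverse on distributions. For surjectivity the explicit inverse is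
seen to gain one derivative, as two are gained by the symbol and at most one is lost between the
components. -/
theorem bijOn_freeGeneratorSub {z : ℂ} (hz : z.im ≠ 0) (s : ℝ) :
    Set.BijOn (freeGeneratorSub d z) (Set.range (toPair : EnergySpace d (s + 1) → _))
      (Set.range (toPair : EnergySpace d s → _)) := by
  obtain ⟨h1, h2⟩ := freeGeneratorSub_mul_resolventPow_one (d := d) hz
  have h1' : ∀ u, freeGeneratorSub d z (resolventPow d z 1 u) = u := fun u =>
    congrArg (fun T : (Distr d × Distr d) →L[ℂ] (Distr d × Distr d) => T u) h1
  have h2' : ∀ u, resolventPow d z 1 (freeGeneratorSub d z u) = u := fun u =>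
    congrArg (fun T : (Distr d × Distr d) →L[ℂ] (Distr d × Distr d) => T u) h2
  have hL := hasTemperateGrowth_symL (V := EuclideanSpace ℝ (Fin d)) hz
  have hρ := hasTemperateGrowth_symLaplace (V := EuclideanSpace ℝ (Fin d))
  refine ⟨fun u hu => ?_, (Function.LeftInverse.injective h2').injOn, fun u hu => ?_⟩
  · rw [mem_range_toPair] at hu ⊢
    rw [freeGeneratorSub_apply]
    have h3 := hu.1.laplacian
    rw [show s + 1 + 1 - 2 = s by ring] at h3
    exact ⟨(hu.2.smul I).sub ((hu.1.mono (by linarith)).smul z),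
      (h3.smul I).sub ((hu.2.mono (by linarith)).smul z)⟩
  · refine ⟨resolventPow d z 1 u, ?_, h1' u⟩
    rw [mem_range_toPair] at hu ⊢
    have hC : (symC z 1 : EuclideanSpace ℝ (Fin d) → ℂ) = fun ξ => z * symL z ξ := by
      ext ξ
      rw [symC_succ, symC_zero, symS_zero]
      ring
    have hS : (symS z 1 : EuclideanSpace ℝ (Fin d) → ℂ) = symL z := by
      ext ξ
      rw [symS_succ, symC_zero, symS_zero]
      ring
    have hl1 := memSobolev_symL hz hu.1
    have hl2 := memSobolev_symL hz hu.2
    have h3 := hl1.laplacian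
    rw [laplacian_eq_neg_fourierMultiplierCLM, fourierMultiplierCLM_comp hρ hL] at h3
    have h : resolventPow d z 1 u =
        (z • fourierMultiplierCLM ℂ (symL z) u.1 + I • fourierMultiplierCLM ℂ (symL z) u.2,
          I • -fourierMultiplierCLM ℂ (fun ξ => symLaplace ξ * symL z ξ) u.1 +
            z • fourierMultiplierCLM ℂ (symL z) u.2) := by
      rw [resolventPow, pairMultiplier_apply, hC, hS, fourierMultiplierCLM_const_mul hL,
        fourierMultiplierCLM_const_mul hL, fourierMultiplierCLM_const_mul
          (g := fun ξ => symLaplace ξ * symL z ξ) (hρ.mul hL)]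
      simp only [smul_apply, neg_apply, neg_smul, smul_neg]
    rw [h]
    exact ⟨((hl1.mono (by linarith)).smul z).add ((hl2.mono (by linarith)).smul I),
      ((h3.mono (by linarith)).smul I).add ((hl2.mono (by linarith)).smul z)⟩

end Resolvent

/-! ### Assembling the entries on the energy spaces. -/

section Bounds

variable {d : ℕ}

theorem l2n_bwn_mono {s s' : ℝ} (h : s ≤ s') (φ : 𝓢(EuclideanSpace ℝ (Fin d), ℂ)) :
    l2n (bwn s φ) ≤ l2n (bwn s' φ) := by
  refine l2n_mono fun ξ => ?_
  unfold bwn bw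
  gcongr
  nlinarith [sq_nonneg ‖ξ‖]

/-- The slack σ' ≤ σ + k lets the same estimate serve terms whose order is better than required. -/
theorem exists_clm_symC (hd : 3 ≤ d) (hodd : Odd d) (k : ℕ) {a : ℝ} (ha : k < a) (C : ℝ)
    {σ σ' : ℝ} (hσ : σ' ≤ σ + k) :
    ∃ M : ℝ, ∀ z : ℂ, z.im ≠ 0 → ‖z‖ ≤ C → ∃ T : Sobolev d σ →L[ℂ] Sobolev d σ',
      (∀ u, (T u).toDistr = weightedMultiplier d a (symC z k) u.toDistr) ∧ ‖T‖ ≤ M := by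
  obtain ⟨m, rfl⟩ := hodd
  obtain ⟨A, hA, h⟩ := exists_enorm_weightedPairing_symC_le (m := m)
    (V := EuclideanSpace ℝ (Fin (2 * m + 1))) (by omega) (by simp) k ha C σ
  refine ⟨A.toReal, fun z hz hzC => exists_sobolev_clm (hasTemperateGrowth_symC_symS hz k).1
    ENNReal.toReal_nonneg fun f g => ?_⟩
  rw [ENNReal.ofReal_toReal hA]
  refine (h z hz hzC f g).trans ?_
  gcongr
  exact l2n_bwn_mono (by linarith) _

theorem exists_clm_symS (hd : 3 ≤ d) (hodd : Odd d) (k : ℕ) {a : ℝ} (ha : k < a) (C : ℝ)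
    {σ σ' : ℝ} (hσ : σ' ≤ σ + (k + 1)) :
    ∃ M : ℝ, ∀ z : ℂ, z.im ≠ 0 → ‖z‖ ≤ C → ∃ T : Sobolev d σ →L[ℂ] Sobolev d σ',
      (∀ u, (T u).toDistr = weightedMultiplier d a (symS z k) u.toDistr) ∧ ‖T‖ ≤ M := by
  obtain ⟨m, rfl⟩ := hodd
  obtain ⟨A, hA, h⟩ := exists_enorm_weightedPairing_symS_le (m := m)
    (V := EuclideanSpace ℝ (Fin (2 * m + 1))) (by omega) (by simp) k ha C σ
  refine ⟨A.toReal, fun z hz hzC => exists_sobolev_clm (hasTemperateGrowth_symC_symS hz k).2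
    ENNReal.toReal_nonneg fun f g => ?_⟩
  rw [ENNReal.ofReal_toReal hA]
  refine (h z hz hzC f g).trans ?_
  gcongr
  exact l2n_bwn_mono (by linarith) _

theorem weightedMultiplier_add {a : ℝ} {g₁ g₂ : EuclideanSpace ℝ (Fin d) → ℂ}
    (h₁ : g₁.HasTemperateGrowth) (h₂ : g₂.HasTemperateGrowth) (u : Distr d) :
    weightedMultiplier d a (fun ξ => g₁ ξ + g₂ ξ) u =
      weightedMultiplier d a g₁ u + weightedMultiplier d a g₂ u := by
  simp only [weightedMultiplier, ContinuousLinearMap.comp_apply, fourierMultiplierCLM_add h₁ h₂,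
    add_apply, map_add]

theorem weightedMultiplier_const_mul {a : ℝ} {g : EuclideanSpace ℝ (Fin d) → ℂ}
    (h : g.HasTemperateGrowth) (c : ℂ) (u : Distr d) :
    weightedMultiplier d a (fun ξ => c * g ξ) u = c • weightedMultiplier d a g u := by
  simp only [weightedMultiplier, ContinuousLinearMap.comp_apply,
    fourierMultiplierCLM_const_mul h, smul_apply, map_smul]

/-- By `sq_mul_symS_succ` the symbol is a combination of two even parts, at levels k - 1 and k, with
coefficients 1 and z. The weaker of the two orders is k - 1. -/
theorem exists_clm_symLaplace_mul_symS (hd : 3 ≤ d) (hodd : Odd d) (k : ℕ) {a : ℝ} (ha : k < a)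
    {C : ℝ} {σ σ' : ℝ} (hσ : σ' ≤ σ + (k - 1)) :
    ∃ M : ℝ, ∀ z : ℂ, z.im ≠ 0 → ‖z‖ ≤ C → ∃ T : Sobolev d σ →L[ℂ] Sobolev d σ',
      (∀ u, (T u).toDistr =
        weightedMultiplier d a (fun ξ => symLaplace ξ * symS z k ξ) u.toDistr) ∧ ‖T‖ ≤ M := by
  cases k with
  | zero =>
    refine ⟨0, fun z hz hzC => ⟨0, fun u => ?_, by simp⟩⟩
    have : (fun ξ : EuclideanSpace ℝ (Fin d) => symLaplace ξ * symS z 0 ξ) =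
        fun ξ => (0 : ℂ) * symLaplace ξ := by
      ext ξ
      simp
    rw [this, weightedMultiplier_const_mul hasTemperateGrowth_symLaplace]
    exact (map_zero Sobolev.toDistr).trans (zero_smul ℂ _).symm
  | succ n =>
    push_cast at hσ ha
    obtain ⟨M₁, h₁⟩ := exists_clm_symC hd hodd n (a := a) (by linarith) C (σ := σ) (σ' := σ')
      (by linarith)
    obtain ⟨M₂, h₂⟩ := exists_clm_symC hd hodd (n + 1) (a := a) (by push_cast; linarith) C
      (σ := σ) (σ' := σ') (by push_cast; linarith)
    refine ⟨M₁ + C * M₂, fun z hz hzC => ?_⟩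
    obtain ⟨T₁, hT₁, hM₁⟩ := h₁ z hz hzC
    obtain ⟨T₂, hT₂, hM₂⟩ := h₂ z hz hzC
    have hc := fun j => (hasTemperateGrowth_symC_symS (V := EuclideanSpace ℝ (Fin d)) hz j).1
    have hzc : (fun ξ : EuclideanSpace ℝ (Fin d) => z * symC z (n + 1) ξ).HasTemperateGrowth := by
      have := hc (n + 1)
      fun_prop
    refine ⟨T₁ + z • T₂, fun u => ?_, ?_⟩
    · have e : (fun ξ : EuclideanSpace ℝ (Fin d) => symLaplace ξ * symS z (n + 1) ξ) =
          fun ξ => symC z n ξ + z * symC z (n + 1) ξ := funext fun ξ => sq_mul_symS_succ hz n ξ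
      rw [e, weightedMultiplier_add (hc n) hzc, weightedMultiplier_const_mul (hc (n + 1)),
        ← hT₁, ← hT₂, add_apply, smul_apply, map_add, map_smul]
    · refine (norm_add_le _ _).trans (add_le_add hM₁ ?_)
      rw [norm_smul]
      exact mul_le_mul hzC hM₂ (norm_nonneg _) ((norm_nonneg _).trans hzC)

theorem exists_energySpace_clm {s s' M₁ M₂ M₃ M₄ : ℝ}
    (T₁ : Sobolev d (s + 1) →L[ℂ] Sobolev d (s' + 1)) (T₂ : Sobolev d s →L[ℂ] Sobolev d (s' + 1))
    (T₃ : Sobolev d (s + 1) →L[ℂ] Sobolev d s') (T₄ : Sobolev d s →L[ℂ] Sobolev d s')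
    (h₁ : ‖T₁‖ ≤ M₁) (h₂ : ‖T₂‖ ≤ M₂) (h₃ : ‖T₃‖ ≤ M₃) (h₄ : ‖T₄‖ ≤ M₄) :
    ∃ T : EnergySpace d s →L[ℂ] EnergySpace d s',
      (∀ f, T f = WithLp.toLp 2 (T₁ f.fst + T₂ f.snd, T₃ f.fst + T₄ f.snd)) ∧
        ‖T‖ ≤ (M₁ + M₂) + (M₃ + M₄) := by
  have hf : ∀ f : EnergySpace d s, ‖f.fst‖ ≤ ‖f‖ ∧ ‖f.snd‖ ≤ ‖f‖ := fun f => by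
    rw [WithLp.prod_norm_eq_of_L2]
    constructor <;> apply Real.le_sqrt_of_sq_le <;> nlinarith [sq_nonneg ‖f.fst‖, sq_nonneg ‖f.snd‖]
  have hto : ∀ (x : Sobolev d (s' + 1)) (y : Sobolev d s'),
      ‖(WithLp.toLp 2 (x, y) : EnergySpace d s')‖ ≤ ‖x‖ + ‖y‖ := fun x y => by
    rw [WithLp.prod_norm_eq_of_L2]
    refine Real.sqrt_le_iff.2 ⟨by positivity, ?_⟩
    change ‖x‖ ^ 2 + ‖y‖ ^ 2 ≤ _
    nlinarith [norm_nonneg x, norm_nonneg y]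
  refine ⟨(WithLp.prodContinuousLinearEquiv 2 ℂ (Sobolev d (s' + 1))
      (Sobolev d s')).symm.toContinuousLinearMap ∘L
    ((T₁.coprod T₂).prod (T₃.coprod T₄)) ∘L
      (WithLp.prodContinuousLinearEquiv 2 ℂ (Sobolev d (s + 1)) (Sobolev d s)).toContinuousLinearMap,
    fun f => rfl, ?_⟩
  have h0 := (norm_nonneg _).trans h₁
  have h0' := (norm_nonneg _).trans h₂
  have h0'' := (norm_nonneg _).trans h₃
  have h0''' := (norm_nonneg _).trans h₄
  refine ContinuousLinearMap.opNorm_le_bound _ (by positivity) fun f => ?_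
  obtain ⟨hf1, hf2⟩ := hf f
  calc _ ≤ ‖T₁ f.fst + T₂ f.snd‖ + ‖T₃ f.fst + T₄ f.snd‖ := hto _ _
    _ ≤ (‖T₁ f.fst‖ + ‖T₂ f.snd‖) + (‖T₃ f.fst‖ + ‖T₄ f.snd‖) :=
        add_le_add (norm_add_le _ _) (norm_add_le _ _)
    _ ≤ (M₁ * ‖f‖ + M₂ * ‖f‖) + (M₃ * ‖f‖ + M₄ * ‖f‖) := by
        gcongr
        · exact T₁.le_of_opNorm_le_of_le h₁ hf1
        · exact T₂.le_of_opNorm_le_of_le h₂ hf2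
        · exact T₃.le_of_opNorm_le_of_le h₃ hf1
        · exact T₄.le_of_opNorm_le_of_le h₄ hf2
    _ = _ := by ring

theorem weightPair_resolventPow {z : ℂ} (hz : z.im ≠ 0) (k : ℕ) (a : ℝ) (u : Distr d × Distr d) :
    weightPair d (-a) (resolventPow d z k (weightPair d (-a) u)) =
      (weightedMultiplier d a (symC z k) u.1 + I • weightedMultiplier d a (symS z k) u.2,
        (-I) • weightedMultiplier d a (fun ξ => symLaplace ξ * symS z k ξ) u.1 +
          weightedMultiplier d a (symC z k) u.2) := by
  obtain ⟨hc, hs⟩ := hasTemperateGrowth_symC_symS (V := EuclideanSpace ℝ (Fin d)) hz k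
  have hρ := hasTemperateGrowth_symLaplace (V := EuclideanSpace ℝ (Fin d))
  rw [← weightedMultiplier_const_mul hs, ← weightedMultiplier_const_mul
    (g := fun ξ => symLaplace ξ * symS z k ξ) (hρ.mul hs)]
  exact Prod.ext (map_add (weight d (-a)) _ _) (map_add (weight d (-a)) _ _)

/-- The component spaces differ by one derivative, so the four entries need orders k, k + 1, k - 1
and k; these are exactly the gains of c, s, ρ² s and c. -/
theorem exists_weighted_resolvent_bound (hd : 3 ≤ d) (hodd : Odd d) (k : ℕ) (s C : ℝ) {a : ℝ}
    (ha : k < a) :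
    ∃ M : ℝ, ∀ z : ℂ, z.im ≠ 0 → ‖z‖ ≤ C → ∃ T : EnergySpace d s →L[ℂ] EnergySpace d (s + k),
      (∀ f, toPair (T f) =
        weightPair d (-a) ((freeResolvent d z ^ k) (weightPair d (-a) (toPair f)))) ∧ ‖T‖ ≤ M := by
  obtain ⟨M₁, h₁⟩ := exists_clm_symC hd hodd k ha C (σ := s + 1) (σ' := s + k + 1) (by linarith)
  obtain ⟨M₂, h₂⟩ := exists_clm_symS hd hodd k ha C (σ := s) (σ' := s + k + 1) (by linarith)
  obtain ⟨M₃, h₃⟩ := exists_clm_symLaplace_mul_symS hd hodd k ha (C := C) (σ := s + 1)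
    (σ' := s + k) (by linarith)
  obtain ⟨M₄, h₄⟩ := exists_clm_symC hd hodd k ha C (σ := s) (σ' := s + k) le_rfl
  refine ⟨(M₁ + M₂) + (M₃ + M₄), fun z hz hzC => ?_⟩
  obtain ⟨T₁, hT₁, hM₁⟩ := h₁ z hz hzC
  obtain ⟨T₂, hT₂, hM₂⟩ := h₂ z hz hzC
  obtain ⟨T₃, hT₃, hM₃⟩ := h₃ z hz hzC
  obtain ⟨T₄, hT₄, hM₄⟩ := h₄ z hz hzC
  have hM₂' : ‖I • T₂‖ ≤ M₂ := by rwa [norm_smul, norm_I, one_mul]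
  have hM₃' : ‖(-I) • T₃‖ ≤ M₃ := by rwa [norm_smul, norm_neg, norm_I, one_mul]
  obtain ⟨T, hT, hM⟩ := exists_energySpace_clm T₁ (I • T₂) ((-I) • T₃) T₄ hM₁ hM₂' hM₃' hM₄
  refine ⟨T, fun f => ?_, hM⟩
  rw [freeResolvent_pow hz, weightPair_resolventPow hz, hT]
  refine Prod.ext ?_ ?_
  · change (T₁ f.fst + (I • T₂) f.snd).toDistr = _
    rw [map_add, smul_apply, map_smul, hT₁, hT₂]
    rfl
  · change (((-I) • T₃) f.fst + T₄ f.snd).toDistr = _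
    rw [map_add, smul_apply, map_smul, hT₃, hT₄]
    rfl

end Bounds
end FreeWave

end

theorem mainTheorem5 (d : ℕ) (hd : 3 ≤ d) (hodd : Odd d) (k : ℕ) (s C ε : ℝ)
    (hC : 0 < C) (hε : 0 < ε) :
    (∀ z : ℂ, z.im ≠ 0 →
      IsUnit (FreeWave.freeGeneratorSub d z) ∧
      Set.BijOn (FreeWave.freeGeneratorSub d z)
        (Set.range (FreeWave.toPair : FreeWave.EnergySpace d (s + 1) → _))
        (Set.range (FreeWave.toPair : FreeWave.EnergySpace d s → _))) ∧
    ∃ M : ℝ, ∀ z : ℂ, z.im ≠ 0 → ‖z‖ ≤ C →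
      ∃ T : FreeWave.EnergySpace d s →L[ℂ] FreeWave.EnergySpace d (s + k),
        (∀ f : FreeWave.EnergySpace d s,
          FreeWave.toPair (T f) =
            FreeWave.weightPair d (-k - ε) ((FreeWave.freeResolvent d z ^ k)
              (FreeWave.weightPair d (-k - ε) (FreeWave.toPair f)))) ∧
        ‖T‖ ≤ M := by
  refine ⟨fun z hz => ⟨FreeWave.isUnit_freeGeneratorSub hz,
    FreeWave.bijOn_freeGeneratorSub hz s⟩, ?_⟩
  -- Positivity of ε gives the strict inequality a > k that makes the dyadic series converge.
  have h := FreeWave.exists_weighted_resolvent_bound hd hodd k s C (a := k + ε) (by linarith)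
  rwa [neg_add'] at h
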